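/- **First stability criterion.** Let $n\ge 1$ and $z_1<z_2$. For a positive function $h$ on $[z_1,z_2]$ let $X_h\subset\mathbb R^{n+2}=\mathbb R^{n+1}\times\mathbb R$ be the hypersurface of revolution $\{(h(z)\theta,z):\theta\in S^n,\ z_1\le z\le z_2\}$ between the hyperplanes $\Pi_i=\{z=z_i\}$. Its mean curvature is $$H=\frac1{n+1}\Big[\frac{h_{zz}}{(1+h_z^2)^{3/2}}-\frac{n}{h\sqrt{1+h_z^2}}\Big].$$ $X_h$ is a *half period of an unduloid* if $h$ is smooth and positive, $H$ is constant, $h_z(z_1)=h_z(z_2)=0$, and $h$ is strictly monotone on $[z_1,z_2]$ (it runs from a neck to the next bulge or from a bulge to the next neck). Let $I\subset\mathbb R$ be open and let $X(s)=X_{h(\cdot,s)}$, $s\in I$, be half periods of unduloids, with $h(z,s)$ smooth on $[z_1,z_2]\times I$, parametrized by $s=1-h_{\min}/h_{\max}$, where $h_{\min},h_{\max}$ are the radii of $X(s)$ at the neck and at the bulge. Let $H(s)$ be the mean curvature of $X(s)$, $V(s)$ the $(n+2)$-dimensional volume enclosed by $X(s)$, $\Pi_1$ and $\Pi_2$, and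 let $\lambda_1(s)<\lambda_2(s)<\cdots$ be the eigenvalues of the Neumann problem $$\mathcal L\varphi=-\lambda\varphi \text{ on } [z_1,z_2],\qquad \varphi_z(z_1)=\varphi_z(z_2)=0,$$ $$\mathcal L=\frac{d}{dz}\Big(\frac{h^n}{(1+h_z^2)^{3/2}}\frac{d}{dz}\Big)+\frac{n h^{n-2}}{\sqrt{1+h_z^2}},\qquad h=h(\cdot,s).$$ Call $X(s)$ *stable* if $\frac{d^2}{d\varepsilon^2}\big|_{\varepsilon=0}A(Y_\varepsilon)\ge0$ for the area $A$ of every smooth volume-preserving variation $Y_\varepsilon=\{(f(\varepsilon,\theta,z)\,\theta,z):\theta\in S^n,\ z_1\le z\le z_2\}$, $f>0$, $Y_0=X(s)$ (not necessarily axially symmetric, with boundary free to move in $\Pi_1\cup\Pi_2$), and *unstable* otherwise. Then for every $s\in I$: (I) If $\lambda_1(s)\ge 0$, then $X(s)$ is stable. (II) If $\lambda_1(s)<0<\lambda_2(s)$, then $X(s)$ is stable if $H'(s)V'(s)\ge 0$ and unstable if $H'(s)V'(s)<0$. (III) Let $\lambda_2(s)=0$. (a) If $H'(s)=0$ and $V'(s)\neq0$,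 then $X(s)$ is unstable. (b) If $H'(s)\ne0$, then $X(s)$ is stable if $H'(s)V'(s)\ge0$ and unstable if $H'(s)V'(s)<0$. (IV) If $\lambda_2(s)<0$, then $X(s)$ is unstable. -/

import Mathlib

open MeasureTheory Set
open scoped ContDiff

/-!
Hypersurfaces of `ℝ^(n+2) = ℝ^(n+1) × ℝ` in the slab `a ≤ z ≤ b`, written as radial graphs
`{(f(θ, z) θ, z) : θ ∈ Sⁿ, a ≤ z ≤ b}` with a positive radius function `f`. The axially
symmetric ones are those with `f(θ, z) = h(z)`. All derivatives in `z` are taken in `[a, b]`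
(one-sided at the two ends).
-/

noncomputable section

namespace Unduloid

/-- The cross-section space `ℝ^(n+1)`, whose unit sphere is `Sⁿ`. -/
abbrev Cross (n : ℕ) : Type := EuclideanSpace ℝ (Fin (n + 1))

/-- `d/dz` on the interval `[a, b]`. -/
def dz (a b : ℝ) (u : ℝ → ℝ) : ℝ → ℝ := derivWithin u (Icc a b)

/-- Squared norm of the gradient along the sphere `Sⁿ` at the unit vector `θ`, of a function
given in a neighbourhood of `θ`: the full gradient minus its radial component. -/
def sphGradSq {n : ℕ} (g : Cross n → ℝ) (θ : Cross n) : ℝ :=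
  ‖fderiv ℝ g θ‖ ^ 2 - (fderiv ℝ g θ θ) ^ 2

/-- The `(n+1)`-dimensional area of the radial graph of `f`,
`∫_{Sⁿ} ∫_a^b fⁿ √(1 + f_z² + |∇_{Sⁿ} f|² / f²) dz dθ`.
The measure `volume.toSphere` is the surface measure of `Sⁿ`. -/
def area (n : ℕ) (a b : ℝ) (f : Cross n → ℝ → ℝ) : ℝ :=
  ∫ θ : Metric.sphere (0 : Cross n) 1,
    (∫ z in a..b, f θ z ^ n *
      √(1 + dz a b (f θ) z ^ 2 + sphGradSq (fun x => f x z) (θ : Cross n) / f θ z ^ 2))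
    ∂(volume : Measure (Cross n)).toSphere

/-- The `(n+2)`-dimensional volume enclosed by the radial graph of `f` and the two hyperplanes,
`(n+1)⁻¹ ∫_{Sⁿ} ∫_a^b f^(n+1) dz dθ`. -/
def enclosedVolume (n : ℕ) (a b : ℝ) (f : Cross n → ℝ → ℝ) : ℝ :=
  ((n : ℝ) + 1)⁻¹ * ∫ θ : Metric.sphere (0 : Cross n) 1,
    (∫ z in a..b, f θ z ^ (n + 1)) ∂(volume : Measure (Cross n)).toSphere

/-- The volume enclosed by the hypersurface of revolution with profile `h`. -/
def profileVolume (n : ℕ) (a b : ℝ) (h : ℝ → ℝ) : ℝ :=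
  enclosedVolume n a b (fun _ z => h z)

/-- The mean curvature of the hypersurface of revolution with profile `h`. -/
def meanCurvature (n : ℕ) (a b : ℝ) (h : ℝ → ℝ) (z : ℝ) : ℝ :=
  1 / ((n : ℝ) + 1) *
    (dz a b (dz a b h) z / √(1 + dz a b h z ^ 2) ^ 3
      - n / (h z * √(1 + dz a b h z ^ 2)))

/-- The profile `h` on `[a, b]` generates a half period of an unduloid of constant mean
curvature `H`: it is positive, has constant mean curvature, meets both hyperplanes
perpendicularly, and runs from a neck to the next bulge or from a bulge to the next neck. -/
structure IsHalfPeriod (n : ℕ) (a b : ℝ) (h : ℝ → ℝ) (H : ℝ) : Prop where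
  smooth : ContDiffOn ℝ ∞ h (Icc a b)
  pos : ∀ z ∈ Icc a b, 0 < h z
  cmc : ∀ z ∈ Icc a b, meanCurvature n a b h z = H
  left : dz a b h a = 0
  right : dz a b h b = 0
  mono : StrictMonoOn h (Icc a b) ∨ StrictAntiOn h (Icc a b)

/-- The non-uniformness parameter `1 - h_min / h_max` of a half period; neck and bulge lie on
the two hyperplanes. -/
def nonuniformness (a b : ℝ) (h : ℝ → ℝ) : ℝ :=
  1 - min (h a) (h b) / max (h a) (h b)

/-- `σ = hⁿ / (1 + h_z²)^(3/2)`. -/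
def sigma (n : ℕ) (a b : ℝ) (h : ℝ → ℝ) (z : ℝ) : ℝ :=
  h z ^ n / √(1 + dz a b h z ^ 2) ^ 3

/-- The operator `𝓛 u = (σ u_z)_z + n h^(n-2) / √(1 + h_z²) u`. -/
def jacobiOp (n : ℕ) (a b : ℝ) (h u : ℝ → ℝ) (z : ℝ) : ℝ :=
  dz a b (fun y => sigma n a b h y * dz a b u y) z
    + n * h z ^ ((n : ℤ) - 2) / √(1 + dz a b h z ^ 2) * u z

/-- `μ` is an eigenvalue of `𝓛 φ = -μ φ` on `[a, b]`, `φ_z(a) = φ_z(b) = 0`. -/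
def IsNeumannEigenvalue (n : ℕ) (a b : ℝ) (h : ℝ → ℝ) (μ : ℝ) : Prop :=
  ∃ φ : ℝ → ℝ, ContDiffOn ℝ 2 φ (Icc a b) ∧ (∃ z ∈ Icc a b, φ z ≠ 0) ∧
    (∀ z ∈ Icc a b, jacobiOp n a b h φ z = -μ * φ z) ∧
    dz a b φ a = 0 ∧ dz a b φ b = 0

/-- The `i`-th eigenvalue (`i = 1, 2, …`, in increasing order): the least eigenvalue `μ` such
that at least `i` eigenvalues are `≤ μ`. All eigenvalues of this Sturm–Liouville problem are
simple, so distinct values are counted. -/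
def neumannEigenvalue (n : ℕ) (a b : ℝ) (h : ℝ → ℝ) (i : ℕ) : ℝ :=
  sInf {μ | IsNeumannEigenvalue n a b h μ ∧
    (i : ℕ∞) ≤ {ν | IsNeumannEigenvalue n a b h ν ∧ ν ≤ μ}.encard}

/-- `f` is a smooth volume-preserving variation, with parameter `ε ∈ (-δ, δ)`, of the
hypersurface of revolution with profile `h`; the varied hypersurfaces need not be axially
symmetric, and their boundaries move freely in the two hyperplanes. A smooth function on `Sⁿ` is
given by a smooth function on `ℝ^(n+1) \ {0}`, of which only the values on `Sⁿ` matter. -/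
structure IsVolumePreservingVariation (n : ℕ) (a b : ℝ) (h : ℝ → ℝ) (δ : ℝ)
    (f : ℝ → Cross n → ℝ → ℝ) : Prop where
  smooth : ContDiffOn ℝ ∞ (fun p : ℝ × Cross n × ℝ => f p.1 p.2.1 p.2.2)
    (Ioo (-δ) δ ×ˢ ({0}ᶜ : Set (Cross n)) ×ˢ Icc a b)
  pos : ∀ ε ∈ Ioo (-δ) δ, ∀ θ ∈ Metric.sphere (0 : Cross n) 1, ∀ z ∈ Icc a b, 0 < f ε θ z
  start : ∀ θ ∈ Metric.sphere (0 : Cross n) 1, ∀ z ∈ Icc a b, f 0 θ z = h z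
  volume_eq : ∀ ε ∈ Ioo (-δ) δ, enclosedVolume n a b (f ε) = enclosedVolume n a b (f 0)

/-- Stability: the second variation of area is non-negative for every volume-preserving
variation. -/
def IsStable (n : ℕ) (a b : ℝ) (h : ℝ → ℝ) : Prop :=
  ∀ δ > 0, ∀ f : ℝ → Cross n → ℝ → ℝ, IsVolumePreservingVariation n a b h δ f →
    0 ≤ iteratedDeriv 2 (fun ε => area n a b (f ε)) 0

end Unduloid

end

/-!
Stability of half periods of unduloids. The proof reduces stability to a one-dimensional quadratic
form under one linear constraint, and decides its sign by means of two test fields: the ground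
state of the Jacobi operator and the field `w = ∂h/∂s` generated by the given family.

*Reduction to one variable.* For a volume-preserving variation with field `u`, the second derivative
of area is `∫_{Sⁿ} ∫ (σ u_z² - q u² + (q / n) |∇_{Sⁿ} u|²) dz dθ`, where `σ` and `q` are the
coefficients of the operator `𝓛` (`area_second_variation`); the second parameter derivative of the
variation drops out because the mean curvature is constant. By the Poincaré inequality on the sphere
with its sharp constant `n` (`sphere_poincare`), averaging over the parallels does not increase
this expression (`energy_average_le`). Hence stability follows once the energy form
`B(v, v) = ∫ (σ v_z² - q v²) dz` is non-negative on the functions of `z` with `∫ hⁿ v dz = 0`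
(`isStable_of_energy_nonneg`). Conversely a smooth such `v` with `B(v, v) < 0` is the field of a
variation that preserves volume exactly, with radii `(hⁿ⁺¹ + (n + 1) ε hⁿ v)^(1 / (n + 1))`
(`not_isStable_of_energy_neg`).

*The Poincaré inequality.* On the line, `∫ (f - f 0)² e^{-x²/2} ≤ ∫ f'² e^{-x²/2}` follows from
completing a square; the variance inequality tensorizes to `ℝ^(n+1)`, and applied to the
positively homogeneous function `‖x‖ g(x / ‖x‖)` it becomes the inequality for `g` on the sphere.

*The spectrum.* `B` is bounded below by the lowest eigenvalue, and on the orthogonal complement of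
the ground state by the second one (`SLData.exists_first_eigenfunction`): were the infimum of the
Rayleigh quotient not an eigenvalue, the resolvent there would be bounded, and the Cauchy–Schwarz
inequality for the shifted form would push the infimum up. Testing with the constant `1` shows that
the lowest eigenvalue is always negative, so that the case `λ₁ ≥ 0` does not occur.

*The criterion.* Differentiating the weak Euler–Lagrange equation along the family gives
`B(w, v) = -(n + 1) H' ∫ hⁿ v dz` for all `v`, while `V'` is the area of `Sⁿ` times `∫ hⁿ w dz`
(`exists_family_field`); thus `B(w, w)` has the sign of `-H' V'`. If `λ₂ ≥ 0` and `H' ≠ 0`, then the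
constraint says that `v` is `B`-orthogonal to `w`, and for `B(w, w) ≤ 0` this excludes
`B(v, v) < 0`, since `B` has only one negative direction. If `B(w, w) > 0`, or if `H' = 0 ≠ V'`,
then the ground state corrected by a multiple of `w` satisfies the constraint and is still
negative. If `λ₂ > 0`, then `H' ≠ 0`, for otherwise `w`, which is non-zero by the parametrization,
would be in the kernel of `B`. If `λ₂ < 0`, then two negative directions meet the constraint.
-/

noncomputable section

namespace Unduloid

/-! ### Linear first-order systems on an interval -/

/-- A priori bound for the system `u' = α (y + F)`, `y' = β u`. The inhomogeneity enters only
through the supremum of the primitive `F`. -/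
lemma linearSystem_bound {a b : ℝ} {α β : ℝ → ℝ} (hα : ContinuousOn α (Icc a b))
    (hβ : ContinuousOn β (Icc a b)) :
    ∃ C : ℝ, 0 < C ∧ ∀ (F u y : ℝ → ℝ) (x m : ℝ), (∀ z ∈ Icc a b, |F z| ≤ m) →
      |u a| ≤ x → |y a| ≤ x →
      ∀ α' β' : ℝ → ℝ, (∀ z ∈ Icc a b, |α' z| ≤ (|y z| + |F z|) * |α z|) →
      (∀ z ∈ Icc a b, |β' z| ≤ |β z| * |u z|) →
      (∀ z ∈ Icc a b, HasDerivWithinAt u (α' z) (Icc a b) z) →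
      (∀ z ∈ Icc a b, HasDerivWithinAt y (β' z) (Icc a b) z) →
      ∀ z ∈ Icc a b, |u z| ≤ C * (x + m) ∧ |y z| ≤ C * (x + m) := by
  obtain ⟨A, hA⟩ := isCompact_Icc.exists_bound_of_continuousOn hα
  obtain ⟨B, hB⟩ := isCompact_Icc.exists_bound_of_continuousOn hβ
  set K : ℝ := max 1 (max A B) with hK
  have hK0 : 0 < K := lt_of_lt_of_le one_pos (le_max_left _ _)
  have hAK : A ≤ K := (le_max_left _ _).trans (le_max_right _ _)
  have hBK : B ≤ K := (le_max_right _ _).trans (le_max_right _ _)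
  refine ⟨Real.exp (K * (b - a)), Real.exp_pos _, ?_⟩
  intro F u y x m hF hu0 hy0 α' β' hα' hβ' hu hy z hz
  have hab : a ≤ b := hz.1.trans hz.2
  have hm : 0 ≤ m := (abs_nonneg _).trans (hF z hz)
  have hx : 0 ≤ x := (abs_nonneg _).trans hu0
  have hd : ∀ t ∈ Icc a b, HasDerivWithinAt (fun t => (u t, y t)) (α' t, β' t) (Icc a b) t :=
    fun t ht => (hu t ht).prodMk (hy t ht)
  have key := norm_le_gronwallBound_of_norm_deriv_right_le
    (f := fun t => (u t, y t)) (f' := fun t => (α' t, β' t)) (δ := x) (K := K) (ε := K * m)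
    (a := a) (b := b) (fun t ht => (hd t ht).continuousWithinAt)
    (fun t ht => ((hd t (Ico_subset_Icc_self ht)).mono_of_mem_nhdsWithin
      (Icc_mem_nhdsGE_of_mem ht)))
    (by simp [Prod.norm_def, hu0, hy0]) ?_ z hz
  · rw [gronwallBound_of_K_ne_0 hK0.ne'] at key
    have h1 : Real.exp (K * (z - a)) ≤ Real.exp (K * (b - a)) := by
      apply Real.exp_le_exp.2; gcongr; exact hz.2
    have h2 : K * m / K = m := by field_simp
    have h3 : ‖(u z, y z)‖ ≤ Real.exp (K * (b - a)) * (x + m) := by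
      refine key.trans ?_
      rw [h2]
      nlinarith
    simp only [Prod.norm_def, Real.norm_eq_abs, sup_le_iff] at h3
    exact h3
  · intro t ht
    have ht' := Ico_subset_Icc_self ht
    have hut : |u t| ≤ ‖(u t, y t)‖ := by simp [Prod.norm_def]
    have hyt : |y t| ≤ ‖(u t, y t)‖ := by simp [Prod.norm_def]
    have hAt : |α t| ≤ K := (hA t ht').trans hAK
    have hBt : |β t| ≤ K := (hB t ht').trans hBK
    simp only [Prod.norm_def, Real.norm_eq_abs, sup_le_iff] at hut hyt ⊢
    set N := max |u t| |y t|
    have hN : 0 ≤ N := (abs_nonneg _).trans hut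
    constructor
    · refine (hα' t ht').trans ?_
      have := hF t ht'
      calc (|y t| + |F t|) * |α t| ≤ (N + m) * K := by gcongr
        _ = K * N + K * m := by ring
    · refine (hβ' t ht').trans ?_
      calc |β t| * |u t| ≤ K * N := by gcongr
        _ ≤ K * N + K * m := by
          have := mul_nonneg hK0.le hm
          linarith

/-- Truncation of a real number to `[-R, R]`. -/
def clip (R x : ℝ) : ℝ := max (-R) (min x R)

lemma lipschitzWith_clip (R : ℝ) : LipschitzWith 1 (clip R) :=
  (LipschitzWith.id.min_const R).const_max (-R)

lemma abs_clip_le {R : ℝ} (hR : 0 ≤ R) (x : ℝ) : |clip R x| ≤ R := by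
  unfold clip
  rw [abs_le]
  exact ⟨le_max_left _ _, max_le (by linarith) (min_le_right _ _)⟩

lemma abs_clip_le_abs {R : ℝ} (hR : 0 ≤ R) (x : ℝ) : |clip R x| ≤ |x| := by
  unfold clip
  rw [abs_le]
  have h' : -|x| ≤ R := by linarith [abs_nonneg x]
  refine ⟨?_, max_le (by linarith [abs_nonneg x]) ((min_le_left _ _).trans (le_abs_self x))⟩
  rcases le_total x R with h | h
  · rw [min_eq_left h]
    exact (neg_abs_le x).trans (le_max_right _ _)
  · rw [min_eq_right h]
    exact h'.trans (le_max_right _ _)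

lemma clip_of_abs_le {R x : ℝ} (h : |x| ≤ R) : clip R x = x := by
  rw [abs_le] at h
  unfold clip
  rw [min_eq_left h.2, max_eq_right h.1]

/-- Global solvability of linear systems: the right-hand side is truncated outside a ball which,
by the a priori bound, the solution never leaves. -/
lemma linearSystem_exists {a b : ℝ} (hab : a ≤ b) {α β F : ℝ → ℝ}
    (hα : ContinuousOn α (Icc a b)) (hβ : ContinuousOn β (Icc a b))
    (hF : ContinuousOn F (Icc a b)) (u₀ y₀ : ℝ) :
    ∃ u y : ℝ → ℝ, u a = u₀ ∧ y a = y₀ ∧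
      (∀ z ∈ Icc a b, HasDerivWithinAt u ((y z + F z) * α z) (Icc a b) z) ∧
      (∀ z ∈ Icc a b, HasDerivWithinAt y (β z * u z) (Icc a b) z) := by
  obtain ⟨C, hC, hbound⟩ := linearSystem_bound hα hβ
  obtain ⟨m, hm⟩ := isCompact_Icc.exists_bound_of_continuousOn hF
  obtain ⟨A, hA⟩ := isCompact_Icc.exists_bound_of_continuousOn hα
  obtain ⟨B, hB⟩ := isCompact_Icc.exists_bound_of_continuousOn hβ
  have hm0 : 0 ≤ m := (norm_nonneg _).trans (hm a (left_mem_Icc.2 hab))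
  have hA0 : 0 ≤ A := (norm_nonneg _).trans (hA a (left_mem_Icc.2 hab))
  have hB0 : 0 ≤ B := (norm_nonneg _).trans (hB a (left_mem_Icc.2 hab))
  simp only [Real.norm_eq_abs] at hm hA hB
  set x : ℝ := max |u₀| |y₀|
  have hx : 0 ≤ x := (abs_nonneg _).trans (le_max_left _ _)
  set R : ℝ := C * (x + m) with hR
  have hR0 : 0 ≤ R := by positivity
  let v : ℝ → ℝ × ℝ → ℝ × ℝ := fun t p => ((clip R p.2 + F t) * α t, β t * clip R p.1)
  let K : NNReal := ⟨max A B, le_max_of_le_left hA0⟩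
  let L : NNReal := ⟨max ((R + m) * A) (B * R), le_max_of_le_left (by positivity)⟩
  let r : NNReal := ⟨L * (b - a), mul_nonneg L.2 (by linarith)⟩
  have hPL : IsPicardLindelof v (tmin := a) (tmax := b) ⟨a, left_mem_Icc.2 hab⟩ (u₀, y₀) r 0
      L K := by
    refine ⟨?_, ?_, ?_, ?_⟩
    · intro t ht
      refine LipschitzWith.lipschitzOnWith (LipschitzWith.of_dist_le_mul fun p p' => ?_)
      have hKc : (K : ℝ) = max A B := rfl
      have h1 : |clip R p.1 - clip R p'.1| ≤ dist p p' := by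
        have := (lipschitzWith_clip R).dist_le_mul p.1 p'.1
        rw [Real.dist_eq] at this
        simp only [NNReal.coe_one, one_mul] at this
        exact this.trans (le_max_left _ _)
      have h2 : |clip R p.2 - clip R p'.2| ≤ dist p p' := by
        have := (lipschitzWith_clip R).dist_le_mul p.2 p'.2
        rw [Real.dist_eq] at this
        simp only [NNReal.coe_one, one_mul] at this
        exact this.trans (le_max_right _ _)
      rw [Prod.dist_eq (x := v t p)]
      refine max_le ?_ ?_
      · rw [Real.dist_eq]
        have : (v t p).1 - (v t p').1 = α t * (clip R p.2 - clip R p'.2) := by simp only [v]; ring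
        rw [this, abs_mul]
        have := (hA t ht).trans (le_max_left A B)
        rw [hKc]; gcongr
      · rw [Real.dist_eq]
        have : (v t p).2 - (v t p').2 = β t * (clip R p.1 - clip R p'.1) := by simp only [v]; ring
        rw [this, abs_mul]
        have := (hB t ht).trans (le_max_right A B)
        rw [hKc]; gcongr
    · intro p _
      exact ((continuousOn_const.add hF).mul hα).prodMk (hβ.mul continuousOn_const)
    · intro t ht p _
      have hLc : (L : ℝ) = max ((R + m) * A) (B * R) := rfl
      rw [hLc, Prod.norm_def]
      refine max_le_max ?_ ?_
      · rw [Real.norm_eq_abs, abs_mul]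
        have := (abs_add_le (clip R p.2) (F t)).trans (add_le_add (abs_clip_le hR0 p.2) (hm t ht))
        have := hA t ht
        gcongr
      · rw [Real.norm_eq_abs, abs_mul]
        have := abs_clip_le hR0 p.1
        have := hB t ht
        gcongr
    · have : max (b - a) (a - a) = b - a := max_eq_left (by linarith)
      simp only [this, NNReal.coe_zero, sub_zero]
      exact le_rfl
  obtain ⟨γ, hγ0, hγ⟩ := hPL.exists_eq_forall_mem_Icc_hasDerivWithinAt₀
  have hu : ∀ z ∈ Icc a b, HasDerivWithinAt (fun t => (γ t).1)
      ((clip R (γ z).2 + F z) * α z) (Icc a b) z := fun z hz => (hγ z hz).fst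
  have hy : ∀ z ∈ Icc a b, HasDerivWithinAt (fun t => (γ t).2)
      (β z * clip R (γ z).1) (Icc a b) z := fun z hz => (hγ z hz).snd
  have h0 : γ a = (u₀, y₀) := hγ0
  have hsol : ∀ z ∈ Icc a b, |(γ z).1| ≤ R ∧ |(γ z).2| ≤ R := by
    refine hbound F _ _ x m hm ?_ ?_ _ _ (fun z hz => ?_) (fun z hz => ?_) hu hy
    · simp only [h0]; exact le_max_left _ _
    · simp only [h0]; exact le_max_right _ _
    · rw [abs_mul]
      gcongr
      exact (abs_add_le _ _).trans (add_le_add (abs_clip_le_abs hR0 _) le_rfl)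
    · rw [abs_mul]
      exact mul_le_mul_of_nonneg_left (abs_clip_le_abs hR0 _) (abs_nonneg _)
  refine ⟨fun t => (γ t).1, fun t => (γ t).2, by simp [h0], by simp [h0], fun z hz => ?_,
    fun z hz => ?_⟩
  · have := hu z hz
    rwa [clip_of_abs_le (hsol z hz).2] at this
  · have := hy z hz
    rwa [clip_of_abs_le (hsol z hz).1] at this

/-! ### Continuously differentiable functions on an interval and their quadratic forms -/

/-- Pairs `(u, u')` of functions that are continuous on `[a, b]` and such that `u'` is the
derivative of `u` in the open interval. Recording the derivative makes the energy form below
bilinear. -/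
def C1Space (a b : ℝ) : Submodule ℝ ((ℝ → ℝ) × (ℝ → ℝ)) where
  carrier := {u | ContinuousOn u.1 (Icc a b) ∧ ContinuousOn u.2 (Icc a b) ∧
    ∀ z ∈ Ioo a b, HasDerivAt u.1 (u.2 z) z}
  add_mem' := fun hu hv => ⟨hu.1.add hv.1, hu.2.1.add hv.2.1,
    fun z hz => (hu.2.2 z hz).add (hv.2.2 z hz)⟩
  zero_mem' := ⟨continuousOn_const, continuousOn_const, fun z _ => hasDerivAt_const z 0⟩
  smul_mem' := fun c _ hu => ⟨hu.1.const_smul c, hu.2.1.const_smul c,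
    fun z hz => (hu.2.2 z hz).const_smul c⟩

section C1Space

variable {a b : ℝ}

lemma C1Space.cont (u : C1Space a b) : ContinuousOn u.1.1 (Icc a b) := u.2.1
lemma C1Space.cont' (u : C1Space a b) : ContinuousOn u.1.2 (Icc a b) := u.2.2.1
lemma C1Space.hasDerivAt (u : C1Space a b) {z : ℝ} (hz : z ∈ Ioo a b) :
    HasDerivAt u.1.1 (u.1.2 z) z := u.2.2.2 z hz

lemma mem_C1Space_of_hasDerivWithinAt {u u' : ℝ → ℝ} (hu' : ContinuousOn u' (Icc a b))
    (h : ∀ z ∈ Icc a b, HasDerivWithinAt u (u' z) (Icc a b) z) : (u, u') ∈ C1Space a b :=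
  ⟨fun z hz => (h z hz).continuousWithinAt, hu', fun z hz =>
    (h z (Ioo_subset_Icc_self hz)).hasDerivAt (Icc_mem_nhds hz.1 hz.2)⟩

/-- The constant function `1`. -/
def C1Space.one (a b : ℝ) : C1Space a b :=
  ⟨(fun _ => 1, fun _ => 0), continuousOn_const, continuousOn_const,
    fun z _ => hasDerivAt_const z 1⟩

lemma intervalIntegrable_of_continuousOn_Icc (hab : a ≤ b) {f : ℝ → ℝ}
    (hf : ContinuousOn f (Icc a b)) : IntervalIntegrable f volume a b :=
  ContinuousOn.intervalIntegrable (by rwa [uIcc_of_le hab])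

lemma intervalIntegrable_mul (hab : a ≤ b) {f g : ℝ → ℝ} (hf : ContinuousOn f (Icc a b))
    (hg : ContinuousOn g (Icc a b)) : IntervalIntegrable (fun z => f z * g z) volume a b :=
  intervalIntegrable_of_continuousOn_Icc hab (hf.mul hg)

/-- Integration by parts against a `C¹` function `y` given with its derivative on `[a, b]`. -/
lemma integral_mul_deriv_C1Space (hab : a ≤ b) {y y' : ℝ → ℝ}
    (hy : (y, y') ∈ C1Space a b) (v : C1Space a b) :
    ∫ z in a..b, y z * v.1.2 z =
      y b * v.1.1 b - y a * v.1.1 a - ∫ z in a..b, y' z * v.1.1 z := by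
  refine intervalIntegral.integral_mul_deriv_eq_deriv_mul_of_hasDerivAt ?_ ?_ ?_ ?_ ?_ ?_
  · rw [uIcc_of_le hab]; exact hy.1
  · rw [uIcc_of_le hab]; exact (C1Space.cont v)
  · rw [min_eq_left hab, max_eq_right hab]; exact fun z hz => hy.2.2 z hz
  · rw [min_eq_left hab, max_eq_right hab]; exact fun z hz => C1Space.hasDerivAt v hz
  · exact intervalIntegrable_of_continuousOn_Icc hab hy.2.1
  · exact intervalIntegrable_of_continuousOn_Icc hab (C1Space.cont' v)

/-- The product of two `C¹` functions. -/
def C1Space.mul (u v : C1Space a b) : C1Space a b :=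
  ⟨(fun z => u.1.1 z * v.1.1 z, fun z => u.1.2 z * v.1.1 z + u.1.1 z * v.1.2 z),
    (C1Space.cont u).mul (C1Space.cont v),
    ((C1Space.cont' u).mul (C1Space.cont v)).add ((C1Space.cont u).mul (C1Space.cont' v)),
    fun _ hz => (C1Space.hasDerivAt u hz).mul (C1Space.hasDerivAt v hz)⟩

/-- The coefficients `σ > 0`, `q` of a regular Sturm–Liouville operator
`u ↦ (σ u')' + q u` on `[a, b]`. -/
structure SLData (a b : ℝ) where
  /-- The leading coefficient. -/
  σ : ℝ → ℝ
  /-- The potential. -/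
  q : ℝ → ℝ
  lt : a < b
  σ_smooth : ContDiffOn ℝ ∞ σ (Icc a b)
  σ_pos : ∀ z ∈ Icc a b, 0 < σ z
  q_smooth : ContDiffOn ℝ ∞ q (Icc a b)

/-- The functional `u ↦ ∫ ρ u`. -/
def weightedIntegral (hab : a ≤ b) (ρ : ℝ → ℝ) (hρ : ContinuousOn ρ (Icc a b)) :
    C1Space a b →ₗ[ℝ] ℝ where
  toFun u := ∫ z in a..b, ρ z * u.1.1 z
  map_add' u v := by
    rw [← intervalIntegral.integral_add
      (intervalIntegrable_mul hab hρ (C1Space.cont u))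
      (intervalIntegrable_mul hab hρ (C1Space.cont v))]
    simp [mul_add]
  map_smul' c u := by
    simp only [SetLike.val_smul, Prod.smul_fst, Pi.smul_apply, smul_eq_mul, RingHom.id_apply]
    rw [← intervalIntegral.integral_const_mul]
    congr 1; ext z; ring

/-- The `L²` inner product on `[a, b]`. -/
def massForm (hab : a ≤ b) : LinearMap.BilinForm ℝ (C1Space a b) :=
  LinearMap.mk₂ ℝ (fun u v => ∫ z in a..b, u.1.1 z * v.1.1 z)
    (fun u v w => by
      rw [← intervalIntegral.integral_add
        (intervalIntegrable_mul hab (C1Space.cont u) (C1Space.cont w))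
        (intervalIntegrable_mul hab (C1Space.cont v) (C1Space.cont w))]
      simp [add_mul])
    (fun c u w => by
      simp only [SetLike.val_smul, Prod.smul_fst, Pi.smul_apply, smul_eq_mul]
      rw [← intervalIntegral.integral_const_mul]
      congr 1; ext z; ring)
    (fun u v w => by
      rw [← intervalIntegral.integral_add
        (intervalIntegrable_mul hab (C1Space.cont u) (C1Space.cont v))
        (intervalIntegrable_mul hab (C1Space.cont u) (C1Space.cont w))]
      simp [mul_add])
    (fun c u w => by
      simp only [SetLike.val_smul, Prod.smul_fst, Pi.smul_apply, smul_eq_mul]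
      rw [← intervalIntegral.integral_const_mul]
      congr 1; ext z; ring)

namespace SLData

variable (S : SLData a b)

lemma σ_cont : ContinuousOn S.σ (Icc a b) := S.σ_smooth.continuousOn
lemma q_cont : ContinuousOn S.q (Icc a b) := S.q_smooth.continuousOn

lemma cont_energy (u v : C1Space a b) :
    ContinuousOn (fun z => S.σ z * u.1.2 z * v.1.2 z - S.q z * u.1.1 z * v.1.1 z) (Icc a b) :=
  ((S.σ_cont.mul (C1Space.cont' u)).mul (C1Space.cont' v)).sub
    ((S.q_cont.mul (C1Space.cont u)).mul (C1Space.cont v))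

/-- The energy form `∫ σ u' v' - q u v`. -/
def energy : LinearMap.BilinForm ℝ (C1Space a b) :=
  LinearMap.mk₂ ℝ (fun u v => ∫ z in a..b,
      (S.σ z * u.1.2 z * v.1.2 z - S.q z * u.1.1 z * v.1.1 z))
    (fun u v w => by
      rw [← intervalIntegral.integral_add
        (intervalIntegrable_of_continuousOn_Icc S.lt.le (S.cont_energy u w))
        (intervalIntegrable_of_continuousOn_Icc S.lt.le (S.cont_energy v w))]
      congr 1; ext z
      simp only [Submodule.coe_add, Prod.fst_add, Prod.snd_add, Pi.add_apply]; ring)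
    (fun c u w => by
      rw [smul_eq_mul, ← intervalIntegral.integral_const_mul]
      congr 1; ext z
      simp only [SetLike.val_smul, Prod.smul_fst, Prod.smul_snd, Pi.smul_apply, smul_eq_mul]; ring)
    (fun u v w => by
      rw [← intervalIntegral.integral_add
        (intervalIntegrable_of_continuousOn_Icc S.lt.le (S.cont_energy u v))
        (intervalIntegrable_of_continuousOn_Icc S.lt.le (S.cont_energy u w))]
      congr 1; ext z
      simp only [Submodule.coe_add, Prod.fst_add, Prod.snd_add, Pi.add_apply]; ring)
    (fun c u w => by
      rw [smul_eq_mul, ← intervalIntegral.integral_const_mul]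
      congr 1; ext z
      simp only [SetLike.val_smul, Prod.smul_fst, Prod.smul_snd, Pi.smul_apply, smul_eq_mul]; ring)

/-- The `L²` inner product. -/
abbrev mass : LinearMap.BilinForm ℝ (C1Space a b) := massForm S.lt.le

lemma energy_apply (u v : C1Space a b) : S.energy u v = ∫ z in a..b,
    (S.σ z * u.1.2 z * v.1.2 z - S.q z * u.1.1 z * v.1.1 z) := rfl

lemma mass_apply (u v : C1Space a b) : S.mass u v = ∫ z in a..b, u.1.1 z * v.1.1 z := rfl

lemma energy_comm (u v : C1Space a b) : S.energy u v = S.energy v u := by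
  simp only [energy_apply]; congr 1; ext z; ring

lemma mass_comm (u v : C1Space a b) : S.mass u v = S.mass v u := by
  simp only [mass_apply]; congr 1; ext z; ring

lemma mass_nonneg (u : C1Space a b) : 0 ≤ S.mass u u :=
  intervalIntegral.integral_nonneg S.lt.le fun _ _ => mul_self_nonneg _

lemma mass_pos (u : C1Space a b) (hu : ∃ z ∈ Icc a b, u.1.1 z ≠ 0) : 0 < S.mass u u := by
  obtain ⟨z, hz, hne⟩ := hu
  exact intervalIntegral.integral_pos S.lt ((C1Space.cont u).mul (C1Space.cont u))
    (fun x _ => mul_self_nonneg _) ⟨z, hz, mul_self_pos.2 hne⟩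

/-- The energy is bounded below relative to the `L²` norm. -/
lemma exists_lower_bound : ∃ C : ℝ, 0 < C ∧ ∀ u : C1Space a b, -C * S.mass u u ≤ S.energy u u := by
  obtain ⟨C, hC⟩ := isCompact_Icc.exists_bound_of_continuousOn S.q_cont
  refine ⟨max C 1, by positivity, fun u => ?_⟩
  rw [energy_apply, mass_apply, ← intervalIntegral.integral_const_mul]
  refine intervalIntegral.integral_mono_on S.lt.le
    (intervalIntegrable_of_continuousOn_Icc S.lt.le
      (continuousOn_const.mul ((C1Space.cont u).mul (C1Space.cont u))))
    (intervalIntegrable_of_continuousOn_Icc S.lt.le (S.cont_energy u u)) fun z hz => ?_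
  have h1 : S.q z ≤ max C 1 := ((le_abs_self _).trans (hC z hz)).trans (le_max_left _ _)
  have h2 := mul_le_mul_of_nonneg_right h1 (mul_self_nonneg (u.1.1 z))
  have h3 := mul_nonneg (S.σ_pos z hz).le (mul_self_nonneg (u.1.2 z))
  nlinarith

lemma abs_integral_le (hab : a ≤ b) (u : C1Space a b) {z : ℝ} (hz : z ∈ Icc a b) :
    |∫ t in a..z, u.1.1 t| ≤ ∫ t in a..b, |u.1.1 t| := by
  have hi := intervalIntegrable_of_continuousOn_Icc hab (C1Space.cont u).abs
  refine (intervalIntegral.abs_integral_le_integral_abs hz.1).trans ?_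
  exact intervalIntegral.integral_mono_interval le_rfl hz.1 hz.2
    (Filter.Eventually.of_forall fun _ => abs_nonneg _) hi

/-- Cauchy–Schwarz for the `L¹` norm on a bounded interval. -/
lemma sq_integral_abs_le (u : C1Space a b) :
    (∫ t in a..b, |u.1.1 t|) ^ 2 ≤ (b - a) * S.mass u u := by
  set m := ∫ t in a..b, |u.1.1 t| with hm
  have hba : 0 < b - a := sub_pos.2 S.lt
  have h1 : 0 ≤ ∫ t in a..b, (|u.1.1 t| - m / (b - a)) ^ 2 :=
    intervalIntegral.integral_nonneg S.lt.le fun z _ => sq_nonneg _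
  have i1 := intervalIntegrable_of_continuousOn_Icc S.lt.le (C1Space.cont u).abs
  have i2 := intervalIntegrable_mul S.lt.le (C1Space.cont u) (C1Space.cont u)
  have h2 : ∫ t in a..b, (|u.1.1 t| - m / (b - a)) ^ 2 =
      S.mass u u - 2 * (m / (b - a)) * m + (b - a) * (m / (b - a)) ^ 2 := by
    have : ∀ t, (|u.1.1 t| - m / (b - a)) ^ 2 = (u.1.1 t * u.1.1 t -
        (2 * (m / (b - a))) * |u.1.1 t|) + (m / (b - a)) ^ 2 := by
      intro t
      rw [sub_sq, sq_abs]; ring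
    simp_rw [this]
    rw [intervalIntegral.integral_add (i2.sub (i1.const_mul _)) intervalIntegrable_const,
      intervalIntegral.integral_sub i2 (i1.const_mul _), intervalIntegral.integral_const_mul,
      intervalIntegral.integral_const, ← hm, mass_apply, smul_eq_mul]
  rw [h2] at h1
  have h3 : S.mass u u - 2 * (m / (b - a)) * m + (b - a) * (m / (b - a)) ^ 2 =
      S.mass u u - m ^ 2 / (b - a) := by field_simp; ring
  rw [h3] at h1
  have := (div_le_iff₀ hba).1 (sub_nonneg.1 h1)
  linarith

end SLData

end C1Space

/-! ### Linear algebra of symmetric forms -/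

section Forms

variable {X : Type*} [AddCommGroup X] [Module ℝ X]

/-- The Cauchy–Schwarz inequality for a symmetric form that is non-negative on a subspace. -/
lemma sq_le_mul_of_nonneg_on {B : LinearMap.BilinForm ℝ X} (hB : ∀ x y, B x y = B y x)
    {T : Submodule ℝ X} (hpos : ∀ x ∈ T, 0 ≤ B x x) {x y : X} (hx : x ∈ T) (hy : y ∈ T) :
    B x y ^ 2 ≤ B x x * B y y := by
  have h : ∀ t : ℝ, 0 ≤ B y y * (t * t) + (2 * B x y) * t + B x x := by
    intro t
    have := hpos (x + t • y) (T.add_mem hx (T.smul_mem t hy))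
    simp only [map_add, map_smul, LinearMap.add_apply, LinearMap.smul_apply, smul_eq_mul,
      hB y x] at this
    linarith
  have := discrim_le_zero h
  rw [discrim] at this
  linarith

/-- If the quadratic form `B` has infimum `μ` relative to `M` on a subspace `T`, then
`B - μ M` cannot have a bounded inverse on `T`. -/
lemma not_bounded_resolvent {B M : LinearMap.BilinForm ℝ X} (hB : ∀ x y, B x y = B y x)
    (hM : ∀ x y, M x y = M y x) (hM0 : ∀ x, 0 ≤ M x x) {T : Submodule ℝ X} {μ : ℝ}
    (hne : ∃ x ∈ T, 0 < M x x) (hμ : ∀ x ∈ T, μ * M x x ≤ B x x)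
    (hinf : ∀ μ', (∀ x ∈ T, μ' * M x x ≤ B x x) → μ' ≤ μ)
    (hres : ∃ K : ℝ, ∀ x ∈ T, ∃ u ∈ T, (∀ y ∈ T, B u y - μ * M u y = M x y) ∧
      M x u ≤ K * M x x) : False := by
  obtain ⟨K, hK⟩ := hres
  obtain ⟨x₀, hx₀, hMx₀⟩ := hne
  set L : ℝ := max K 1
  have hL : 0 < L := by positivity
  have hsym : ∀ x y, (B - μ • M) x y = (B - μ • M) y x := by
    intro x y; simp [hB x y, hM x y]
  have hpos : ∀ x ∈ T, 0 ≤ (B - μ • M) x x := by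
    intro x hx; simpa using hμ x hx
  have key : ∀ x ∈ T, (μ + 1 / L) * M x x ≤ B x x := by
    intro x hx
    obtain ⟨u, hu, hux, hb⟩ := hK x hx
    have h1 := sq_le_mul_of_nonneg_on hsym hpos hu hx
    simp only [LinearMap.sub_apply, LinearMap.smul_apply, smul_eq_mul] at h1
    rw [hux x hx, hux u hu] at h1
    rcases (hM0 x).eq_or_lt with h0 | h0
    · have := hμ x hx
      rw [← h0] at this ⊢
      linarith
    · have h2 : M x u ≤ L * M x x := hb.trans (by gcongr; exact le_max_left _ _)
      have h3 : 0 ≤ B x x - μ * M x x := by simpa using hpos x hx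
      have h4 : M x x ^ 2 ≤ L * M x x * (B x x - μ * M x x) :=
        h1.trans (mul_le_mul_of_nonneg_right h2 h3)
      have h5 : M x x ≤ L * (B x x - μ * M x x) := by
        have : M x x * M x x ≤ M x x * (L * (B x x - μ * M x x)) := by linarith
        exact le_of_mul_le_mul_left this h0
      have h6 : 1 / L * M x x ≤ B x x - μ * M x x := by
        rw [div_mul_eq_mul_div, one_mul, div_le_iff₀ hL]; linarith
      linarith
  have := hinf _ key
  have : 0 < 1 / L := by positivity
  linarith

/-- Stability on the hyperplane `ker l`: the form `B` is non-negative on the `M`-orthogonal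
complement of `φ`, and `ker l` is the `B`-orthogonal complement of a vector `w` with
`B w w ≤ 0`. -/
lemma nonneg_on_ker {B M : LinearMap.BilinForm ℝ X} (hB : ∀ x y, B x y = B y x)
    {φ w : X} {l : X →ₗ[ℝ] ℝ} {lam c : ℝ}
    (hφ : ∀ x, B φ x = lam * M φ x) (hφφ : M φ φ ≠ 0) (hpos : ∀ x, M φ x = 0 → 0 ≤ B x x)
    (hw : ∀ x, B w x = c * l x) (hc : c ≠ 0) (hww : B w w ≤ 0) (hl : ∃ x, l x ≠ 0)
    {v : X} (hv : l v = 0) : 0 ≤ B v v := by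
  by_contra! hneg
  have hwv : B w v = 0 := by rw [hw, hv, mul_zero]
  have hvφ : M φ v ≠ 0 := fun h => absurd (hpos v h) (not_le.2 hneg)
  have h1 := hpos (M φ w • v - M φ v • w) (by simp; ring)
  simp only [map_sub, map_smul, LinearMap.sub_apply, LinearMap.smul_apply, smul_eq_mul,
    hB v w, hwv] at h1
  have h2 : M φ w = 0 := by
    by_contra h
    have : 0 < M φ w ^ 2 := by positivity
    nlinarith [sq_nonneg (M φ v)]
  have hw0 : B w w = 0 := le_antisymm hww (hpos w h2)
  have hker : ∀ y, B w y = 0 := by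
    intro y
    set t := M φ y / M φ φ
    have hy : M φ (y - t • φ) = 0 := by simp [t, div_mul_cancel₀ _ hφφ]
    have h3 := sq_le_mul_of_nonneg_on (T := LinearMap.ker (M φ)) hB
      (fun x hx => hpos x hx) (x := w) (y := y - t • φ) h2 hy
    rw [hw0, zero_mul] at h3
    have h4 : B w (y - t • φ) = 0 := by nlinarith [sq_nonneg (B w (y - t • φ))]
    have h5 : B w φ = 0 := by rw [hB, hφ, h2, mul_zero]
    simpa [h5] using h4
  obtain ⟨x, hx⟩ := hl
  have := hker x
  rw [hw] at this
  exact (mul_ne_zero hc hx) this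

/-- Projecting a negative direction `φ` of `B` along `w` into `ker l` gives a negative direction
when `ker l` is `B`-orthogonal to `w` and `B w w ≥ 0`. -/
lemma neg_on_ker_of_proj {B : LinearMap.BilinForm ℝ X} (hB : ∀ x y, B x y = B y x)
    {φ w : X} {l : X →ₗ[ℝ] ℝ} {c : ℝ} (hφ : B φ φ < 0) (hw : ∀ x, B w x = c * l x)
    (hlw : l w ≠ 0) (hc : 0 ≤ c * l w) :
    l (φ - (l φ / l w) • w) = 0 ∧
      B (φ - (l φ / l w) • w) (φ - (l φ / l w) • w) < 0 := by
  constructor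
  · simp [div_mul_cancel₀ _ hlw]
  · have h1 : B (φ - (l φ / l w) • w) (φ - (l φ / l w) • w) =
        B φ φ - (l φ / l w) ^ 2 * (c * l w) := by
      simp only [map_sub, map_smul, LinearMap.sub_apply, LinearMap.smul_apply, smul_eq_mul,
        hB φ w, hw]
      field_simp; ring
    rw [h1]
    nlinarith [mul_nonneg (sq_nonneg (l φ / l w)) hc]

/-- Two eigenvectors with distinct negative eigenvalues span a plane on which `B` is negative
definite, and this plane meets every hyperplane. -/
lemma neg_on_ker_of_two {B M : LinearMap.BilinForm ℝ X} (hB : ∀ x y, B x y = B y x)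
    (hM : ∀ x y, M x y = M y x) {φ ψ : X} (l : X →ₗ[ℝ] ℝ) {lam μ : ℝ}
    (hφ : ∀ x, B φ x = lam * M φ x) (hψ : ∀ x, B ψ x = μ * M ψ x) (hne : lam ≠ μ)
    (hlam : lam < 0) (hμ : μ < 0) (hφφ : 0 < M φ φ) (hψψ : 0 < M ψ ψ) :
    ∃ s t : ℝ, l (s • φ + t • ψ) = 0 ∧ B (s • φ + t • ψ) (s • φ + t • ψ) < 0 := by
  have h0 : M φ ψ = 0 := by
    have h1 := hφ ψ
    rw [hB, hψ, hM ψ φ] at h1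
    have : (μ - lam) * M φ ψ = 0 := by linarith
    exact (mul_eq_zero.1 this).resolve_left (sub_ne_zero.2 hne.symm)
  have hval : ∀ s t : ℝ, B (s • φ + t • ψ) (s • φ + t • ψ) =
      s ^ 2 * (lam * M φ φ) + t ^ 2 * (μ * M ψ ψ) := by
    intro s t
    simp only [map_add, map_smul, LinearMap.add_apply, LinearMap.smul_apply, smul_eq_mul, hφ, hψ,
      h0, hM ψ φ]
    ring
  have hn1 : lam * M φ φ < 0 := mul_neg_of_neg_of_pos hlam hφφ
  have hn2 : μ * M ψ ψ < 0 := mul_neg_of_neg_of_pos hμ hψψ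
  by_cases hl : l φ = 0
  · refine ⟨1, 0, by simp [hl], ?_⟩
    rw [hval]; linarith
  · refine ⟨- l ψ, l φ, by simp; ring, ?_⟩
    rw [hval]
    have : 0 < l φ ^ 2 := by positivity
    nlinarith [sq_nonneg (l ψ)]

end Forms

/-! ### Eigenvalues of Sturm–Liouville problems -/

namespace SLData

variable {a b : ℝ} (S : SLData a b)

/-- `u` with flux `y = σ u'` solves `(σ u')' + (q + μ) u = -f` on `[a, b]`. -/
def IsSol (μ : ℝ) (f u y : ℝ → ℝ) : Prop :=
  ∀ z ∈ Icc a b, HasDerivWithinAt u (y z / S.σ z) (Icc a b) z ∧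
    HasDerivWithinAt y (-(S.q z + μ) * u z - f z) (Icc a b) z

variable {S}

lemma IsSol.cont {μ : ℝ} {f u y : ℝ → ℝ} (h : S.IsSol μ f u y) : ContinuousOn u (Icc a b) :=
  fun z hz => (h z hz).1.continuousWithinAt

lemma IsSol.cont_flux {μ : ℝ} {f u y : ℝ → ℝ} (h : S.IsSol μ f u y) : ContinuousOn y (Icc a b) :=
  fun z hz => (h z hz).2.continuousWithinAt

/-- A solution as an element of the `C¹` space. -/
def IsSol.toC1 {μ : ℝ} {f u y : ℝ → ℝ} (h : S.IsSol μ f u y) : C1Space a b :=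
  ⟨(u, fun z => y z / S.σ z), mem_C1Space_of_hasDerivWithinAt
    (h.cont_flux.div S.σ_cont fun z hz => (S.σ_pos z hz).ne') fun z hz => (h z hz).1⟩

lemma IsSol.toC1_apply {μ : ℝ} {f u y : ℝ → ℝ} (h : S.IsSol μ f u y) : h.toC1.1.1 = u := rfl

/-- Green's identity. -/
lemma IsSol.energy_sub {μ : ℝ} {f u y : ℝ → ℝ} (h : S.IsSol μ f u y)
    (hf : ContinuousOn f (Icc a b)) (v : C1Space a b) :
    S.energy h.toC1 v - μ * S.mass h.toC1 v =
      (∫ z in a..b, f z * v.1.1 z) + y b * v.1.1 b - y a * v.1.1 a := by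
  have hv := C1Space.cont v
  have hy' : ContinuousOn (fun z => -(S.q z + μ) * u z - f z) (Icc a b) :=
    (((S.q_cont.add continuousOn_const).neg).mul h.cont).sub hf
  have hparts := integral_mul_deriv_C1Space S.lt.le (y := y)
    (y' := fun z => -(S.q z + μ) * u z - f z)
    (mem_C1Space_of_hasDerivWithinAt hy' fun z hz => (h z hz).2) v
  have i1 : IntervalIntegrable (fun z => (S.q z + μ) * u z * v.1.1 z) volume a b :=
    intervalIntegrable_mul S.lt.le ((S.q_cont.add continuousOn_const).mul h.cont) hv
  have i2 : IntervalIntegrable (fun z => μ * (h.toC1.1.1 z * v.1.1 z)) volume a b :=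
    intervalIntegrable_mul S.lt.le continuousOn_const (h.cont.mul hv)
  have h1 : S.energy h.toC1 v - μ * S.mass h.toC1 v =
      ∫ z in a..b, (y z * v.1.2 z - (S.q z + μ) * u z * v.1.1 z) := by
    rw [energy_apply, mass_apply, ← intervalIntegral.integral_const_mul,
      ← intervalIntegral.integral_sub
        (intervalIntegrable_of_continuousOn_Icc S.lt.le (S.cont_energy _ _)) i2]
    refine intervalIntegral.integral_congr fun z hz => ?_
    rw [uIcc_of_le S.lt.le] at hz
    have := (S.σ_pos z hz).ne'
    simp only [IsSol.toC1]
    field_simp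
    ring
  have h2 : ∫ z in a..b, (-(S.q z + μ) * u z - f z) * v.1.1 z =
      -(∫ z in a..b, (S.q z + μ) * u z * v.1.1 z) - ∫ z in a..b, f z * v.1.1 z := by
    rw [← intervalIntegral.integral_neg, ← intervalIntegral.integral_sub]
    · congr 1; ext z; ring
    · exact i1.neg
    · exact intervalIntegrable_mul S.lt.le hf hv
  rw [h1, intervalIntegral.integral_sub (intervalIntegrable_mul S.lt.le h.cont_flux
    (C1Space.cont' v)) i1, hparts, h2]
  ring

variable (S)

/-- The initial value problem for `(σ u')' + (q + μ) u = -f` is solvable, and for zero initial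
data the solution is bounded by the `L¹` norm of `f`. -/
lemma exists_isSol (μ : ℝ) : ∃ C : ℝ, 0 < C ∧ ∀ f : ℝ → ℝ, ContinuousOn f (Icc a b) →
    ∀ u₀ y₀ m : ℝ, (∀ z ∈ Icc a b, |∫ t in a..z, f t| ≤ m) →
    ∃ u y : ℝ → ℝ, u a = u₀ ∧ y a = y₀ ∧ S.IsSol μ f u y ∧
      ∀ z ∈ Icc a b, |u z| ≤ C * (max |u₀| |y₀| + m) ∧ |y z| ≤ C * (max |u₀| |y₀| + m) := by
  have hα : ContinuousOn (fun z => (S.σ z)⁻¹) (Icc a b) :=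
    S.σ_cont.inv₀ fun z hz => (S.σ_pos z hz).ne'
  have hβ : ContinuousOn (fun z => -(S.q z + μ)) (Icc a b) :=
    (S.q_cont.add continuousOn_const).neg
  obtain ⟨C, hC, hbd⟩ := linearSystem_bound hα hβ
  refine ⟨C + 1, by positivity, fun f hf u₀ y₀ m hm => ?_⟩
  set fe : ℝ → ℝ := IccExtend S.lt.le (domRestrict (Icc a b) f) with hfe
  have hfec : Continuous fe := hf.domRestrict.Icc_extend'
  have hfeq : ∀ z ∈ Icc a b, fe z = f z := fun z hz => by
    rw [hfe, IccExtend_of_mem _ _ hz, domRestrict_apply]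
  set F : ℝ → ℝ := fun z => -∫ t in a..z, fe t
  have hF' : ∀ z, HasDerivAt F (-fe z) z := fun z =>
    (hfec.integral_hasStrictDerivAt a z).hasDerivAt.neg
  have hFm : ∀ z ∈ Icc a b, |F z| ≤ m := by
    intro z hz
    rw [abs_neg]
    have : ∫ t in a..z, fe t = ∫ t in a..z, f t := by
      refine intervalIntegral.integral_congr fun t ht => ?_
      rw [uIcc_of_le hz.1] at ht
      exact hfeq t ⟨ht.1, ht.2.trans hz.2⟩
    rw [this]
    exact hm z hz
  have hFa : F a = 0 := by simp [F]
  obtain ⟨u, y, hu0, hy0, hu, hy⟩ := linearSystem_exists S.lt.le hα hβ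
    (F := F) (fun z _ => (hF' z).continuousAt.continuousWithinAt) u₀ y₀
  refine ⟨u, fun z => y z + F z, hu0, by simp [hy0, hFa], fun z hz => ⟨?_, ?_⟩, fun z hz => ?_⟩
  · simpa [div_eq_mul_inv] using hu z hz
  · have := (hy z hz).add (hF' z).hasDerivWithinAt
    rw [hfeq z hz] at this
    exact this
  · have hm0 : 0 ≤ m := (abs_nonneg _).trans (hm z hz)
    have hx0 : 0 ≤ max |u₀| |y₀| := (abs_nonneg _).trans (le_max_left _ _)
    have key := hbd F u y (max |u₀| |y₀|) m hFm (by rw [hu0]; exact le_max_left _ _)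
      (by rw [hy0]; exact le_max_right _ _) _ _ (fun z _ => ?_) (fun z _ => ?_) hu hy z hz
    · refine ⟨key.1.trans (by nlinarith), ?_⟩
      have := (abs_add_le (y z) (F z)).trans (add_le_add key.2 (hFm z hz))
      exact this.trans (by nlinarith)
    · rw [abs_mul]
      exact mul_le_mul_of_nonneg_right (abs_add_le _ _) (abs_nonneg _)
    · rw [abs_mul]

lemma exists_isSol_zero (μ u₀ y₀ : ℝ) :
    ∃ u y : ℝ → ℝ, u a = u₀ ∧ y a = y₀ ∧ S.IsSol μ 0 u y := by
  obtain ⟨C, -, h⟩ := S.exists_isSol μ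
  obtain ⟨u, y, h1, h2, h3, -⟩ := h 0 continuousOn_const u₀ y₀ 0 (by simp)
  exact ⟨u, y, h1, h2, h3⟩

/-- The bounded particular solution used to invert `σ`-Sturm–Liouville operators in `L²`. -/
lemma exists_isSol_particular (μ : ℝ) : ∃ C : ℝ, 0 < C ∧ ∀ x : C1Space a b, ∃ u y : ℝ → ℝ,
    u a = 0 ∧ y a = 0 ∧ S.IsSol μ x.1.1 u y ∧
      ∀ z ∈ Icc a b, |u z| ≤ C * (∫ t in a..b, |x.1.1 t|) ∧ |y z| ≤ C * ∫ t in a..b, |x.1.1 t| := by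
  obtain ⟨C, hC, h⟩ := S.exists_isSol μ
  refine ⟨C, hC, fun x => ?_⟩
  obtain ⟨u, y, h1, h2, h3, h4⟩ := h x.1.1 (C1Space.cont x) 0 0 _
    (fun z hz => abs_integral_le S.lt.le x hz)
  exact ⟨u, y, h1, h2, h3, by simpa using h4⟩

variable {S}

lemma IsSol.eq_zero {μ : ℝ} {u y : ℝ → ℝ} (h : S.IsSol μ 0 u y) (hu : u a = 0) (hy : y a = 0) :
    ∀ z ∈ Icc a b, u z = 0 := by
  have hα : ContinuousOn (fun z => (S.σ z)⁻¹) (Icc a b) :=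
    S.σ_cont.inv₀ fun z hz => (S.σ_pos z hz).ne'
  have hβ : ContinuousOn (fun z => -(S.q z + μ)) (Icc a b) :=
    (S.q_cont.add continuousOn_const).neg
  obtain ⟨C, hC, hbd⟩ := linearSystem_bound hα hβ
  intro z hz
  have := (hbd 0 u y 0 0 (by simp) (by simp [hu]) (by simp [hy]) _ _
    (fun z _ => ?_) (fun z _ => ?_) (fun z hz => (h z hz).1) (fun z hz => (h z hz).2) z hz).1
  · simpa using this
  · rw [abs_div, abs_inv, div_eq_mul_inv]; simp
  · simp [abs_mul]

variable (S)

/-- `μ` is an eigenvalue of the Neumann problem `(σ u')' + q u = -μ u`; the eigenfunction is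
recorded with its flux `y = σ u'`. -/
def IsEig (μ : ℝ) : Prop :=
  ∃ u y : ℝ → ℝ, S.IsSol μ 0 u y ∧ (∃ z ∈ Icc a b, u z ≠ 0) ∧ y a = 0 ∧ y b = 0

variable {S}

lemma IsSol.energy_eq {μ : ℝ} {u y : ℝ → ℝ} (h : S.IsSol μ 0 u y) (ha : y a = 0) (hb : y b = 0)
    (v : C1Space a b) : S.energy h.toC1 v = μ * S.mass h.toC1 v := by
  have := h.energy_sub continuousOn_const v
  simp only [Pi.zero_apply, zero_mul, intervalIntegral.integral_zero, ha, hb] at this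
  linarith

/-- An eigenfunction does not vanish at the right end. -/
lemma IsSol.right_ne_zero {μ : ℝ} {u y : ℝ → ℝ} (h : S.IsSol μ 0 u y) (ha : y a = 0)
    (hb : y b = 0) (hne : ∃ z ∈ Icc a b, u z ≠ 0) : u b ≠ 0 := by
  have hua : u a ≠ 0 := by
    intro h0
    obtain ⟨z, hz, hz'⟩ := hne
    exact hz' (h.eq_zero h0 ha z hz)
  obtain ⟨χ, η, hχ, hη, hs⟩ := S.exists_isSol_zero μ 0 1
  have h1 := hs.energy_sub continuousOn_const h.toC1
  rw [S.energy_comm, S.mass_comm, h.energy_eq ha hb, sub_self] at h1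
  simp only [Pi.zero_apply, zero_mul, intervalIntegral.integral_zero, hη, h.toC1_apply] at h1
  intro h0
  rw [h0] at h1
  apply hua
  linarith

/-- Eigenfunctions are smooth. -/
lemma IsSol.smooth {μ : ℝ} {u y : ℝ → ℝ} (h : S.IsSol μ 0 u y) : ContDiffOn ℝ ∞ u (Icc a b) := by
  have hU := uniqueDiffOn_Icc S.lt
  have key : ∀ k : ℕ, ContDiffOn ℝ k u (Icc a b) ∧ ContDiffOn ℝ k y (Icc a b) := by
    intro k
    induction k with
    | zero => exact ⟨contDiffOn_zero.2 h.cont, contDiffOn_zero.2 h.cont_flux⟩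
    | succ k ih =>
      have hk : ((k : ℕ∞) : WithTop ℕ∞) ≤ ∞ := by exact_mod_cast le_top
      constructor
      · rw [Nat.cast_add, Nat.cast_one, contDiffOn_succ_iff_derivWithin hU]
        refine ⟨fun z hz => (h z hz).1.differentiableWithinAt, by simp, ?_⟩
        refine (ih.2.div (S.σ_smooth.of_le hk) fun z hz => (S.σ_pos z hz).ne').congr
          fun z hz => (h z hz).1.derivWithin (hU z hz)
      · rw [Nat.cast_add, Nat.cast_one, contDiffOn_succ_iff_derivWithin hU]
        refine ⟨fun z hz => (h z hz).2.differentiableWithinAt, by simp, ?_⟩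
        refine (((S.q_smooth.of_le hk).add (contDiffOn_const (c := μ))).neg.mul ih.1).congr
          fun z hz => ?_
        rw [(h z hz).2.derivWithin (hU z hz)]
        simp
  exact contDiffOn_infty.2 fun k => (key k).1

variable (S)

lemma mass_le_of_abs_le {x u : C1Space a b} {C : ℝ}
    (hu : ∀ z ∈ Icc a b, |u.1.1 z| ≤ C * ∫ t in a..b, |x.1.1 t|) :
    S.mass x u ≤ max C 0 * (b - a) * S.mass x x := by
  set m := ∫ t in a..b, |x.1.1 t| with hm
  have hm0 : 0 ≤ m := intervalIntegral.integral_nonneg S.lt.le fun _ _ => abs_nonneg _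
  have hx := C1Space.cont x
  calc S.mass x u ≤ ∫ z in a..b, |x.1.1 z| * (max C 0 * m) := by
        rw [mass_apply]
        refine intervalIntegral.integral_mono_on S.lt.le
          (intervalIntegrable_mul S.lt.le hx (C1Space.cont u))
          (intervalIntegrable_mul S.lt.le hx.abs continuousOn_const) fun z hz => ?_
        refine (le_abs_self _).trans ?_
        rw [abs_mul]
        have : |u.1.1 z| ≤ max C 0 * m :=
          (hu z hz).trans (mul_le_mul_of_nonneg_right (le_max_left _ _) hm0)
        gcongr
    _ = max C 0 * m ^ 2 := by rw [intervalIntegral.integral_mul_const, ← hm]; ring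
    _ ≤ max C 0 * ((b - a) * S.mass x x) := by
        gcongr
        exact S.sq_integral_abs_le x
    _ = _ := by ring

/-- If `μ` is not an eigenvalue, the Neumann problem `(σ u')' + (q + μ) u = -x` has a solution
that is bounded in terms of `x`. -/
lemma exists_resolvent {μ : ℝ} (hμ : ¬ S.IsEig μ) : ∃ K : ℝ, ∀ x : C1Space a b, ∃ u : C1Space a b,
    (∀ v, S.energy u v - μ * S.mass u v = S.mass x v) ∧ S.mass x u ≤ K * S.mass x x := by
  obtain ⟨φ, η, hφ0, hη0, hφ⟩ := S.exists_isSol_zero μ 1 0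
  have hηb : η b ≠ 0 := by
    intro h
    exact hμ ⟨φ, η, hφ, ⟨a, left_mem_Icc.2 S.lt.le, by simp [hφ0]⟩, hη0, h⟩
  obtain ⟨C, hC, hsol⟩ := S.exists_isSol_particular μ
  obtain ⟨N, hN⟩ := isCompact_Icc.exists_bound_of_continuousOn hφ.cont
  refine ⟨max (C + C / |η b| * N) 0 * (b - a), fun x => ?_⟩
  obtain ⟨u, y, hu0, hy0, hu, hub⟩ := hsol x
  -- a multiple of the homogeneous solution corrects the flux of the particular one at `b`
  refine ⟨hu.toC1 - (y b / η b) • hφ.toC1, fun v => ?_, S.mass_le_of_abs_le fun z hz => ?_⟩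
  · have h1 := hu.energy_sub (C1Space.cont x) v
    have h2 := hφ.energy_sub continuousOn_const v
    simp only [Pi.zero_apply, zero_mul, intervalIntegral.integral_zero, hη0, hy0,
      zero_add, sub_zero] at h1 h2
    simp only [map_sub, map_smul, LinearMap.sub_apply, LinearMap.smul_apply, smul_eq_mul]
    rw [mass_apply S x v]
    have h3 : y b / η b * (η b * v.1.1 b) = y b * v.1.1 b := by field_simp
    linear_combination h1 - (y b / η b) * h2 - h3
  · set m := ∫ t in a..b, |x.1.1 t|
    have hm0 : 0 ≤ m := intervalIntegral.integral_nonneg S.lt.le fun _ _ => abs_nonneg _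
    have h1 : (hu.toC1 - (y b / η b) • hφ.toC1).1.1 z = u z - y b / η b * φ z := rfl
    rw [h1]
    refine (abs_sub _ _).trans ?_
    rw [abs_mul, abs_div]
    have h2 := hN z hz
    rw [Real.norm_eq_abs] at h2
    have h3 := (hub b (right_mem_Icc.2 S.lt.le)).2
    have h4 := (hub z hz).1
    have h5 : |y b| / |η b| * |φ z| ≤ (C * m) / |η b| * N := by gcongr
    calc |u z| + |y b| / |η b| * |φ z| ≤ C * m + (C * m) / |η b| * N := add_le_add h4 h5
      _ = _ := by ring

/-- The Fredholm alternative at an eigenvalue: the Neumann problem is solvable for right-hand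
sides orthogonal to the eigenfunction, with a bounded solution orthogonal to it. -/
lemma exists_resolvent_of_isSol {μ : ℝ} {φ η : ℝ → ℝ} (hφ : S.IsSol μ 0 φ η)
    (hne : ∃ z ∈ Icc a b, φ z ≠ 0) (hηa : η a = 0) (hηb : η b = 0) :
    ∃ K : ℝ, ∀ x : C1Space a b, S.mass hφ.toC1 x = 0 → ∃ u : C1Space a b,
      S.mass hφ.toC1 u = 0 ∧ (∀ v, S.energy u v - μ * S.mass u v = S.mass x v) ∧
      S.mass x u ≤ K * S.mass x x := by
  obtain ⟨C, hC, hsol⟩ := S.exists_isSol_particular μ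
  refine ⟨max C 0 * (b - a), fun x hx => ?_⟩
  obtain ⟨u, y, hu0, hy0, hu, hub⟩ := hsol x
  have hpos := S.mass_pos hφ.toC1 hne
  have hyb : y b = 0 := by
    have h1 := hu.energy_sub (C1Space.cont x) hφ.toC1
    rw [S.energy_comm, S.mass_comm, hφ.energy_eq hηa hηb, sub_self] at h1
    have h2 : ∫ z in a..b, x.1.1 z * hφ.toC1.1.1 z = 0 := by
      rw [← hx, S.mass_comm]; rfl
    rw [h2, hy0, hφ.toC1_apply] at h1
    simp only [zero_add, zero_mul, sub_zero] at h1
    exact (mul_eq_zero.1 h1.symm).resolve_right (hφ.right_ne_zero hηa hηb hne)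
  refine ⟨hu.toC1 - (S.mass hφ.toC1 hu.toC1 / S.mass hφ.toC1 hφ.toC1) • hφ.toC1, ?_,
    fun v => ?_, ?_⟩
  · simp [div_mul_cancel₀ _ hpos.ne']
  · have h1 := hu.energy_sub (C1Space.cont x) v
    rw [hyb, hy0] at h1
    have h2 := hφ.energy_eq hηa hηb v
    simp only [map_sub, map_smul, LinearMap.sub_apply, LinearMap.smul_apply, smul_eq_mul]
    rw [mass_apply S x v]
    linear_combination h1 - (S.mass hφ.toC1 hu.toC1 / S.mass hφ.toC1 hφ.toC1) * h2
  · have h1 : S.mass x hφ.toC1 = 0 := by rw [S.mass_comm, hx]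
    simp only [map_sub, map_smul, h1, smul_zero, sub_zero]
    exact S.mass_le_of_abs_le fun z hz => (hub z hz).1

/-- The infimum of the Rayleigh quotient on a subspace. -/
lemma exists_rayleigh_inf (T : Submodule ℝ (C1Space a b)) (hT : ∃ x ∈ T, 0 < S.mass x x) :
    ∃ μ : ℝ, (∀ x ∈ T, μ * S.mass x x ≤ S.energy x x) ∧
      ∀ μ', (∀ x ∈ T, μ' * S.mass x x ≤ S.energy x x) → μ' ≤ μ := by
  obtain ⟨C, -, hC⟩ := S.exists_lower_bound
  obtain ⟨x₀, hx₀, h0⟩ := hT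
  set A : Set ℝ := {m | ∀ x ∈ T, m * S.mass x x ≤ S.energy x x}
  have hbdd : BddAbove A := ⟨S.energy x₀ x₀ / S.mass x₀ x₀, fun m hm => by
    rw [le_div_iff₀ h0]; exact hm x₀ hx₀⟩
  refine ⟨sSup A, fun x hx => ?_, fun μ' h => le_csSup hbdd h⟩
  rcases (S.mass_nonneg x).eq_or_lt with h | h
  · have := hC x
    rw [← h] at this ⊢
    linarith
  · rw [← le_div_iff₀ h]
    exact csSup_le ⟨-C, fun x _ => hC x⟩ fun m hm => by
      rw [le_div_iff₀ h]; exact hm x hx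

/-- The least eigenvalue is the infimum of the Rayleigh quotient. -/
theorem exists_first_eigenvalue :
    ∃ μ : ℝ, S.IsEig μ ∧ ∀ x, μ * S.mass x x ≤ S.energy x x := by
  have hT : ∃ x ∈ (⊤ : Submodule ℝ (C1Space a b)), 0 < S.mass x x :=
    ⟨C1Space.one a b, trivial, S.mass_pos _ ⟨a, left_mem_Icc.2 S.lt.le, one_ne_zero⟩⟩
  obtain ⟨μ, h1, h2⟩ := S.exists_rayleigh_inf ⊤ hT
  refine ⟨μ, ?_, fun x => h1 x trivial⟩
  by_contra hμ
  obtain ⟨K, hK⟩ := S.exists_resolvent hμ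
  refine not_bounded_resolvent S.energy_comm S.mass_comm S.mass_nonneg hT h1 h2 ⟨K, fun x _ => ?_⟩
  obtain ⟨u, hu, hb⟩ := hK x
  exact ⟨u, trivial, fun v _ => hu v, hb⟩

/-- On the orthogonal complement of an eigenfunction, the infimum of the Rayleigh quotient is
another eigenvalue. -/
theorem exists_second_eigenvalue {lam : ℝ} {φ η : ℝ → ℝ} (hφ : S.IsSol lam 0 φ η)
    (hne : ∃ z ∈ Icc a b, φ z ≠ 0) (hηa : η a = 0) (hηb : η b = 0) {v : C1Space a b}
    (hv : S.mass hφ.toC1 v = 0) (hvv : 0 < S.mass v v) :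
    ∃ μ : ℝ, S.IsEig μ ∧ μ ≠ lam ∧ μ * S.mass v v ≤ S.energy v v ∧
      ∀ μ', (∀ x, μ' * S.mass x x ≤ S.energy x x) → μ' ≤ μ := by
  set T : Submodule ℝ (C1Space a b) := LinearMap.ker (S.mass hφ.toC1)
  have hT : ∃ x ∈ T, 0 < S.mass x x := ⟨v, hv, hvv⟩
  obtain ⟨μ, h1, h2⟩ := S.exists_rayleigh_inf T hT
  have hlam : μ ≠ lam := by
    rintro rfl
    obtain ⟨K, hK⟩ := S.exists_resolvent_of_isSol hφ hne hηa hηb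
    refine not_bounded_resolvent S.energy_comm S.mass_comm S.mass_nonneg hT h1 h2
      ⟨K, fun x hx => ?_⟩
    obtain ⟨u, hu0, hu, hb⟩ := hK x hx
    exact ⟨u, hu0, fun v _ => hu v, hb⟩
  refine ⟨μ, ?_, hlam, h1 v hv, fun μ' h => h2 μ' fun x _ => h x⟩
  by_contra hμ
  obtain ⟨K, hK⟩ := S.exists_resolvent hμ
  refine not_bounded_resolvent S.energy_comm S.mass_comm S.mass_nonneg hT h1 h2 ⟨K, fun x hx => ?_⟩
  obtain ⟨u, hu, hb⟩ := hK x
  refine ⟨u, ?_, fun v _ => hu v, hb⟩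
  have h3 := hu hφ.toC1
  rw [S.energy_comm, S.mass_comm, hφ.energy_eq hηa hηb, S.mass_comm x,
    show S.mass hφ.toC1 x = 0 from hx, ← sub_mul] at h3
  exact (mul_eq_zero.1 h3).resolve_left (sub_ne_zero.2 hlam.symm)

/-- The `i`-th eigenvalue of the Neumann problem. -/
def eigenvalue (i : ℕ) : ℝ :=
  sInf {μ | S.IsEig μ ∧ (i : ℕ∞) ≤ {ν | S.IsEig ν ∧ ν ≤ μ}.encard}

lemma IsEig.exists_energy_eq {μ : ℝ} (h : S.IsEig μ) : ∃ φ : C1Space a b,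
    0 < S.mass φ φ ∧ (∀ v, S.energy φ v = μ * S.mass φ v) ∧ ContDiffOn ℝ ∞ φ.1.1 (Icc a b) := by
  obtain ⟨u, y, hs, hne, ha, hb⟩ := h
  exact ⟨hs.toC1, S.mass_pos _ hne, hs.energy_eq ha hb, hs.smooth⟩

lemma bddBelow_eigenvalues (i : ℕ) :
    BddBelow {μ | S.IsEig μ ∧ (i : ℕ∞) ≤ {ν | S.IsEig ν ∧ ν ≤ μ}.encard} := by
  obtain ⟨C, -, hC⟩ := S.exists_lower_bound
  refine ⟨-C, fun μ hμ => ?_⟩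
  obtain ⟨φ, hφ, he, -⟩ := IsEig.exists_energy_eq S hμ.1
  have := hC φ
  rw [he] at this
  exact le_of_mul_le_mul_right this hφ

lemma eigenvalue_one_le {μ : ℝ} (h : S.IsEig μ) : S.eigenvalue 1 ≤ μ := by
  refine csInf_le (S.bddBelow_eigenvalues 1) ⟨h, ?_⟩
  rw [Nat.cast_one, Set.one_le_encard_iff_nonempty]
  exact ⟨μ, h, le_rfl⟩

lemma eigenvalue_two_le {μ ν : ℝ} (hμ : S.IsEig μ) (hν : S.IsEig ν) (hne : ν ≠ μ) (hle : ν ≤ μ) :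
    S.eigenvalue 2 ≤ μ := by
  refine csInf_le (S.bddBelow_eigenvalues 2) ⟨hμ, ?_⟩
  have : ({ν, μ} : Set ℝ) ⊆ {ν | S.IsEig ν ∧ ν ≤ μ} := by
    rintro x (rfl | rfl)
    exacts [⟨hν, hle⟩, ⟨hμ, le_rfl⟩]
  refine le_trans ?_ (Set.encard_le_encard this)
  rw [Set.encard_pair hne]
  rfl

/-- The variational description of the first two eigenvalues. -/
theorem exists_first_eigenfunction : ∃ (lam : ℝ) (φ : C1Space a b),
    S.eigenvalue 1 ≤ lam ∧ 0 < S.mass φ φ ∧ (∀ v, S.energy φ v = lam * S.mass φ v) ∧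
    ContDiffOn ℝ ∞ φ.1.1 (Icc a b) ∧ (∀ x, lam * S.mass x x ≤ S.energy x x) ∧
    ∀ v, S.mass φ v = 0 → S.eigenvalue 2 * S.mass v v ≤ S.energy v v := by
  obtain ⟨lam, hlam, hmin⟩ := S.exists_first_eigenvalue
  obtain ⟨u, y, hs, hne, ha, hb⟩ := id hlam
  refine ⟨lam, hs.toC1, S.eigenvalue_one_le hlam, S.mass_pos _ hne, hs.energy_eq ha hb, hs.smooth,
    hmin, fun v hv => ?_⟩
  rcases (S.mass_nonneg v).eq_or_lt with h | h
  · have := hmin v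
    rw [← h] at this ⊢
    linarith
  · obtain ⟨μ, hμ, hμne, hμv, hμinf⟩ := S.exists_second_eigenvalue hs hne ha hb hv h
    refine le_trans ?_ hμv
    exact mul_le_mul_of_nonneg_right
      (S.eigenvalue_two_le hμ hlam hμne.symm (hμinf lam hmin)) h.le

/-- If the second eigenvalue is negative, there are two distinct negative eigenvalues. -/
lemma exists_two_of_eigenvalue_two_neg (h : S.eigenvalue 2 < 0) :
    ∃ μ ν : ℝ, μ ≠ ν ∧ μ < 0 ∧ ν < 0 ∧ S.IsEig μ ∧ S.IsEig ν := by
  obtain ⟨μ, ⟨hμ, hcard⟩, hneg⟩ : ∃ μ ∈ {μ | S.IsEig μ ∧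
      ((2 : ℕ) : ℕ∞) ≤ {ν | S.IsEig ν ∧ ν ≤ μ}.encard}, μ < 0 := by
    by_contra! hcon
    exact absurd (Real.sInf_nonneg hcon) (not_le.2 h)
  have h2 : 1 < {ν | S.IsEig ν ∧ ν ≤ μ}.encard := lt_of_lt_of_le (by norm_num) hcard
  obtain ⟨x, y, hx, hy, hxy⟩ := Set.one_lt_encard_iff.1 h2
  exact ⟨x, y, hxy, hx.2.trans_lt hneg, hy.2.trans_lt hneg, hx.1, hy.1⟩

end SLData

/-! ### The Jacobi operator of a half period -/

section Profile

variable {n : ℕ} {a b : ℝ} {h : ℝ → ℝ}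

lemma pow_pred_eq {x : ℝ} (hn : 1 ≤ n) (hx : x ≠ 0) : x ^ (n - 1) = x ^ n / x := by
  rw [eq_div_iff hx, ← pow_succ, Nat.sub_add_cancel hn]

lemma contDiffOn_dz (hab : a < b) {u : ℝ → ℝ} (hu : ContDiffOn ℝ ∞ u (Icc a b)) :
    ContDiffOn ℝ ∞ (dz a b u) (Icc a b) :=
  hu.derivWithin (uniqueDiffOn_Icc hab) (by simp)

lemma hasDerivWithinAt_dz {u : ℝ → ℝ} (hu : DifferentiableOn ℝ u (Icc a b)) {z : ℝ}
    (hz : z ∈ Icc a b) : HasDerivWithinAt u (dz a b u z) (Icc a b) z :=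
  (hu z hz).hasDerivWithinAt

lemma dz_eq (hab : a < b) {u : ℝ → ℝ} {c z : ℝ} (hz : z ∈ Icc a b)
    (hu : HasDerivWithinAt u c (Icc a b) z) : dz a b u z = c :=
  hu.derivWithin (uniqueDiffOn_Icc hab z hz)

lemma one_add_sq_pos (x : ℝ) : 0 < 1 + x ^ 2 := by positivity

lemma sqrt_one_add_sq_pos (x : ℝ) : 0 < √(1 + x ^ 2) := Real.sqrt_pos.2 (one_add_sq_pos x)

lemma sq_sqrt_one_add_sq (x : ℝ) : √(1 + x ^ 2) ^ 2 = 1 + x ^ 2 :=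
  Real.sq_sqrt (one_add_sq_pos x).le

lemma contDiffOn_sqrt_slope (hab : a < b) (hs : ContDiffOn ℝ ∞ h (Icc a b)) :
    ContDiffOn ℝ ∞ (fun z => √(1 + dz a b h z ^ 2)) (Icc a b) :=
  (contDiffOn_const.add ((contDiffOn_dz hab hs).pow 2)).sqrt fun _ _ => (one_add_sq_pos _).ne'

/-- The coefficients of the Jacobi operator `𝓛` of a hypersurface of revolution. -/
def jacobiData (n : ℕ) (hab : a < b) (hs : ContDiffOn ℝ ∞ h (Icc a b))
    (hpos : ∀ z ∈ Icc a b, 0 < h z) : SLData a b where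
  σ := sigma n a b h
  q z := n * h z ^ ((n : ℤ) - 2) / √(1 + dz a b h z ^ 2)
  lt := hab
  σ_smooth := (hs.pow n).div ((contDiffOn_sqrt_slope hab hs).pow 3) fun _ _ =>
    (pow_pos (sqrt_one_add_sq_pos _) 3).ne'
  σ_pos z hz := div_pos (pow_pos (hpos z hz) n) (pow_pos (sqrt_one_add_sq_pos _) 3)
  q_smooth := by
    have : ContDiffOn ℝ ∞ (fun z => n * (h z ^ n / h z ^ 2) / √(1 + dz a b h z ^ 2)) (Icc a b) :=
      (contDiffOn_const.mul ((hs.pow n).div (hs.pow 2) fun z hz => (pow_pos (hpos z hz) 2).ne')).div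
        (contDiffOn_sqrt_slope hab hs) fun _ _ => (sqrt_one_add_sq_pos _).ne'
    refine this.congr fun z hz => ?_
    rw [zpow_sub₀ (hpos z hz).ne']
    norm_cast

lemma jacobiData_q (n : ℕ) (hab : a < b) (hs : ContDiffOn ℝ ∞ h (Icc a b))
    (hpos : ∀ z ∈ Icc a b, 0 < h z) {z : ℝ} (hz : z ∈ Icc a b) :
    (jacobiData n hab hs hpos).q z = n * (h z ^ n / h z ^ 2) / √(1 + dz a b h z ^ 2) := by
  change n * h z ^ ((n : ℤ) - 2) / √(1 + dz a b h z ^ 2) = _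
  rw [zpow_sub₀ (hpos z hz).ne']
  norm_cast

/-- The classical notion of eigenvalue agrees with the first-order formulation. -/
lemma isNeumannEigenvalue_iff (hab : a < b) (hs : ContDiffOn ℝ ∞ h (Icc a b))
    (hpos : ∀ z ∈ Icc a b, 0 < h z) (μ : ℝ) :
    IsNeumannEigenvalue n a b h μ ↔ (jacobiData n hab hs hpos).IsEig μ := by
  set S := jacobiData n hab hs hpos
  have hU := uniqueDiffOn_Icc hab
  constructor
  · rintro ⟨φ, hφ, hne, heq, ha, hb⟩
    have hd : ContDiffOn ℝ 1 (dz a b φ) (Icc a b) := hφ.derivWithin hU (by norm_num)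
    have hy : ContDiffOn ℝ 1 (fun y => sigma n a b h y * dz a b φ y) (Icc a b) :=
      (S.σ_smooth.of_le (by exact_mod_cast le_top)).mul hd
    refine ⟨φ, fun y => sigma n a b h y * dz a b φ y, fun z hz => ⟨?_, ?_⟩, hne, by simp [ha],
      by simp [hb]⟩
    · have h1 := hasDerivWithinAt_dz (hφ.differentiableOn (by norm_num)) hz
      have h2 : sigma n a b h z * dz a b φ z / S.σ z = dz a b φ z :=
        mul_div_cancel_left₀ _ (S.σ_pos z hz).ne'
      simpa only [h2] using h1
    · have h1 := hasDerivWithinAt_dz (hy.differentiableOn (by norm_num)) hz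
      have h2 := heq z hz
      unfold jacobiOp at h2
      have h3 : -(S.q z + μ) * φ z - (0 : ℝ → ℝ) z =
          dz a b (fun y => sigma n a b h y * dz a b φ y) z := by
        change -(n * h z ^ ((n : ℤ) - 2) / √(1 + dz a b h z ^ 2) + μ) * φ z - 0 = _
        linarith
      rw [h3]
      exact h1
  · rintro ⟨u, y, hsol, hne, ha, hb⟩
    have hu : ∀ z ∈ Icc a b, dz a b u z = y z / S.σ z := fun z hz => dz_eq hab hz (hsol z hz).1
    refine ⟨u, contDiffOn_infty.1 hsol.smooth 2, hne, fun z hz => ?_, ?_, ?_⟩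
    · have h1 : EqOn (fun y => sigma n a b h y * dz a b u y) y (Icc a b) := fun t ht => by
        change S.σ t * _ = _
        simp only [hu t ht]
        exact mul_div_cancel₀ _ (S.σ_pos t ht).ne'
      have h2 : dz a b (fun y => sigma n a b h y * dz a b u y) z = dz a b y z :=
        derivWithin_congr h1 (h1 hz)
      unfold jacobiOp
      rw [h2, dz_eq hab hz (hsol z hz).2]
      change -(n * h z ^ ((n : ℤ) - 2) / √(1 + dz a b h z ^ 2) + μ) * u z - 0 + _ = _
      ring
    · rw [hu a (left_mem_Icc.2 hab.le), ha, zero_div]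
    · rw [hu b (right_mem_Icc.2 hab.le), hb, zero_div]

lemma neumannEigenvalue_eq (hab : a < b) (hs : ContDiffOn ℝ ∞ h (Icc a b))
    (hpos : ∀ z ∈ Icc a b, 0 < h z) (i : ℕ) :
    neumannEigenvalue n a b h i = (jacobiData n hab hs hpos).eigenvalue i := by
  unfold neumannEigenvalue SLData.eigenvalue
  simp only [isNeumannEigenvalue_iff hab hs hpos]

lemma meanCurvature_mul (z : ℝ) : ((n : ℝ) + 1) * meanCurvature n a b h z =
    dz a b (dz a b h) z / √(1 + dz a b h z ^ 2) ^ 3 - n / (h z * √(1 + dz a b h z ^ 2)) := by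
  unfold meanCurvature
  have : (n : ℝ) + 1 ≠ 0 := by positivity
  field_simp

lemma hasDerivWithinAt_sqrt_slope {p : ℝ → ℝ} {p' z : ℝ} {s : Set ℝ}
    (hp : HasDerivWithinAt p p' s z) :
    HasDerivWithinAt (fun z => √(1 + p z ^ 2)) (p z * p' / √(1 + p z ^ 2)) s z := by
  have := ((hp.fun_pow 2).const_add 1).sqrt (one_add_sq_pos (p z)).ne'
  convert this using 1
  have := (sqrt_one_add_sq_pos (p z)).ne'
  field_simp
  norm_num
  ring

lemma hasDerivWithinAt_slope_div {p : ℝ → ℝ} {p' z : ℝ} {s : Set ℝ}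
    (hp : HasDerivWithinAt p p' s z) :
    HasDerivWithinAt (fun z => p z / √(1 + p z ^ 2)) (p' / √(1 + p z ^ 2) ^ 3) s z := by
  have hD := (sqrt_one_add_sq_pos (p z)).ne'
  refine (hp.div (hasDerivWithinAt_sqrt_slope hp) hD).congr_deriv ?_
  have := sq_sqrt_one_add_sq (p z)
  field_simp
  rw [this]
  ring

lemma hasDerivWithinAt_pow_of_pos {f : ℝ → ℝ} {f' z : ℝ} {s : Set ℝ} (hn : 1 ≤ n)
    (hf : HasDerivWithinAt f f' s z) (h0 : f z ≠ 0) :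
    HasDerivWithinAt (fun z => f z ^ n) (n * (f z ^ n / f z) * f') s z := by
  have := hf.pow n
  rwa [pow_pred_eq hn h0] at this

lemma hasDerivWithinAt_pow_div {f : ℝ → ℝ} {f' z : ℝ} {s : Set ℝ} (hn : 1 ≤ n)
    (hf : HasDerivWithinAt f f' s z) (h0 : f z ≠ 0) :
    HasDerivWithinAt (fun z => f z ^ n / f z) ((n - 1) * (f z ^ n / f z ^ 2) * f') s z := by
  refine ((hasDerivWithinAt_pow_of_pos hn hf h0).div hf h0).congr_deriv ?_
  field_simp

end Profile

namespace IsHalfPeriod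

variable {n : ℕ} {a b : ℝ} {h : ℝ → ℝ} {H : ℝ}

lemma curvature_eq (hp : IsHalfPeriod n a b h H) {z : ℝ} (hz : z ∈ Icc a b) :
    ((n : ℝ) + 1) * H = dz a b (dz a b h) z / √(1 + dz a b h z ^ 2) ^ 3 -
      n / (h z * √(1 + dz a b h z ^ 2)) := by
  rw [← hp.cmc z hz, meanCurvature_mul]

lemma cont (hp : IsHalfPeriod n a b h H) : ContinuousOn h (Icc a b) := hp.smooth.continuousOn

lemma cont_pow (hp : IsHalfPeriod n a b h H) : ContinuousOn (fun z => h z ^ n) (Icc a b) :=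
  hp.cont.pow n

lemma cont_pow_div (hp : IsHalfPeriod n a b h H) (k : ℕ) :
    ContinuousOn (fun z => h z ^ n / h z ^ k) (Icc a b) :=
  hp.cont_pow.div (hp.cont.pow k) fun z hz => (pow_pos (hp.pos z hz) k).ne'

lemma cont_slope (hp : IsHalfPeriod n a b h H) (hab : a < b) :
    ContinuousOn (dz a b h) (Icc a b) := (contDiffOn_dz hab hp.smooth).continuousOn

lemma cont_sqrt (hp : IsHalfPeriod n a b h H) (hab : a < b) :
    ContinuousOn (fun z => √(1 + dz a b h z ^ 2)) (Icc a b) :=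
  (contDiffOn_sqrt_slope hab hp.smooth).continuousOn

lemma hasDerivWithinAt (hp : IsHalfPeriod n a b h H) {z : ℝ} (hz : z ∈ Icc a b) :
    HasDerivWithinAt h (dz a b h z) (Icc a b) z :=
  hasDerivWithinAt_dz (hp.smooth.differentiableOn (by simp)) hz

lemma hasDerivWithinAt_slope (hp : IsHalfPeriod n a b h H) (hab : a < b) {z : ℝ}
    (hz : z ∈ Icc a b) : HasDerivWithinAt (dz a b h) (dz a b (dz a b h) z) (Icc a b) z :=
  hasDerivWithinAt_dz ((contDiffOn_dz hab hp.smooth).differentiableOn (by simp)) hz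

/-- The Jacobi operator of a half period. -/
abbrev data (hp : IsHalfPeriod n a b h H) (hab : a < b) : SLData a b :=
  jacobiData n hab hp.smooth hp.pos

/-- The first variation of volume, up to the area of the unit sphere. -/
abbrev volumeForm (hp : IsHalfPeriod n a b h H) (hab : a < b) : C1Space a b →ₗ[ℝ] ℝ :=
  weightedIntegral hab.le (fun z => h z ^ n) hp.cont_pow

lemma volumeForm_apply (hp : IsHalfPeriod n a b h H) (hab : a < b) (v : C1Space a b) :
    hp.volumeForm hab v = ∫ z in a..b, h z ^ n * v.1.1 z := rfl

lemma cont_slope_div (hp : IsHalfPeriod n a b h H) (hab : a < b) :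
    ContinuousOn (fun z => dz a b h z / √(1 + dz a b h z ^ 2)) (Icc a b) :=
  (hp.cont_slope hab).div (hp.cont_sqrt hab) fun _ _ => (sqrt_one_add_sq_pos _).ne'

lemma cont_slope_deriv (hp : IsHalfPeriod n a b h H) (hab : a < b) :
    ContinuousOn (fun z => dz a b (dz a b h) z / √(1 + dz a b h z ^ 2) ^ 3) (Icc a b) :=
  (contDiffOn_dz hab (contDiffOn_dz hab hp.smooth)).continuousOn.div ((hp.cont_sqrt hab).pow 3)
    fun _ _ => (pow_pos (sqrt_one_add_sq_pos _) 3).ne'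

/-- The Euler–Lagrange equation in weak form: the first variation of area is `-(n+1) H` times the
first variation of volume. The boundary terms vanish because the profile meets the two
hyperplanes perpendicularly. -/
lemma euler_lagrange (hp : IsHalfPeriod n a b h H) (hn : 1 ≤ n) (hab : a < b) (v : C1Space a b) :
    ∫ z in a..b, (n * (h z ^ n / h z) * √(1 + dz a b h z ^ 2) * v.1.1 z +
      h z ^ n * (dz a b h z / √(1 + dz a b h z ^ 2)) * v.1.2 z) =
      -((n + 1) * H) * hp.volumeForm hab v := by
  have hdiv : ContinuousOn (fun z => h z ^ n / h z) (Icc a b) := by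
    simpa using hp.cont_pow_div 1
  have hk : ((fun z => h z ^ n * (dz a b h z / √(1 + dz a b h z ^ 2))), fun z =>
      n * (h z ^ n / h z) * dz a b h z * (dz a b h z / √(1 + dz a b h z ^ 2)) +
        h z ^ n * (dz a b (dz a b h) z / √(1 + dz a b h z ^ 2) ^ 3)) ∈ C1Space a b := by
    refine mem_C1Space_of_hasDerivWithinAt ?_ fun z hz => ?_
    · exact (((continuousOn_const.mul hdiv).mul (hp.cont_slope hab)).mul
        (hp.cont_slope_div hab)).add (hp.cont_pow.mul (hp.cont_slope_deriv hab))
    · exact (hasDerivWithinAt_pow_of_pos hn (hp.hasDerivWithinAt hz) (hp.pos z hz).ne').mul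
        (hasDerivWithinAt_slope_div (hp.hasDerivWithinAt_slope hab hz))
  have hparts := integral_mul_deriv_C1Space hab.le hk v
  simp only [hp.left, hp.right, zero_div, mul_zero, zero_mul, sub_zero, zero_sub] at hparts
  have i1 : IntervalIntegrable (fun z => n * (h z ^ n / h z) * √(1 + dz a b h z ^ 2) * v.1.1 z)
      volume a b := intervalIntegrable_mul hab.le
        ((continuousOn_const.mul hdiv).mul (hp.cont_sqrt hab)) (C1Space.cont v)
  have i2 : IntervalIntegrable (fun z => h z ^ n * (dz a b h z / √(1 + dz a b h z ^ 2)) * v.1.2 z)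
      volume a b := intervalIntegrable_mul hab.le hk.1 (C1Space.cont' v)
  have i3 := intervalIntegrable_mul hab.le hk.2.1 (C1Space.cont v)
  rw [intervalIntegral.integral_add i1 i2, hparts, ← sub_eq_add_neg,
    ← intervalIntegral.integral_sub i1 i3, hp.volumeForm_apply hab,
    ← intervalIntegral.integral_const_mul]
  refine intervalIntegral.integral_congr fun z hz => ?_
  rw [uIcc_of_le hab.le] at hz
  simp only []
  rw [hp.curvature_eq hz]
  have h1 := (hp.pos z hz).ne'
  have h2 := (sqrt_one_add_sq_pos (dz a b h z)).ne'
  have h3 := sq_sqrt_one_add_sq (dz a b h z)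
  field_simp
  linear_combination (n * v.1.1 z * √(1 + dz a b h z ^ 2) ^ 2) * h3

/-- The second derivative of the Lagrangian `fⁿ √(1 + f_z²)`, after an integration by parts, is
the energy form of the Jacobi operator up to the contribution of the volume. -/
lemma second_variation_eq (hp : IsHalfPeriod n a b h H) (hn : 1 ≤ n) (hab : a < b)
    (u v : C1Space a b) :
    ∫ z in a..b, (n * (n - 1) * (h z ^ n / h z ^ 2) * √(1 + dz a b h z ^ 2) * (u.1.1 z * v.1.1 z) +
      n * (h z ^ n / h z) * (dz a b h z / √(1 + dz a b h z ^ 2)) *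
        (u.1.2 z * v.1.1 z + u.1.1 z * v.1.2 z) +
      h z ^ n / √(1 + dz a b h z ^ 2) ^ 3 * (u.1.2 z * v.1.2 z)) =
      (hp.data hab).energy u v -
        (n + 1) * H * ∫ z in a..b, n * (h z ^ n / h z) * (u.1.1 z * v.1.1 z) := by
  have hdiv : ContinuousOn (fun z => h z ^ n / h z) (Icc a b) := by
    simpa using hp.cont_pow_div 1
  set w := C1Space.mul u v
  have hw1 : ∀ z, w.1.1 z = u.1.1 z * v.1.1 z := fun _ => rfl
  have hw2 : ∀ z, w.1.2 z = u.1.2 z * v.1.1 z + u.1.1 z * v.1.2 z := fun _ => rfl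
  have hk : ((fun z => n * (h z ^ n / h z) * (dz a b h z / √(1 + dz a b h z ^ 2))), fun z =>
      n * ((n - 1) * (h z ^ n / h z ^ 2) * dz a b h z) * (dz a b h z / √(1 + dz a b h z ^ 2)) +
        n * (h z ^ n / h z) * (dz a b (dz a b h) z / √(1 + dz a b h z ^ 2) ^ 3))
      ∈ C1Space a b := by
    refine mem_C1Space_of_hasDerivWithinAt ?_ fun z hz => ?_
    · exact ((continuousOn_const.mul ((continuousOn_const.mul (hp.cont_pow_div 2)).mul
        (hp.cont_slope hab))).mul (hp.cont_slope_div hab)).add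
          ((continuousOn_const.mul hdiv).mul (hp.cont_slope_deriv hab))
    · exact ((hasDerivWithinAt_pow_div hn (hp.hasDerivWithinAt hz)
        (hp.pos z hz).ne').const_mul (n : ℝ)).mul
        (hasDerivWithinAt_slope_div (hp.hasDerivWithinAt_slope hab hz))
  have hparts := integral_mul_deriv_C1Space hab.le hk w
  simp only [hp.left, hp.right, zero_div, mul_zero, zero_mul, sub_zero, zero_sub] at hparts
  have i1 : IntervalIntegrable (fun z => n * (n - 1) * (h z ^ n / h z ^ 2) *
      √(1 + dz a b h z ^ 2) * w.1.1 z) volume a b := intervalIntegrable_mul hab.le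
        ((continuousOn_const.mul (hp.cont_pow_div 2)).mul (hp.cont_sqrt hab)) (C1Space.cont w)
  have i2 : IntervalIntegrable (fun z => n * (h z ^ n / h z) *
      (dz a b h z / √(1 + dz a b h z ^ 2)) * w.1.2 z)
      volume a b := intervalIntegrable_mul hab.le hk.1 (C1Space.cont' w)
  have i3 := intervalIntegrable_mul hab.le hk.2.1 (C1Space.cont w)
  have i4 : IntervalIntegrable (fun z => h z ^ n / √(1 + dz a b h z ^ 2) ^ 3 *
      (u.1.2 z * v.1.2 z)) volume a b := intervalIntegrable_mul hab.le
        (hp.cont_pow.div ((hp.cont_sqrt hab).pow 3)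
          fun _ _ => (pow_pos (sqrt_one_add_sq_pos _) 3).ne')
        ((C1Space.cont' u).mul (C1Space.cont' v))
  have i5 : IntervalIntegrable (fun z => (n + 1) * H * (n * (h z ^ n / h z) * w.1.1 z))
      volume a b := intervalIntegrable_mul hab.le continuousOn_const
        ((continuousOn_const.mul hdiv).mul (C1Space.cont w))
  simp only [← hw1, ← hw2]
  rw [intervalIntegral.integral_add (i1.add i2) i4, intervalIntegral.integral_add i1 i2, hparts,
    ← sub_eq_add_neg, ← intervalIntegral.integral_sub i1 i3,
    ← intervalIntegral.integral_add (i1.sub i3) i4, SLData.energy_apply,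
    ← intervalIntegral.integral_const_mul, ← intervalIntegral.integral_sub
      (intervalIntegrable_of_continuousOn_Icc hab.le (SLData.cont_energy _ _ _)) i5]
  refine intervalIntegral.integral_congr fun z hz => ?_
  rw [uIcc_of_le hab.le] at hz
  simp only [hw1]
  rw [hp.curvature_eq hz, jacobiData_q n hab hp.smooth hp.pos hz]
  have h1 := (hp.pos z hz).ne'
  have h2 := (sqrt_one_add_sq_pos (dz a b h z)).ne'
  have h3 := sq_sqrt_one_add_sq (dz a b h z)
  have h4 : (hp.data hab).σ z = h z ^ n / √(1 + dz a b h z ^ 2) ^ 3 := rfl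
  rw [h4]
  generalize √(1 + dz a b h z ^ 2) = D at *
  generalize dz a b (dz a b h) z = p' at *
  generalize dz a b h z = p at *
  generalize h z ^ n = E at *
  generalize h z = x at *
  field_simp
  have h5 : p ^ 2 = D ^ 2 - 1 := by rw [h3]; ring
  ring_nf
  simp only [h5]
  ring

end IsHalfPeriod

/-! ### Directional derivatives on slabs -/

section Directional

variable {G : Type*} [NormedAddCommGroup G] [NormedSpace ℝ G] {D : Set G} {F : G → ℝ}

/-- The derivative of `F` within `D` in the direction `e`. -/
def pd (D : Set G) (F : G → ℝ) (e : G) (p : G) : ℝ := fderivWithin ℝ F D p e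

lemma contDiffOn_pd (hU : UniqueDiffOn ℝ D) (hF : ContDiffOn ℝ ∞ F D) (e : G) :
    ContDiffOn ℝ ∞ (pd D F e) D :=
  (hF.fderivWithin hU (by simp)).clm_apply contDiffOn_const

lemma pd_comm (hU : UniqueDiffOn ℝ D) (hcl : D ⊆ closure (interior D)) (hF : ContDiffOn ℝ ∞ F D)
    (e e' : G) {p : G} (hp : p ∈ D) : pd D (pd D F e) e' p = pd D (pd D F e') e p := by
  have h1 : DifferentiableWithinAt ℝ (fderivWithin ℝ F D) D p :=
    (hF.fderivWithin (m := ∞) hU (by simp)).differentiableOn (by simp) p hp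
  have h2 : ∀ e e' : G, pd D (pd D F e) e' p =
      fderivWithin ℝ (fderivWithin ℝ F D) D p e' e := by
    intro e e'
    unfold pd
    rw [fderivWithin_clm_apply (hU p hp) h1 (differentiableWithinAt_const e)]
    simp
  rw [h2, h2]
  have hsm : minSmoothness ℝ 2 ≤ ((2 : ℕ) : WithTop ℕ∞) := by
    rw [minSmoothness_of_isRCLikeNormedField]
    simp
  exact ((contDiffOn_infty.1 hF 2 p hp).isSymmSndFDerivWithinAt hsm hU (hcl hp) hp) e' e

lemma hasDerivWithinAt_pd (hF : ContDiffOn ℝ ∞ F D) {c : ℝ → G} {e : G} {T : Set ℝ} {t : ℝ}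
    (hc : HasDerivWithinAt c e T t) (hT : MapsTo c T D) (ht : c t ∈ D) :
    HasDerivWithinAt (fun τ => F (c τ)) (pd D F e (c t)) T t :=
  ((hF.differentiableOn (by simp)) (c t) ht).hasFDerivWithinAt.comp_hasDerivWithinAt t hc hT

end Directional

section Slab

variable {E : Type*} [NormedAddCommGroup E] {O : Set E} {a b : ℝ}

lemma uniqueDiffOn_slab [NormedSpace ℝ E] (hO : IsOpen O) (hab : a < b) :
    UniqueDiffOn ℝ (O ×ˢ Icc a b) :=
  hO.uniqueDiffOn.prod (uniqueDiffOn_Icc hab)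

lemma slab_subset_closure (hO : IsOpen O) (hab : a < b) :
    O ×ˢ Icc a b ⊆ closure (interior (O ×ˢ Icc a b)) := by
  rw [interior_prod_eq, closure_prod_eq, hO.interior_eq, interior_Icc, closure_Ioo hab.ne]
  exact prod_mono subset_closure le_rfl

lemma hasDerivWithinAt_slab [NormedSpace ℝ E] {F : E × ℝ → ℝ}
    (hF : ContDiffOn ℝ ∞ F (O ×ˢ Icc a b)) {x : E} (hx : x ∈ O) {z : ℝ} (hz : z ∈ Icc a b) :
    HasDerivWithinAt (fun t => F (x, t)) (pd (O ×ˢ Icc a b) F (0, 1) (x, z)) (Icc a b) z :=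
  hasDerivWithinAt_pd hF ((hasDerivWithinAt_const z _ x).prodMk (hasDerivWithinAt_id z _))
    (fun _ ht => ⟨hx, ht⟩) ⟨hx, hz⟩

end Slab

/-! ### Integrals depending on a parameter -/

section Parametric

variable {Y : Type*} [TopologicalSpace Y] [MeasurableSpace Y] [OpensMeasurableSpace Y]
  {m : Measure Y} {κ : Set Y}

lemma continuousOn_setIntegral_param {X : Type*} [TopologicalSpace X] [FirstCountableTopology X]
    {J : Set X} (hJ : IsCompact J)
    (hκ : IsCompact κ) (hκm : MeasurableSet κ) (hm : m κ ≠ ⊤) {Φ : X → Y → ℝ}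
    (hΦ : ContinuousOn (fun p : X × Y => Φ p.1 p.2) (J ×ˢ κ)) :
    ContinuousOn (fun t => ∫ y in κ, Φ t y ∂m) J := by
  obtain ⟨C, hC⟩ := (hJ.prod hκ).exists_bound_of_continuousOn hΦ
  refine continuousOn_of_dominated (bound := fun _ => C) (fun t ht => ?_) (fun t ht => ?_) ?_ ?_
  · exact ContinuousOn.aestronglyMeasurable_of_isCompact
      (hΦ.comp (continuousOn_const.prodMk continuousOn_id) fun y hy => ⟨ht, hy⟩) hκ hκm
  · filter_upwards [ae_restrict_mem hκm] with y hy
    exact hC (t, y) ⟨ht, hy⟩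
  · exact integrableOn_const hm
  · filter_upwards [ae_restrict_mem hκm] with y hy
    exact hΦ.comp (continuousOn_id.prodMk continuousOn_const) fun t ht => ⟨ht, hy⟩

/-- Differentiation under the integral sign over a compact set. -/
lemma hasDerivAt_setIntegral_param {J : Set ℝ} (hJ : IsOpen J)
    (hκ : IsCompact κ) (hκm : MeasurableSet κ) (hm : m κ ≠ ⊤) {Φ Φ' : ℝ → Y → ℝ}
    (hΦ : ContinuousOn (fun p : ℝ × Y => Φ p.1 p.2) (J ×ˢ κ))
    (hΦ' : ContinuousOn (fun p : ℝ × Y => Φ' p.1 p.2) (J ×ˢ κ))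
    (hd : ∀ t ∈ J, ∀ y ∈ κ, HasDerivAt (fun t => Φ t y) (Φ' t y) t) {t₀ : ℝ} (ht₀ : t₀ ∈ J) :
    HasDerivAt (fun t => ∫ y in κ, Φ t y ∂m) (∫ y in κ, Φ' t₀ y ∂m) t₀ := by
  obtain ⟨r, hr, hball⟩ := Metric.nhds_basis_closedBall.mem_iff.1 (hJ.mem_nhds ht₀)
  have hK := (isCompact_closedBall t₀ r).prod hκ
  obtain ⟨C, hC⟩ := hK.exists_bound_of_continuousOn
    (hΦ'.mono (prod_mono hball le_rfl))
  have hmeas : ∀ t ∈ J, ∀ Ψ : ℝ → Y → ℝ,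
      ContinuousOn (fun p : ℝ × Y => Ψ p.1 p.2) (J ×ˢ κ) →
      ContinuousOn (Ψ t) κ := fun t ht Ψ hΨ =>
    hΨ.comp (continuousOn_const.prodMk continuousOn_id) fun y hy => ⟨ht, hy⟩
  refine (hasDerivAt_integral_of_dominated_loc_of_deriv_le (bound := fun _ => C)
    (Metric.closedBall_mem_nhds t₀ hr) ?_ ?_ ?_ ?_ ?_ ?_).2
  · filter_upwards [hJ.mem_nhds ht₀] with t ht
    exact (hmeas t ht Φ hΦ).aestronglyMeasurable_of_isCompact hκ hκm
  · obtain ⟨B, hB⟩ := hκ.exists_bound_of_continuousOn (hmeas t₀ ht₀ Φ hΦ)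
    refine (integrableOn_const (C := B) hm).mono'
      ((hmeas t₀ ht₀ Φ hΦ).aestronglyMeasurable_of_isCompact hκ hκm) ?_
    filter_upwards [ae_restrict_mem hκm] with y hy using hB y hy
  · exact (hmeas t₀ ht₀ Φ' hΦ').aestronglyMeasurable_of_isCompact hκ hκm
  · filter_upwards [ae_restrict_mem hκm] with y hy t ht
    exact hC (t, y) ⟨ht, hy⟩
  · exact integrableOn_const hm
  · filter_upwards [ae_restrict_mem hκm] with y hy t ht
    exact hd t (hball ht) y hy

lemma iteratedDeriv_two_setIntegral_param {J : Set ℝ} (hJ : IsOpen J)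
    (hκ : IsCompact κ) (hκm : MeasurableSet κ) (hm : m κ ≠ ⊤) {Φ Φ' Φ'' : ℝ → Y → ℝ}
    (hΦ : ContinuousOn (fun p : ℝ × Y => Φ p.1 p.2) (J ×ˢ κ))
    (hΦ' : ContinuousOn (fun p : ℝ × Y => Φ' p.1 p.2) (J ×ˢ κ))
    (hΦ'' : ContinuousOn (fun p : ℝ × Y => Φ'' p.1 p.2) (J ×ˢ κ))
    (hd : ∀ t ∈ J, ∀ y ∈ κ, HasDerivAt (fun t => Φ t y) (Φ' t y) t)
    (hd' : ∀ t ∈ J, ∀ y ∈ κ, HasDerivAt (fun t => Φ' t y) (Φ'' t y) t) {t₀ : ℝ} (ht₀ : t₀ ∈ J) :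
    iteratedDeriv 2 (fun t => ∫ y in κ, Φ t y ∂m) t₀ = ∫ y in κ, Φ'' t₀ y ∂m := by
  have h1 : deriv (fun t => ∫ y in κ, Φ t y ∂m) =ᶠ[nhds t₀] fun t => ∫ y in κ, Φ' t y ∂m := by
    filter_upwards [hJ.mem_nhds ht₀] with t ht
    exact (hasDerivAt_setIntegral_param hJ hκ hκm hm hΦ hΦ' hd ht).deriv
  rw [iteratedDeriv_succ, iteratedDeriv_one, h1.deriv_eq]
  exact (hasDerivAt_setIntegral_param hJ hκ hκm hm hΦ' hΦ'' hd' ht₀).deriv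

lemma intervalIntegral_eq_setIntegral_Icc {a b : ℝ} (hab : a ≤ b) (f : ℝ → ℝ) :
    ∫ z in a..b, f z = ∫ z in Icc a b, f z := by
  rw [intervalIntegral.integral_of_le hab, integral_Icc_eq_integral_Ioc]

end Parametric

/-! ### The variation along the family of half periods -/

/-- The area of the unit sphere `Sⁿ`. -/
def sphereArea (n : ℕ) : ℝ := ((volume : Measure (Cross n)).toSphere).real univ

lemma sphereArea_pos (n : ℕ) : 0 < sphereArea n := by
  unfold sphereArea
  rw [Measure.toSphere_real_apply_univ]
  have h1 : 0 < Module.finrank ℝ (Cross n) := by simp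
  have h2 : 0 < (volume : Measure (Cross n)).real (Metric.ball 0 1) :=
    ENNReal.toReal_pos (Metric.measure_ball_pos volume 0 one_pos).ne' measure_ball_lt_top.ne
  positivity

lemma profileVolume_eq (n : ℕ) (a b : ℝ) (h : ℝ → ℝ) :
    profileVolume n a b h = ((n : ℝ) + 1)⁻¹ * (sphereArea n * ∫ z in a..b, h z ^ (n + 1)) := by
  unfold profileVolume enclosedVolume
  rw [integral_const, smul_eq_mul]
  rfl

section Family

variable {n : ℕ} {a b : ℝ} {I : Set ℝ} {h : ℝ → ℝ → ℝ} {H : ℝ → ℝ}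

/-- The Jacobi field `∂h/∂s` generated by a family of half periods: it represents the first
variation of volume, up to the factor `-(n+1) H'`, with respect to the energy form. -/
theorem exists_family_field (hn : 1 ≤ n) (hab : a < b) (hI : IsOpen I)
    (hsm : ContDiffOn ℝ ∞ (fun p : ℝ × ℝ => h p.1 p.2) (I ×ˢ Icc a b))
    (hund : ∀ s ∈ I, IsHalfPeriod n a b (h s) (H s)) {s : ℝ} (hs : s ∈ I) :
    ∃ w : C1Space a b, ContDiffOn ℝ ∞ w.1.1 (Icc a b) ∧
      (∀ z ∈ Icc a b, HasDerivAt (fun t => h t z) (w.1.1 z) s) ∧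
      (∀ v, ((hund s hs).data hab).energy w v =
        -((n + 1) * deriv H s) * (hund s hs).volumeForm hab v) ∧
      HasDerivAt (fun t => profileVolume n a b (h t))
        (sphereArea n * (hund s hs).volumeForm hab w) s := by
  set D : Set (ℝ × ℝ) := I ×ˢ Icc a b with hD
  set F : ℝ × ℝ → ℝ := fun p => h p.1 p.2 with hF
  have hU : UniqueDiffOn ℝ D := uniqueDiffOn_slab hI hab
  have hcl : D ⊆ closure (interior D) := slab_subset_closure hI hab
  set P : ℝ × ℝ → ℝ := pd D F (0, 1) with hP
  set W : ℝ × ℝ → ℝ := pd D F (1, 0) with hW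
  set W' : ℝ × ℝ → ℝ := pd D P (1, 0) with hW'
  have sP : ContDiffOn ℝ ∞ P D := contDiffOn_pd hU hsm _
  have sW : ContDiffOn ℝ ∞ W D := contDiffOn_pd hU hsm _
  have sW' : ContDiffOn ℝ ∞ W' D := contDiffOn_pd hU sP _
  have hdz : ∀ t ∈ I, ∀ z ∈ Icc a b, dz a b (h t) z = P (t, z) := fun t ht z hz =>
    dz_eq hab hz (hasDerivWithinAt_slab hsm ht hz)
  have hline : ∀ {Q : ℝ × ℝ → ℝ}, ContDiffOn ℝ ∞ Q D → ∀ t ∈ I, ∀ z ∈ Icc a b,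
      HasDerivAt (fun τ => Q (τ, z)) (pd D Q (1, 0) (t, z)) t := fun {Q} hQ t ht z hz =>
    (hasDerivWithinAt_pd hQ ((hasDerivWithinAt_id t I).prodMk (hasDerivWithinAt_const t I z))
      (fun _ hτ => ⟨hτ, hz⟩) ⟨ht, hz⟩).hasDerivAt (hI.mem_nhds ht)
  have hFd : ∀ t ∈ I, ∀ z ∈ Icc a b, HasDerivAt (fun τ => h τ z) (W (t, z)) t := hline hsm
  have hPd : ∀ t ∈ I, ∀ z ∈ Icc a b, HasDerivAt (fun τ => P (τ, z)) (W' (t, z)) t := hline sP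
  have hpos : ∀ p ∈ D, 0 < F p := fun p hp => (hund p.1 hp.1).pos p.2 hp.2
  have hslice : ∀ z ∈ Icc a b, HasDerivWithinAt (fun t => W (s, t)) (W' (s, z)) (Icc a b) z := by
    intro z hz
    have h1 := hasDerivWithinAt_slab sW hs hz
    rwa [hW, pd_comm hU hcl hsm (1, 0) (0, 1) ⟨hs, hz⟩] at h1
  have hmap : ContDiffOn ℝ ∞ (fun z : ℝ => (s, z)) (Icc a b) := by fun_prop
  have hmapsto : MapsTo (fun z : ℝ => (s, z)) (Icc a b) D := fun z hz => ⟨hs, hz⟩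
  let w : C1Space a b := ⟨(fun z => W (s, z), fun z => W' (s, z)),
    mem_C1Space_of_hasDerivWithinAt (sW'.continuousOn.comp hmap.continuousOn hmapsto) hslice⟩
  -- continuity of the building blocks on the slab
  have cF : ContinuousOn F D := hsm.continuousOn
  have cFn : ContinuousOn (fun p => F p ^ n) D := cF.pow n
  have cFd : ∀ k : ℕ, ContinuousOn (fun p => F p ^ n / F p ^ k) D := fun k =>
    cFn.div (cF.pow k) fun p hp => (pow_pos (hpos p hp) k).ne'
  have cFd1 : ContinuousOn (fun p => F p ^ n / F p) D := by simpa using cFd 1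
  have cS : ContinuousOn (fun p => √(1 + P p ^ 2)) D :=
    (continuousOn_const.add (sP.continuousOn.pow 2)).sqrt
  have cPS : ContinuousOn (fun p => P p / √(1 + P p ^ 2)) D :=
    sP.continuousOn.div cS fun p _ => (sqrt_one_add_sq_pos _).ne'
  have cW := sW.continuousOn
  have cW' := sW'.continuousOn
  have csnd : ∀ {f : ℝ → ℝ}, ContinuousOn f (Icc a b) → ContinuousOn (fun p : ℝ × ℝ => f p.2) D :=
    fun hf => hf.comp continuousOn_snd fun p hp => hp.2
  have hfin : volume (Icc a b) ≠ ⊤ := measure_Icc_lt_top.ne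
  -- the first variations of area and of volume in the direction `v`, as functions of `s`
  have hVol : ∀ v : C1Space a b, HasDerivAt (fun t => ∫ z in Icc a b, h t z ^ n * v.1.1 z)
      (∫ z in Icc a b, n * (h s z ^ n / h s z) * W (s, z) * v.1.1 z) s := by
    intro v
    refine hasDerivAt_setIntegral_param hI isCompact_Icc measurableSet_Icc hfin
      (Φ' := fun t z => n * (h t z ^ n / h t z) * W (t, z) * v.1.1 z) ?_ ?_ ?_ hs
    · exact cFn.mul (csnd (C1Space.cont v))
    · exact ((continuousOn_const.mul cFd1).mul cW).mul (csnd (C1Space.cont v))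
    · intro t ht z hz
      have h1 := (hFd t ht z hz).hasDerivWithinAt (s := univ)
      have h2 := hasDerivWithinAt_pow_of_pos hn h1 (hpos (t, z) ⟨ht, hz⟩).ne'
      exact (h2.hasDerivAt Filter.univ_mem).mul_const _
  have hArea : ∀ v : C1Space a b, HasDerivAt
      (fun t => ∫ z in Icc a b, (n * (h t z ^ n / h t z) * √(1 + P (t, z) ^ 2) * v.1.1 z +
        h t z ^ n * (P (t, z) / √(1 + P (t, z) ^ 2)) * v.1.2 z))
      (∫ z in Icc a b, (n * (n - 1) * (h s z ^ n / h s z ^ 2) * √(1 + P (s, z) ^ 2) *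
          (W (s, z) * v.1.1 z) +
        n * (h s z ^ n / h s z) * (P (s, z) / √(1 + P (s, z) ^ 2)) *
          (W' (s, z) * v.1.1 z + W (s, z) * v.1.2 z) +
        h s z ^ n / √(1 + P (s, z) ^ 2) ^ 3 * (W' (s, z) * v.1.2 z))) s := by
    intro v
    refine hasDerivAt_setIntegral_param hI isCompact_Icc measurableSet_Icc hfin
      (Φ' := fun t z => n * (n - 1) * (h t z ^ n / h t z ^ 2) * √(1 + P (t, z) ^ 2) *
          (W (t, z) * v.1.1 z) +
        n * (h t z ^ n / h t z) * (P (t, z) / √(1 + P (t, z) ^ 2)) *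
          (W' (t, z) * v.1.1 z + W (t, z) * v.1.2 z) +
        h t z ^ n / √(1 + P (t, z) ^ 2) ^ 3 * (W' (t, z) * v.1.2 z)) ?_ ?_ ?_ hs
    · exact (((continuousOn_const.mul cFd1).mul cS).mul (csnd (C1Space.cont v))).add
        ((cFn.mul cPS).mul (csnd (C1Space.cont' v)))
    · exact ((((continuousOn_const.mul (cFd 2)).mul cS).mul (cW.mul (csnd (C1Space.cont v)))).add
        (((continuousOn_const.mul cFd1).mul cPS).mul ((cW'.mul (csnd (C1Space.cont v))).add
          (cW.mul (csnd (C1Space.cont' v)))))).add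
        ((cFn.div (cS.pow 3) fun p _ => (pow_pos (sqrt_one_add_sq_pos _) 3).ne').mul
          (cW'.mul (csnd (C1Space.cont' v))))
    · intro t ht z hz
      have hx := (hpos (t, z) ⟨ht, hz⟩).ne'
      have h1 := (hFd t ht z hz).hasDerivWithinAt (s := univ)
      have h2 := (hPd t ht z hz).hasDerivWithinAt (s := univ)
      have h3 := (((hasDerivWithinAt_pow_div hn h1 hx).const_mul (n : ℝ)).mul
        (hasDerivWithinAt_sqrt_slope h2)).mul_const (v.1.1 z)
      have h4 := ((hasDerivWithinAt_pow_of_pos hn h1 hx).mul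
        (hasDerivWithinAt_slope_div h2)).mul_const (v.1.2 z)
      refine ((h3.add h4).hasDerivAt Filter.univ_mem).congr_deriv ?_
      ring
  -- the weak Euler–Lagrange equation, for all parameters
  have hEL : ∀ t ∈ I, ∀ v : C1Space a b,
      ∫ z in Icc a b, (n * (h t z ^ n / h t z) * √(1 + P (t, z) ^ 2) * v.1.1 z +
        h t z ^ n * (P (t, z) / √(1 + P (t, z) ^ 2)) * v.1.2 z) =
      -((n + 1) * H t) * ∫ z in Icc a b, h t z ^ n * v.1.1 z := by
    intro t ht v
    have h1 := (hund t ht).euler_lagrange hn hab v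
    rw [(hund t ht).volumeForm_apply, intervalIntegral_eq_setIntegral_Icc hab.le,
      intervalIntegral_eq_setIntegral_Icc hab.le] at h1
    rw [← h1]
    refine setIntegral_congr_fun measurableSet_Icc fun z hz => ?_
    simp only [hdz t ht z hz]
  -- testing with `1` expresses `H` by integrals, so `H` is differentiable
  have hHdiff : DifferentiableAt ℝ H s := by
    have hvpos : ∀ t ∈ I, 0 < ∫ z in Icc a b, h t z ^ n * (C1Space.one a b).1.1 z := by
      intro t ht
      rw [← intervalIntegral_eq_setIntegral_Icc hab.le]
      have hc := (hund t ht).cont_pow.mul (C1Space.cont (C1Space.one a b))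
      refine intervalIntegral.integral_pos hab hc (fun z hz => ?_)
        ⟨a, left_mem_Icc.2 hab.le, ?_⟩
      · have := pow_pos ((hund t ht).pos z (Ioc_subset_Icc_self hz)) n
        change 0 ≤ h t z ^ n * 1
        linarith
      · have := pow_pos ((hund t ht).pos a (left_mem_Icc.2 hab.le)) n
        change 0 < h t a ^ n * 1
        linarith
    have h1 : H =ᶠ[nhds s] fun t => -(∫ z in Icc a b, (n * (h t z ^ n / h t z) *
        √(1 + P (t, z) ^ 2) * (C1Space.one a b).1.1 z +
        h t z ^ n * (P (t, z) / √(1 + P (t, z) ^ 2)) * (C1Space.one a b).1.2 z)) /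
        ((n + 1) * ∫ z in Icc a b, h t z ^ n * (C1Space.one a b).1.1 z) := by
      filter_upwards [hI.mem_nhds hs] with t ht
      rw [hEL t ht]
      have := (hvpos t ht).ne'
      have hn0 : (n : ℝ) + 1 ≠ 0 := by positivity
      field_simp
    refine DifferentiableAt.congr_of_eventuallyEq ?_ h1
    exact (hArea _).differentiableAt.neg.div ((hVol _).differentiableAt.const_mul _)
      (mul_ne_zero (by positivity) (hvpos s hs).ne')
  refine ⟨w, sW.comp hmap hmapsto, fun z hz => hFd s hs z hz, fun v => ?_, ?_⟩
  · -- differentiate the weak Euler–Lagrange equation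
    have h1 : HasDerivAt (fun t => -((n + 1) * H t) * ∫ z in Icc a b, h t z ^ n * v.1.1 z)
        _ s := ((hHdiff.hasDerivAt.const_mul ((n : ℝ) + 1)).neg).mul (hVol v)
    have h2 := (h1.congr_of_eventuallyEq (Filter.eventuallyEq_of_mem (hI.mem_nhds hs)
      fun t ht => hEL t ht v)).unique (hArea v)
    have h3 := (hund s hs).second_variation_eq hn hab w v
    have e1 : (hund s hs).volumeForm hab v = ∫ z in Icc a b, h s z ^ n * v.1.1 z := by
      rw [(hund s hs).volumeForm_apply, intervalIntegral_eq_setIntegral_Icc hab.le]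
    rw [intervalIntegral_eq_setIntegral_Icc hab.le,
      intervalIntegral_eq_setIntegral_Icc hab.le] at h3
    have e2 : ∫ z in Icc a b, n * (h s z ^ n / h s z) * (w.1.1 z * v.1.1 z) =
        ∫ z in Icc a b, n * (h s z ^ n / h s z) * W (s, z) * v.1.1 z := by
      congr 1; ext z; change _ * (W (s, z) * _) = _; ring
    rw [e2] at h3
    rw [e1]
    have e3 : ∀ z ∈ Icc a b, n * (n - 1) * (h s z ^ n / h s z ^ 2) * √(1 + P (s, z) ^ 2) *
          (W (s, z) * v.1.1 z) +
        n * (h s z ^ n / h s z) * (P (s, z) / √(1 + P (s, z) ^ 2)) *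
          (W' (s, z) * v.1.1 z + W (s, z) * v.1.2 z) +
        h s z ^ n / √(1 + P (s, z) ^ 2) ^ 3 * (W' (s, z) * v.1.2 z) =
        n * (n - 1) * (h s z ^ n / h s z ^ 2) * √(1 + dz a b (h s) z ^ 2) *
          (w.1.1 z * v.1.1 z) +
        n * (h s z ^ n / h s z) * (dz a b (h s) z / √(1 + dz a b (h s) z ^ 2)) *
          (w.1.2 z * v.1.1 z + w.1.1 z * v.1.2 z) +
        h s z ^ n / √(1 + dz a b (h s) z ^ 2) ^ 3 * (w.1.2 z * v.1.2 z) := by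
      intro z hz
      rw [hdz s hs z hz]
    rw [setIntegral_congr_fun measurableSet_Icc e3, h3] at h2
    simp only [Pi.neg_apply] at h2
    linear_combination -h2
  · have h1 : HasDerivAt (fun t => ∫ z in Icc a b, h t z ^ (n + 1))
        (∫ z in Icc a b, (n + 1) * (h s z ^ n * W (s, z))) s := by
      refine hasDerivAt_setIntegral_param hI isCompact_Icc measurableSet_Icc hfin
        (Φ' := fun t z => (n + 1) * (h t z ^ n * W (t, z))) (cF.pow (n + 1))
        (continuousOn_const.mul (cFn.mul cW)) ?_ hs
      intro t ht z hz
      refine ((hFd t ht z hz).pow (n + 1)).congr_deriv ?_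
      push_cast
      ring
    have h2 := (h1.const_mul (sphereArea n)).const_mul ((n : ℝ) + 1)⁻¹
    have h3 : (fun t => profileVolume n a b (h t)) =
        fun t => ((n : ℝ) + 1)⁻¹ * (sphereArea n * ∫ z in Icc a b, h t z ^ (n + 1)) := by
      ext t
      rw [profileVolume_eq, intervalIntegral_eq_setIntegral_Icc hab.le]
    rw [h3]
    refine h2.congr_deriv ?_
    rw [integral_const_mul, (hund s hs).volumeForm_apply,
      intervalIntegral_eq_setIntegral_Icc hab.le]
    have hn0 : (n : ℝ) + 1 ≠ 0 := by positivity
    field_simp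
    rfl

/-- The parametrization by non-uniformness makes the Jacobi field of the family non-trivial. -/
lemma family_field_ne_zero (hab : a < b) (hI : IsOpen I)
    (hund : ∀ s ∈ I, IsHalfPeriod n a b (h s) (H s))
    (hpar : ∀ s ∈ I, nonuniformness a b (h s) = s) {s : ℝ} (hs : s ∈ I) {w : ℝ → ℝ}
    (hw : ∀ z ∈ Icc a b, HasDerivAt (fun t => h t z) (w z) s) : ∃ z ∈ Icc a b, w z ≠ 0 := by
  by_contra! h0
  have haI : a ∈ Icc a b := left_mem_Icc.2 hab.le
  have hbI : b ∈ Icc a b := right_mem_Icc.2 hab.le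
  have ha := hw a haI
  have hb := hw b hbI
  rw [h0 a haI] at ha
  rw [h0 b hbI] at hb
  have hpos := fun z hz => (hund s hs).pos z hz
  -- near `s` the larger end radius stays the larger one, so the parameter would be stationary
  have key : ∀ c d : ℝ, HasDerivAt (fun t => h t c) 0 s → HasDerivAt (fun t => h t d) 0 s →
      h s c < h s d → 0 < h s d →
      (∀ t ∈ I, h t c < h t d → nonuniformness a b (h t) = 1 - h t c / h t d) → False := by
    intro c d hc hd hlt hd0 hnon
    have h1 : ∀ᶠ t in nhds s, h t c < h t d :=
      hc.continuousAt.eventually_lt hd.continuousAt hlt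
    have h2 : (fun t : ℝ => t) =ᶠ[nhds s] fun t => 1 - h t c / h t d := by
      filter_upwards [h1, hI.mem_nhds hs] with t ht htI
      rw [← hnon t htI ht, hpar t htI]
    have h3 := ((hc.div hd hd0.ne').const_sub 1).congr_of_eventuallyEq h2
    have := h3.unique (hasDerivAt_id s)
    simp at this
  rcases (hund s hs).mono with hm | hm
  · refine key a b ha hb (hm haI hbI hab) (hpos b hbI) fun t _ hlt => ?_
    unfold nonuniformness
    rw [min_eq_left hlt.le, max_eq_right hlt.le]
  · refine key b a hb ha (hm haI hbI hab) (hpos a haI) fun t _ hlt => ?_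
    unfold nonuniformness
    rw [min_eq_right hlt.le, max_eq_left hlt.le]

end Family

/-! ### The Gaussian Poincaré inequality -/

section Gaussian

open ProbabilityTheory Filter Topology

lemma integrable_pow_mul_gaussian (k : ℕ) :
    Integrable (fun x : ℝ => x ^ k * Real.exp (-(1 / 2) * x ^ 2)) := by
  have := integrable_rpow_mul_exp_neg_mul_sq (b := 1 / 2) (by norm_num) (s := (k : ℝ))
    (by have : (0 : ℝ) ≤ k := k.cast_nonneg; linarith)
  simpa using this

lemma hasDerivAt_exp_neg_sq (x : ℝ) :
    HasDerivAt (fun x : ℝ => Real.exp (-(1 / 2) * x ^ 2)) (-x * Real.exp (-(1 / 2) * x ^ 2)) x := by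
  refine (((hasDerivAt_pow 2 x).const_mul (-(1 / 2) : ℝ)).exp).congr_deriv ?_
  norm_num
  ring

/-- On the half line, `∫ g² e^{-x²/2} ≤ ∫ g'² e^{-x²/2}` if `g 0 = 0`: the difference of the
integrands is `(g' - g / x)² e^{-x²/2}` plus the derivative of `g² e^{-x²/2} / x`. -/
lemma half_line_poincare {g g' : ℝ → ℝ} {C : ℝ} (hg : ∀ x, HasDerivAt g (g' x) x)
    (hg' : Continuous g') (hC : ∀ x, |g' x| ≤ C) (h0 : g 0 = 0) :
    ∫ x in Ioi 0, g x ^ 2 * Real.exp (-(1 / 2) * x ^ 2) ≤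
      ∫ x in Ioi 0, g' x ^ 2 * Real.exp (-(1 / 2) * x ^ 2) := by
  set e : ℝ → ℝ := fun x => Real.exp (-(1 / 2) * x ^ 2) with he
  have hec : Continuous e := by fun_prop
  have hepos : ∀ x, 0 < e x := fun x => Real.exp_pos _
  have hgc : Continuous g := continuous_iff_continuousAt.2 fun x => (hg x).continuousAt
  have hC0 : 0 ≤ C := (abs_nonneg _).trans (hC 0)
  have hlin : ∀ x, |g x| ≤ C * |x| := by
    intro x
    have := (convex_univ (𝕜 := ℝ) (E := ℝ)).norm_image_sub_le_of_norm_hasDerivWithin_le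
      (f := g) (f' := g') (C := C) (fun x _ => (hg x).hasDerivWithinAt) (fun x _ => hC x)
      (mem_univ 0) (mem_univ x)
    simpa [h0] using this
  have hsq : ∀ x, g x ^ 2 ≤ C ^ 2 * x ^ 2 := by
    intro x
    rw [← mul_pow, ← sq_abs (g x), ← sq_abs (C * x), abs_mul, abs_of_nonneg hC0]
    exact pow_le_pow_left₀ (abs_nonneg _) (hlin x) 2
  have i0 : Integrable (fun x => C ^ 2 * e x) := by
    have := (integrable_pow_mul_gaussian 0).const_mul (C ^ 2)
    simp only [pow_zero, one_mul] at this
    exact this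
  have i2 : Integrable (fun x => C ^ 2 * (x ^ 2 * e x)) :=
    (integrable_pow_mul_gaussian 2).const_mul (C ^ 2)
  have ig : Integrable (fun x => g x ^ 2 * e x) := by
    refine i2.mono' (by fun_prop) (Eventually.of_forall fun x => ?_)
    rw [Real.norm_of_nonneg (by have := hepos x; positivity), ← mul_assoc]
    exact mul_le_mul_of_nonneg_right (hsq x) (hepos x).le
  have ig' : Integrable (fun x => g' x ^ 2 * e x) := by
    refine i0.mono' (by fun_prop) (Eventually.of_forall fun x => ?_)
    rw [Real.norm_of_nonneg (by have := hepos x; positivity)]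
    refine mul_le_mul_of_nonneg_right ?_ (hepos x).le
    rw [← sq_abs]
    exact pow_le_pow_left₀ (abs_nonneg _) (hC x) 2
  set T : ℝ → ℝ := fun x => g x ^ 2 / x * e x with hT
  set T' : ℝ → ℝ := fun x => (2 * (g x / x) * g' x - (g x / x) ^ 2) * e x - g x ^ 2 * e x with hT'
  have hderiv : ∀ x ∈ Ioi (0 : ℝ), HasDerivAt T (T' x) x := by
    intro x hx
    have hx0 : x ≠ 0 := (ne_of_gt hx)
    refine ((((hg x).fun_pow 2).fun_div (hasDerivAt_id' x) hx0).fun_mul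
      (hasDerivAt_exp_neg_sq x)).congr_deriv ?_
    simp only [hT', he]
    field_simp
    push_cast
    ring
  have hquot : ∀ x ∈ Ioi (0 : ℝ), |g x / x| ≤ C := by
    intro x hx
    rw [abs_div, div_le_iff₀ (abs_pos.2 (ne_of_gt hx))]
    exact hlin x
  have iT1 : IntegrableOn (fun x => (2 * (g x / x) * g' x - (g x / x) ^ 2) * e x) (Ioi 0) := by
    refine (i0.const_mul 3).integrableOn.mono' ?_ ?_
    · refine ContinuousOn.aestronglyMeasurable ?_ measurableSet_Ioi
      have hq : ContinuousOn (fun x => g x / x) (Ioi 0) :=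
        hgc.continuousOn.div continuousOn_id fun x hx => (ne_of_gt hx)
      exact (((continuousOn_const.mul hq).mul hg'.continuousOn).sub (hq.pow 2)).mul
        hec.continuousOn
    · filter_upwards [ae_restrict_mem measurableSet_Ioi] with x hx
      rw [Real.norm_eq_abs, abs_mul, abs_of_pos (hepos x), ← mul_assoc]
      refine mul_le_mul_of_nonneg_right ?_ (hepos x).le
      have h1 := abs_le.1 (hquot x hx)
      have h2 := abs_le.1 (hC x)
      have h3 : |g x / x| * |g' x| ≤ C * C :=
        mul_le_mul (hquot x hx) (hC x) (abs_nonneg _) hC0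
      rw [← abs_mul] at h3
      have h4 := abs_le.1 h3
      have h5 : (g x / x) ^ 2 ≤ C ^ 2 := sq_le_sq' h1.1 h1.2
      rw [abs_le]
      constructor <;> nlinarith [sq_nonneg (g x / x)]
  have iT : IntegrableOn T' (Ioi 0) := iT1.sub ig.integrableOn
  have hbound : ∀ x, |T x| ≤ C ^ 2 * |x| * e x := by
    intro x
    rw [hT, abs_mul, abs_of_pos (hepos x)]
    refine mul_le_mul_of_nonneg_right ?_ (hepos x).le
    rcases eq_or_ne x 0 with rfl | hx
    · simp
    · rw [abs_div, div_le_iff₀ (abs_pos.2 hx), abs_of_nonneg (sq_nonneg _), mul_assoc,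
        abs_mul_abs_self, ← sq]
      exact hsq x
  have hcont : ContinuousWithinAt T (Ici 0) 0 := by
    have h1 : Tendsto (fun x => C ^ 2 * |x| * e x) (𝓝 0) (𝓝 0) := by
      have : Continuous fun x => C ^ 2 * |x| * e x := by fun_prop
      simpa using this.tendsto 0
    have h2 : Tendsto T (𝓝 0) (𝓝 0) := squeeze_zero_norm hbound h1
    have h3 : T 0 = 0 := by simp [hT]
    have : ContinuousAt T 0 := by rw [ContinuousAt, h3]; exact h2
    exact this.continuousWithinAt
  have hlim : Tendsto T atTop (𝓝 0) := by
    have h1 : Tendsto (fun x : ℝ => C ^ 2 * (|x| * e x)) atTop (𝓝 (C ^ 2 * 0)) := by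
      refine Tendsto.const_mul _ ?_
      have h2 : Tendsto (fun x : ℝ => x ^ 1 * Real.exp (-x)) atTop (𝓝 0) :=
        Real.tendsto_pow_mul_exp_neg_atTop_nhds_zero 1
      refine squeeze_zero' (Eventually.of_forall fun x => by have := hepos x; positivity) ?_ h2
      filter_upwards [eventually_ge_atTop (2 : ℝ)] with x hx
      rw [abs_of_nonneg (by linarith), pow_one]
      refine mul_le_mul_of_nonneg_left (Real.exp_le_exp.2 ?_) (by linarith)
      nlinarith
    rw [mul_zero] at h1
    exact squeeze_zero_norm (fun x => by simpa [mul_assoc] using hbound x) h1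
  have key := integral_Ioi_of_hasDerivAt_of_tendsto hcont hderiv iT hlim
  have hT0 : T 0 = 0 := by simp [hT]
  rw [hT0, sub_zero, hT', integral_sub iT1 ig.integrableOn] at key
  have h1 : ∫ x in Ioi 0, (2 * (g x / x) * g' x - (g x / x) ^ 2) * e x ≤
      ∫ x in Ioi 0, g' x ^ 2 * e x := by
    refine setIntegral_mono_on iT1 ig'.integrableOn measurableSet_Ioi fun x _ => ?_
    refine mul_le_mul_of_nonneg_right ?_ (hepos x).le
    nlinarith [sq_nonneg (g x / x - g' x)]
  linarith

/-- The standard Gaussian measure on the line. -/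
abbrev stdGauss : Measure ℝ := gaussianReal 0 1

lemma integral_stdGauss (f : ℝ → ℝ) :
    ∫ x, f x ∂stdGauss = (√(2 * Real.pi))⁻¹ * ∫ x, f x * Real.exp (-(1 / 2) * x ^ 2) := by
  rw [integral_gaussianReal_eq_integral_smul (by norm_num), ← integral_const_mul]
  congr 1; ext x
  simp only [gaussianPDFReal, smul_eq_mul, NNReal.coe_one, mul_one, sub_zero]
  rw [show -x ^ 2 / 2 = -(1 / 2) * x ^ 2 by ring]
  ring

lemma memLp_of_linear_growth {f : ℝ → ℝ} (hf : Continuous f) {C : ℝ}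
    (hC : ∀ x, |f x| ≤ C * (1 + |x|)) : MemLp f 2 stdGauss := by
  have h1 : MemLp (fun x : ℝ => C * (1 + |x|)) 2 stdGauss := by
    have h2 : MemLp (fun x : ℝ => x) 2 stdGauss := memLp_id_gaussianReal' 2 (by norm_num)
    have h3 : MemLp (fun x : ℝ => |x|) 2 stdGauss := h2.norm
    have h0 : MemLp (fun _ : ℝ => (1 : ℝ)) 2 stdGauss := memLp_const 1
    exact (h0.add h3).const_mul C
  exact h1.mono' hf.aestronglyMeasurable (Eventually.of_forall hC)

lemma sq_integral_le {α : Type*} [MeasurableSpace α] {μ : Measure α} [IsProbabilityMeasure μ]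
    {f : α → ℝ} (hf : MemLp f 2 μ) (c : ℝ) :
    ∫ x, f x ^ 2 ∂μ - (∫ x, f x ∂μ) ^ 2 ≤ ∫ x, (f x - c) ^ 2 ∂μ := by
  have i1 : Integrable f μ := hf.integrable (by norm_num)
  have i2 : Integrable (fun x => f x ^ 2) μ := hf.integrable_sq
  have h1 : ∫ x, (f x - c) ^ 2 ∂μ = ∫ x, f x ^ 2 ∂μ - 2 * c * ∫ x, f x ∂μ + c ^ 2 := by
    have : ∀ x, (f x - c) ^ 2 = f x ^ 2 - 2 * c * f x + c ^ 2 := fun x => by ring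
    simp_rw [this]
    have i3 : Integrable (fun x => f x ^ 2 - 2 * c * f x) μ := i2.sub (i1.const_mul _)
    rw [integral_add i3 (integrable_const _),
      integral_sub i2 (i1.const_mul _), integral_const_mul]
    simp
  rw [h1]
  nlinarith [sq_nonneg (∫ x, f x ∂μ - c)]

lemma sq_integral_le_integral_sq {α : Type*} [MeasurableSpace α] {μ : Measure α}
    [IsProbabilityMeasure μ] {f : α → ℝ} (hf : MemLp f 2 μ) :
    (∫ x, f x ∂μ) ^ 2 ≤ ∫ x, f x ^ 2 ∂μ := by
  have i1 : Integrable f μ := hf.integrable (by norm_num)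
  have i2 : Integrable (fun x => f x ^ 2) μ := hf.integrable_sq
  set c := ∫ x, f x ∂μ with hc
  have h0 : 0 ≤ ∫ x, (f x - c) ^ 2 ∂μ := integral_nonneg fun x => sq_nonneg _
  have i3 : Integrable (fun x => f x ^ 2 - 2 * c * f x) μ := i2.sub (i1.const_mul _)
  have : ∀ x, (f x - c) ^ 2 = f x ^ 2 - 2 * c * f x + c ^ 2 := fun x => by ring
  simp_rw [this] at h0
  rw [integral_add i3 (integrable_const _), integral_sub i2 (i1.const_mul _),
    integral_const_mul, ← hc] at h0
  simp only [integral_const, probReal_univ, smul_eq_mul] at h0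
  nlinarith

/-- The Gaussian Poincaré inequality on the line. -/
theorem gaussian_poincare_one {f f' : ℝ → ℝ} {C : ℝ} (hf : ∀ x, HasDerivAt f (f' x) x)
    (hf' : Continuous f') (hC : ∀ x, |f' x| ≤ C) :
    ∫ x, f x ^ 2 ∂stdGauss - (∫ x, f x ∂stdGauss) ^ 2 ≤ ∫ x, f' x ^ 2 ∂stdGauss := by
  have hfc : Continuous f := continuous_iff_continuousAt.2 fun x => (hf x).continuousAt
  have hC0 : 0 ≤ C := (abs_nonneg _).trans (hC 0)
  have hlin : ∀ x, |f x - f 0| ≤ C * |x| := by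
    intro x
    have := (convex_univ (𝕜 := ℝ) (E := ℝ)).norm_image_sub_le_of_norm_hasDerivWithin_le
      (f := f) (f' := f') (C := C) (fun x _ => (hf x).hasDerivWithinAt) (fun x _ => hC x)
      (mem_univ 0) (mem_univ x)
    simpa using this
  have hL2 : MemLp f 2 stdGauss := memLp_of_linear_growth (C := C + |f 0|) hfc fun x => by
    have h1 := hlin x
    have h2 : |f x| ≤ |f x - f 0| + |f 0| := by
      have := abs_add_le (f x - f 0) (f 0); simpa using this
    nlinarith [abs_nonneg x, abs_nonneg (f 0)]
  refine (sq_integral_le hL2 (f 0)).trans ?_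
  rw [integral_stdGauss, integral_stdGauss]
  refine mul_le_mul_of_nonneg_left ?_ (by positivity)
  have i1 : Integrable (fun x => (f x - f 0) ^ 2 * Real.exp (-(1 / 2) * x ^ 2)) := by
    refine ((integrable_pow_mul_gaussian 2).const_mul (C ^ 2)).mono' (by fun_prop)
      (Eventually.of_forall fun x => ?_)
    rw [Real.norm_of_nonneg (by positivity), ← mul_assoc]
    refine mul_le_mul_of_nonneg_right ?_ (Real.exp_pos _).le
    rw [← mul_pow, ← sq_abs (f x - f 0), ← sq_abs (C * x), abs_mul, abs_of_nonneg hC0]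
    exact pow_le_pow_left₀ (abs_nonneg _) (hlin x) 2
  have i2 : Integrable (fun x => f' x ^ 2 * Real.exp (-(1 / 2) * x ^ 2)) := by
    refine ((integrable_pow_mul_gaussian 0).const_mul (C ^ 2)).mono' (by fun_prop)
      (Eventually.of_forall fun x => ?_)
    rw [Real.norm_of_nonneg (by positivity), pow_zero, one_mul]
    refine mul_le_mul_of_nonneg_right ?_ (Real.exp_pos _).le
    rw [← sq_abs]
    exact pow_le_pow_left₀ (abs_nonneg _) (hC x) 2
  -- both half lines contribute, the left one after a reflection
  have hR := half_line_poincare (g := fun x => f x - f 0) (g' := f') (C := C)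
    (fun x => (hf x).sub_const _) hf' hC (by simp)
  have hL := half_line_poincare (g := fun x => f (-x) - f 0) (g' := fun x => -f' (-x)) (C := C)
    (fun x => by
      have h1 := ((hf (-x)).comp x (hasDerivAt_neg x)).sub_const (f 0)
      simpa using h1)
    (by fun_prop) (fun x => by simpa using hC (-x)) (by simp)
  have e1 := integral_comp_neg_Ioi (0 : ℝ)
    (fun x => (f x - f 0) ^ 2 * Real.exp (-(1 / 2) * x ^ 2))
  have e2 := integral_comp_neg_Ioi (0 : ℝ) (fun x => f' x ^ 2 * Real.exp (-(1 / 2) * x ^ 2))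
  simp only [neg_sq, neg_zero] at e1 e2 hL
  rw [← intervalIntegral.integral_Iic_add_Ioi i1.integrableOn i1.integrableOn,
    ← intervalIntegral.integral_Iic_add_Ioi i2.integrableOn i2.integrableOn, ← e1, ← e2]
  exact add_le_add hL hR

/-- Tensorization of variance inequalities: `A` and `B` bound the variances of the slices. -/
lemma variance_prod_le {α β : Type*} [MeasurableSpace α] [MeasurableSpace β] {μ : Measure α}
    {ν : Measure β} [IsProbabilityMeasure μ] [IsProbabilityMeasure ν] {G : α × β → ℝ}
    (hG : MemLp G 2 (μ.prod ν)) {A : α → ℝ} {B : β → ℝ} (iA : Integrable A μ) (iB : Integrable B ν)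
    (hA : ∀ᵐ x ∂μ, ∫ y, G (x, y) ^ 2 ∂ν - (∫ y, G (x, y) ∂ν) ^ 2 ≤ A x)
    (hB : ∀ᵐ y ∂ν, ∫ x, G (x, y) ^ 2 ∂μ - (∫ x, G (x, y) ∂μ) ^ 2 ≤ B y) :
    ∫ p, G p ^ 2 ∂(μ.prod ν) - (∫ p, G p ∂(μ.prod ν)) ^ 2 ≤ ∫ x, A x ∂μ + ∫ y, B y ∂ν := by
  have iG : Integrable G (μ.prod ν) := hG.integrable (by norm_num)
  have iG2 : Integrable (fun p => G p ^ 2) (μ.prod ν) := hG.integrable_sq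
  set k : α → ℝ := fun x => ∫ y, G (x, y) ∂ν with hk
  set l : β → ℝ := fun y => ∫ x, G (x, y) ∂μ with hl
  set c : ℝ := ∫ p, G p ∂(μ.prod ν) with hc
  have ik : Integrable k μ := iG.integral_prod_left
  have il : Integrable l ν := iG.integral_prod_right
  have ik2' : Integrable (fun x => ∫ y, G (x, y) ^ 2 ∂ν) μ := iG2.integral_prod_left
  have il2' : Integrable (fun y => ∫ x, G (x, y) ^ 2 ∂μ) ν := iG2.integral_prod_right
  have hslice1 : ∀ᵐ x ∂μ, k x ^ 2 ≤ ∫ y, G (x, y) ^ 2 ∂ν := by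
    filter_upwards [iG2.prod_right_ae, hG.1.prodMk_left] with x hx hm
    have h1 : MemLp (fun y => G (x, y)) 2 ν := (memLp_two_iff_integrable_sq hm).2 hx
    exact sq_integral_le_integral_sq h1
  have hslice2 : ∀ᵐ y ∂ν, l y ^ 2 ≤ ∫ x, G (x, y) ^ 2 ∂μ := by
    have hsw : AEStronglyMeasurable (fun p : β × α => G (p.2, p.1)) (ν.prod μ) := hG.1.prod_swap
    filter_upwards [iG2.prod_left_ae, hsw.prodMk_left] with y hy hm
    have h1 : MemLp (fun x => G (x, y)) 2 μ := (memLp_two_iff_integrable_sq hm).2 hy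
    exact sq_integral_le_integral_sq h1
  have mk : MemLp k 2 μ := by
    refine (memLp_two_iff_integrable_sq ik.1).2 (ik2'.mono' (ik.1.pow 2) ?_)
    filter_upwards [hslice1] with x hx
    rwa [Real.norm_of_nonneg (sq_nonneg _)]
  have ml : MemLp l 2 ν := by
    refine (memLp_two_iff_integrable_sq il.1).2 (il2'.mono' (il.1.pow 2) ?_)
    filter_upwards [hslice2] with x hx
    rwa [Real.norm_of_nonneg (sq_nonneg _)]
  have mk' : MemLp (fun p : α × β => k p.1) 2 (μ.prod ν) := mk.comp_fst ν
  have ml' : MemLp (fun p : α × β => l p.2) 2 (μ.prod ν) := ml.comp_snd μ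
  have hck : ∫ x, k x ∂μ = c := by rw [hc, integral_prod _ iG]
  have hcl : ∫ y, l y ∂ν = c := by rw [hc, integral_prod_symm _ iG]
  have iGk : Integrable (fun p => G p * k p.1) (μ.prod ν) := hG.integrable_mul mk'
  have iGl : Integrable (fun p => G p * l p.2) (μ.prod ν) := hG.integrable_mul ml'
  have ikl : Integrable (fun p : α × β => k p.1 * l p.2) (μ.prod ν) := mk'.integrable_mul ml'
  have ikk : Integrable (fun p : α × β => k p.1 ^ 2) (μ.prod ν) := mk'.integrable_sq
  have ill : Integrable (fun p : α × β => l p.2 ^ 2) (μ.prod ν) := ml'.integrable_sq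
  have eGk : ∫ p, G p * k p.1 ∂(μ.prod ν) = ∫ x, k x ^ 2 ∂μ := by
    rw [integral_prod _ iGk]
    congr 1; ext x
    simp only []
    rw [integral_mul_const, sq]
  have eGl : ∫ p, G p * l p.2 ∂(μ.prod ν) = ∫ y, l y ^ 2 ∂ν := by
    rw [integral_prod_symm _ iGl]
    congr 1; ext y
    simp only []
    rw [integral_mul_const, sq]
  have ekl : ∫ p : α × β, k p.1 * l p.2 ∂(μ.prod ν) = c ^ 2 := by
    rw [integral_prod_mul, hck, hcl, sq]
  have ekk : ∫ p : α × β, k p.1 ^ 2 ∂(μ.prod ν) = ∫ x, k x ^ 2 ∂μ := by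
    rw [integral_prod _ ikk]; simp
  have ell : ∫ p : α × β, l p.2 ^ 2 ∂(μ.prod ν) = ∫ y, l y ^ 2 ∂ν := by
    rw [integral_prod _ ill]; simp
  have ek : ∫ p : α × β, k p.1 ∂(μ.prod ν) = c := by
    rw [integral_prod _ (mk'.integrable (by norm_num))]; simp [hck]
  have el : ∫ p : α × β, l p.2 ∂(μ.prod ν) = c := by
    rw [integral_prod _ (ml'.integrable (by norm_num))]; simp [hcl]
  -- the square of the part of `G` that is orthogonal to functions of one variable
  have hpos : 0 ≤ ∫ p : α × β, (G p - k p.1 - l p.2 + c) ^ 2 ∂(μ.prod ν) :=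
    integral_nonneg fun p => sq_nonneg _
  have hexp : ∫ p : α × β, (G p - k p.1 - l p.2 + c) ^ 2 ∂(μ.prod ν) =
      ∫ p, G p ^ 2 ∂(μ.prod ν) - ∫ x, k x ^ 2 ∂μ - ∫ y, l y ^ 2 ∂ν + c ^ 2 := by
    have h1 : ∀ p : α × β, (G p - k p.1 - l p.2 + c) ^ 2 = (((((((G p ^ 2 + k p.1 ^ 2) + l p.2 ^ 2)
        - 2 * (G p * k p.1)) - 2 * (G p * l p.2)) + 2 * (k p.1 * l p.2)) + 2 * c * G p
        - 2 * c * k p.1) - 2 * c * l p.2) + c ^ 2 := fun p => by ring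
    simp_rw [h1]
    have ik1 := mk'.integrable (q := 2) (by norm_num)
    have il1 := ml'.integrable (q := 2) (by norm_num)
    have j0 : Integrable (fun p : α × β => G p ^ 2 + k p.1 ^ 2) (μ.prod ν) := iG2.add ikk
    have j1 : Integrable (fun p : α × β => G p ^ 2 + k p.1 ^ 2 + l p.2 ^ 2) (μ.prod ν) :=
      j0.add ill
    have j2 : Integrable (fun p : α × β => G p ^ 2 + k p.1 ^ 2 + l p.2 ^ 2
        - 2 * (G p * k p.1)) (μ.prod ν) := j1.sub (iGk.const_mul 2)
    have j3 : Integrable (fun p : α × β => G p ^ 2 + k p.1 ^ 2 + l p.2 ^ 2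
        - 2 * (G p * k p.1) - 2 * (G p * l p.2)) (μ.prod ν) := j2.sub (iGl.const_mul 2)
    have j4 : Integrable (fun p : α × β => G p ^ 2 + k p.1 ^ 2 + l p.2 ^ 2
        - 2 * (G p * k p.1) - 2 * (G p * l p.2) + 2 * (k p.1 * l p.2)) (μ.prod ν) :=
      j3.add (ikl.const_mul 2)
    have j5 : Integrable (fun p : α × β => G p ^ 2 + k p.1 ^ 2 + l p.2 ^ 2
        - 2 * (G p * k p.1) - 2 * (G p * l p.2) + 2 * (k p.1 * l p.2) + 2 * c * G p)
        (μ.prod ν) := j4.add (iG.const_mul (2 * c))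
    have j6 : Integrable (fun p : α × β => G p ^ 2 + k p.1 ^ 2 + l p.2 ^ 2
        - 2 * (G p * k p.1) - 2 * (G p * l p.2) + 2 * (k p.1 * l p.2) + 2 * c * G p
        - 2 * c * k p.1) (μ.prod ν) := j5.sub (ik1.const_mul (2 * c))
    have j7 : Integrable (fun p : α × β => G p ^ 2 + k p.1 ^ 2 + l p.2 ^ 2
        - 2 * (G p * k p.1) - 2 * (G p * l p.2) + 2 * (k p.1 * l p.2) + 2 * c * G p
        - 2 * c * k p.1 - 2 * c * l p.2) (μ.prod ν) := j6.sub (il1.const_mul (2 * c))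
    rw [integral_add j7 (integrable_const _), integral_sub j6 (il1.const_mul _),
      integral_sub j5 (ik1.const_mul _), integral_add j4 (iG.const_mul _),
      integral_add j3 (ikl.const_mul _), integral_sub j2 (iGl.const_mul _),
      integral_sub j1 (iGk.const_mul _), integral_add j0 ill, integral_add iG2 ikk]
    simp only [integral_const_mul, eGk, eGl, ekl, ekk, ell, ek, el, ← hc, integral_const,
      probReal_univ, smul_eq_mul]
    ring
  have hA' : ∫ p, G p ^ 2 ∂(μ.prod ν) - ∫ x, k x ^ 2 ∂μ ≤ ∫ x, A x ∂μ := by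
    rw [integral_prod _ iG2, ← integral_sub ik2' mk.integrable_sq]
    exact integral_mono_ae (ik2'.sub mk.integrable_sq) iA hA
  have hB' : ∫ p, G p ^ 2 ∂(μ.prod ν) - ∫ y, l y ^ 2 ∂ν ≤ ∫ y, B y ∂ν := by
    rw [integral_prod_symm _ iG2, ← integral_sub il2' ml.integrable_sq]
    exact integral_mono_ae (il2'.sub ml.integrable_sq) iB hB
  rw [hexp] at hpos
  linarith

end Gaussian

section Gaussian

open ProbabilityTheory Filter Topology

/-- The standard Gaussian measure on `ℝ^d`. -/
abbrev piGauss (d : ℕ) : Measure (Fin d → ℝ) := Measure.pi fun _ => stdGauss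

/-- The inclusion of the last `d` coordinates. -/
def consL (d : ℕ) : (Fin d → ℝ) →L[ℝ] (Fin (d + 1) → ℝ) :=
  ContinuousLinearMap.pi (Fin.cons 0 fun i => ContinuousLinearMap.proj i)

lemma consL_zero {d : ℕ} (y : Fin d → ℝ) : consL d y 0 = 0 := by simp [consL]

lemma consL_succ {d : ℕ} (y : Fin d → ℝ) (i : Fin d) : consL d y i.succ = y i := by simp [consL]

lemma insertNth_zero_eq {d : ℕ} (x : ℝ) (y : Fin d → ℝ) :
    (MeasurableEquiv.piFinSuccAbove (fun _ : Fin (d + 1) => ℝ) 0).symm (x, y) =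
      x • Pi.single 0 1 + consL d y := by
  ext i
  refine Fin.cases ?_ (fun j => ?_) i
  · simp [MeasurableEquiv.piFinSuccAbove, consL_zero]
  · simp [MeasurableEquiv.piFinSuccAbove, consL_succ]

lemma consL_single {d : ℕ} (i : Fin d) : consL d (Pi.single i 1) = Pi.single i.succ 1 := by
  ext j
  refine Fin.cases ?_ (fun j => ?_) j
  · rw [consL_zero, Pi.single_eq_of_ne (Fin.succ_ne_zero i).symm]
  · rw [consL_succ]
    simp [Pi.single_apply]

lemma norm_consL_le {d : ℕ} (y : Fin d → ℝ) : ‖consL d y‖ ≤ ‖y‖ := by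
  refine (pi_norm_le_iff_of_nonneg (norm_nonneg _)).2 fun i => ?_
  refine Fin.cases ?_ (fun j => ?_) i
  · simp [consL_zero]
  · rw [consL_succ]; exact norm_le_pi_norm y j

lemma measurePreserving_cons (d : ℕ) :
    MeasurePreserving (fun p : ℝ × (Fin d → ℝ) => p.1 • (Pi.single 0 1 : Fin (d + 1) → ℝ)
      + consL d p.2) (stdGauss.prod (piGauss d)) (piGauss (d + 1)) := by
  have := (measurePreserving_piFinSuccAbove (fun _ : Fin (d + 1) => stdGauss) 0).symm
  have h2 : ⇑(MeasurableEquiv.piFinSuccAbove (fun _ : Fin (d + 1) => ℝ) 0).symm =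
      fun p : ℝ × (Fin d → ℝ) => p.1 • (Pi.single 0 1 : Fin (d + 1) → ℝ) + consL d p.2 := by
    funext p
    exact insertNth_zero_eq p.1 p.2
  rw [h2] at this
  exact this

lemma integral_piGauss_succ {d : ℕ} (F : (Fin (d + 1) → ℝ) → ℝ) :
    ∫ x, F x ∂piGauss (d + 1) =
      ∫ p : ℝ × (Fin d → ℝ), F (p.1 • Pi.single 0 1 + consL d p.2)
        ∂(stdGauss.prod (piGauss d)) := by
  have h := measurePreserving_piFinSuccAbove (fun _ : Fin (d + 1) => stdGauss) 0
  have := h.symm.integral_comp' F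
  rw [← this]
  congr 1; ext p
  rw [← insertNth_zero_eq]

/-- Functions of linear growth are square integrable for the Gaussian measure. -/
lemma memLp_piGauss_of_linear_growth {d : ℕ} {F : (Fin d → ℝ) → ℝ} (hF : Continuous F) {C : ℝ}
    (hC : ∀ x, |F x| ≤ C * (1 + ‖x‖)) : MemLp F 2 (piGauss d) := by
  have h1 : ∀ i, MemLp (fun x : Fin d → ℝ => |x i|) 2 (piGauss d) := by
    intro i
    have h2 : MemLp (fun x : ℝ => x) 2 stdGauss := memLp_id_gaussianReal' 2 (by norm_num)
    have h3 : MemLp (fun x : ℝ => |x|) 2 stdGauss := h2.norm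
    exact h3.comp_measurePreserving (measurePreserving_eval (fun _ : Fin d => stdGauss) i)
  have h2 : MemLp (fun x : Fin d → ℝ => ∑ i, |x i|) 2 (piGauss d) :=
    memLp_finsetSum _ fun i _ => h1 i
  have h0 : MemLp (fun _ : Fin d → ℝ => (1 : ℝ)) 2 (piGauss d) := memLp_const 1
  refine ((h0.add h2).const_mul |C|).mono' hF.aestronglyMeasurable
    (Eventually.of_forall fun x => ?_)
  have h3 : ‖x‖ ≤ ∑ i, |x i| := by
    refine (pi_norm_le_iff_of_nonneg (Finset.sum_nonneg fun i _ => abs_nonneg _)).2 fun i => ?_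
    exact Finset.single_le_sum (f := fun i => |x i|) (fun i _ => abs_nonneg _) (Finset.mem_univ i)
  refine (hC x).trans ?_
  have h4 : C ≤ |C| := le_abs_self C
  have := norm_nonneg x
  show C * (1 + ‖x‖) ≤ |C| * (1 + ∑ i, |x i|)
  have h5 : C * (1 + ‖x‖) ≤ |C| * (1 + ‖x‖) := mul_le_mul_of_nonneg_right h4 (by linarith)
  have h6 : |C| * (1 + ‖x‖) ≤ |C| * (1 + ∑ i, |x i|) :=
    mul_le_mul_of_nonneg_left (by linarith) (abs_nonneg _)
  linarith

lemma integrable_sq_partial {d : ℕ} {F : (Fin d → ℝ) → ℝ} {C : ℝ}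
    (hC : ∀ x, ‖fderiv ℝ F x‖ ≤ C) (v : Fin d → ℝ) {μ : Measure (Fin d → ℝ)} [IsFiniteMeasure μ] :
    Integrable (fun x => fderiv ℝ F x v ^ 2) μ := by
  refine (integrable_const ((C * ‖v‖) ^ 2)).mono'
    ((measurable_fderiv_apply_const ℝ F v).pow_const 2).aestronglyMeasurable
    (Eventually.of_forall fun x => ?_)
  rw [Real.norm_of_nonneg (sq_nonneg _), ← sq_abs]
  refine pow_le_pow_left₀ (abs_nonneg _) (((fderiv ℝ F x).le_opNorm v).trans ?_) 2
  exact mul_le_mul_of_nonneg_right (hC x) (norm_nonneg _)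

/-- The induction step of the Gaussian Poincaré inequality. The function need not be
differentiable everywhere: it suffices that almost all slices avoid the bad points. -/
lemma gaussian_poincare_succ {d : ℕ}
    (ih : ∀ (F : (Fin d → ℝ) → ℝ) (C : ℝ), ContDiff ℝ 1 F → (∀ x, |F x| ≤ C * (1 + ‖x‖)) →
      (∀ x, ‖fderiv ℝ F x‖ ≤ C) → ∫ x, F x ^ 2 ∂piGauss d - (∫ x, F x ∂piGauss d) ^ 2 ≤
        ∑ i, ∫ x, fderiv ℝ F x (Pi.single i 1) ^ 2 ∂piGauss d)
    {F : (Fin (d + 1) → ℝ) → ℝ} {C : ℝ} (hF : Continuous F) (hC : ∀ x, |F x| ≤ C * (1 + ‖x‖))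
    (hF' : ∀ x, ‖fderiv ℝ F x‖ ≤ C)
    (h1 : ∀ᵐ x ∂stdGauss, ∀ y : Fin d → ℝ, ContDiffAt ℝ 1 F (x • Pi.single 0 1 + consL d y))
    (h2 : ∀ᵐ y ∂piGauss d, ∀ x : ℝ, ContDiffAt ℝ 1 F (x • Pi.single 0 1 + consL d y)) :
    ∫ x, F x ^ 2 ∂piGauss (d + 1) - (∫ x, F x ∂piGauss (d + 1)) ^ 2 ≤
      ∑ i, ∫ x, fderiv ℝ F x (Pi.single i 1) ^ 2 ∂piGauss (d + 1) := by
  have hC0 : 0 ≤ C := (norm_nonneg _).trans (hF' 0)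
  set ι : ℝ × (Fin d → ℝ) → (Fin (d + 1) → ℝ) := fun p => p.1 • Pi.single 0 1 + consL d p.2 with hι
  have hmp := measurePreserving_cons d
  have hL2 : MemLp (fun p => F (ι p)) 2 (stdGauss.prod (piGauss d)) :=
    (memLp_piGauss_of_linear_growth hF hC).comp_measurePreserving hmp
  have hint : ∀ v, Integrable (fun p => fderiv ℝ F (ι p) v ^ 2) (stdGauss.prod (piGauss d)) :=
    fun v => hmp.integrable_comp_of_integrable (integrable_sq_partial hF' v)
  have hs1 : ∀ (x : ℝ) (y : Fin d → ℝ), HasFDerivAt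
      (fun y => x • (Pi.single 0 1 : Fin (d + 1) → ℝ) + consL d y) (consL d) y := fun x y =>
    ((consL d).hasFDerivAt (x := y)).const_add (x • (Pi.single 0 1 : Fin (d + 1) → ℝ))
  have hs2 : ∀ (x : ℝ) (y : Fin d → ℝ), HasDerivAt
      (fun x : ℝ => x • (Pi.single 0 1 : Fin (d + 1) → ℝ) + consL d y)
      (Pi.single 0 1) x := fun x y => by
    simpa using ((hasDerivAt_id x).smul_const (Pi.single 0 1 : Fin (d + 1) → ℝ)).add_const
      (consL d y)
  have key := variance_prod_le (μ := stdGauss) (ν := piGauss d) hL2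
    (A := fun x => ∑ i : Fin d, ∫ y, fderiv ℝ F (ι (x, y)) (Pi.single i.succ 1) ^ 2 ∂piGauss d)
    (B := fun y => ∫ x, fderiv ℝ F (ι (x, y)) (Pi.single 0 1) ^ 2 ∂stdGauss)
    (integrable_finsetSum _ fun i _ => (hint _).integral_prod_left)
    (hint _).integral_prod_right ?_ ?_
  · rw [integral_piGauss_succ (fun x => F x ^ 2), integral_piGauss_succ F, Fin.sum_univ_succ]
    refine key.trans (le_of_eq ?_)
    rw [integral_finsetSum _ fun i _ => (hint _).integral_prod_left, add_comm]
    congr 1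
    · rw [integral_piGauss_succ (fun x => fderiv ℝ F x (Pi.single 0 1) ^ 2),
        ← integral_prod_symm _ (hint _)]
    · refine Finset.sum_congr rfl fun i _ => ?_
      rw [integral_piGauss_succ (fun x => fderiv ℝ F x (Pi.single i.succ 1) ^ 2),
        ← integral_prod _ (hint _)]
  · filter_upwards [h1] with x hx
    have hd : ∀ y, HasFDerivAt (fun y => F (ι (x, y))) ((fderiv ℝ F (ι (x, y))).comp (consL d)) y :=
      fun y => ((hx y).differentiableAt (by norm_num)).hasFDerivAt.comp y (hs1 x y)
    have := ih (fun y => F (ι (x, y))) (C * (1 + |x|)) ?_ ?_ ?_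
    · refine this.trans (le_of_eq (Finset.sum_congr rfl fun i _ => ?_))
      congr 1; ext y
      rw [(hd y).fderiv, ContinuousLinearMap.comp_apply, consL_single]
    · refine contDiff_iff_contDiffAt.2 fun y => ?_
      have h3 : ContDiff ℝ 1 fun y : Fin d → ℝ => ι (x, y) :=
        (contDiff_const (c := x • (Pi.single 0 1 : Fin (d + 1) → ℝ))).add (consL d).contDiff
      exact (hx y).comp y h3.contDiffAt
    · intro y
      refine (hC _).trans ?_
      rw [mul_assoc]
      refine mul_le_mul_of_nonneg_left ?_ hC0
      have e1 : ‖ι (x, y)‖ ≤ |x| + ‖y‖ := by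
        refine (norm_add_le _ _).trans (add_le_add ?_ (norm_consL_le y))
        rw [norm_smul, Real.norm_eq_abs]
        refine mul_le_of_le_one_right (abs_nonneg _) ?_
        refine (pi_norm_le_iff_of_nonneg zero_le_one).2 fun i => ?_
        rcases eq_or_ne i 0 with rfl | hi
        · simp
        · simp [Pi.single_eq_of_ne hi]
      nlinarith [abs_nonneg x, norm_nonneg y]
    · intro y
      rw [(hd y).fderiv]
      refine (ContinuousLinearMap.opNorm_comp_le _ _).trans ?_
      have e2 : ‖consL d‖ ≤ 1 := ContinuousLinearMap.opNorm_le_bound _ zero_le_one fun y => by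
        simpa using norm_consL_le y
      have e3 := hF' (ι (x, y))
      nlinarith [abs_nonneg x, norm_nonneg (fderiv ℝ F (ι (x, y))), norm_nonneg (consL d)]
  · filter_upwards [h2] with y hy
    have hd : ∀ x, HasDerivAt (fun x => F (ι (x, y))) (fderiv ℝ F (ι (x, y)) (Pi.single 0 1)) x :=
      fun x => ((hy x).differentiableAt (by norm_num)).hasFDerivAt.comp_hasDerivAt x (hs2 x y)
    refine gaussian_poincare_one (C := C * ‖(Pi.single 0 1 : Fin (d + 1) → ℝ)‖) hd ?_ fun x => ?_
    · refine continuous_iff_continuousAt.2 fun x => ?_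
      have e1 : ContinuousAt (fderiv ℝ F) (ι (x, y)) :=
        ((hy x).fderiv_right (m := 0) (by norm_num)).continuousAt
      have e2 : ContinuousAt (fun x : ℝ => ι (x, y)) x := (hs2 x y).continuousAt
      exact (ContinuousAt.comp (f := fun x : ℝ => ι (x, y)) e1 e2).clm_apply continuousAt_const
    · exact ((fderiv ℝ F _).le_opNorm _).trans
        (mul_le_mul_of_nonneg_right (hF' _) (norm_nonneg _))

/-- The Gaussian Poincaré inequality in `ℝ^d`. -/
theorem gaussian_poincare (d : ℕ) : ∀ (F : (Fin d → ℝ) → ℝ) (C : ℝ), ContDiff ℝ 1 F →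
    (∀ x, |F x| ≤ C * (1 + ‖x‖)) → (∀ x, ‖fderiv ℝ F x‖ ≤ C) →
    ∫ x, F x ^ 2 ∂piGauss d - (∫ x, F x ∂piGauss d) ^ 2 ≤
      ∑ i, ∫ x, fderiv ℝ F x (Pi.single i 1) ^ 2 ∂piGauss d := by
  induction d with
  | zero =>
    intro F C _ _ _
    have : ∀ x, F x = F default := fun x => by rw [Subsingleton.elim x default]
    simp_rw [this]
    simp
  | succ d ih =>
    intro F C hF hC hF'
    exact gaussian_poincare_succ ih hF.continuous hC hF'
      (Eventually.of_forall fun x y => hF.contDiffAt)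
      (Eventually.of_forall fun y x => hF.contDiffAt)

/-- The Gaussian Poincaré inequality for functions that are differentiable away from the
origin, in dimension at least two. -/
theorem gaussian_poincare_punctured {n : ℕ} (hn : 1 ≤ n) {F : (Fin (n + 1) → ℝ) → ℝ} {C : ℝ}
    (hF : Continuous F) (hC : ∀ x, |F x| ≤ C * (1 + ‖x‖)) (hF' : ∀ x, ‖fderiv ℝ F x‖ ≤ C)
    (hd : ∀ x ≠ 0, ContDiffAt ℝ 1 F x) :
    ∫ x, F x ^ 2 ∂piGauss (n + 1) - (∫ x, F x ∂piGauss (n + 1)) ^ 2 ≤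
      ∑ i, ∫ x, fderiv ℝ F x (Pi.single i 1) ^ 2 ∂piGauss (n + 1) := by
  have : NullSingletonClass stdGauss := nullSingletonClass_gaussianReal one_ne_zero
  refine gaussian_poincare_succ (gaussian_poincare n) hF hC hF' ?_ ?_
  · filter_upwards [compl_mem_ae_iff.2 (measure_singleton (μ := stdGauss) 0)] with x hx y
    refine hd _ fun h => hx ?_
    have := congrFun h 0
    simpa [consL_zero] using this
  · have i0 : Fin n := ⟨0, hn⟩
    have hae : ∀ᵐ y : Fin n → ℝ ∂piGauss n, y i0 ≠ 0 := by
      have := (measurePreserving_eval (fun _ : Fin n => stdGauss) i0).quasiMeasurePreserving.ae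
        (compl_mem_ae_iff.2 (measure_singleton (μ := stdGauss) 0))
      exact this
    filter_upwards [hae] with y hy x
    refine hd _ fun h => hy ?_
    have := congrFun h i0.succ
    simpa [consL_succ, Pi.single_eq_of_ne (Fin.succ_ne_zero i0)] using this

/-- The density of the Gaussian measure. -/
lemma integral_piGauss (d : ℕ) : ∃ c > 0, ∀ f : (Fin d → ℝ) → ℝ,
    ∫ x, f x ∂piGauss d = c * ∫ x, f x * Real.exp (-(1 / 2) * ∑ i, x i ^ 2) := by
  set p : ℝ → ℝ := gaussianPDFReal 0 1 with hp
  have hpm : Measurable p := measurable_gaussianPDFReal 0 1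
  have hp0 : ∀ x, 0 ≤ p x := gaussianPDFReal_nonneg 0 1
  have hpi : Integrable p := integrable_gaussianPDFReal 0 1
  have hmeas : Measurable fun x : Fin d → ℝ => ∏ i, p (x i) :=
    Finset.measurable_prod _ fun i _ => hpm.comp (measurable_pi_apply i)
  have hdens : piGauss d =
      (volume : Measure (Fin d → ℝ)).withDensity fun x => ENNReal.ofReal (∏ i, p (x i)) := by
    refine Measure.pi_eq fun t ht => ?_
    rw [withDensity_apply _ (MeasurableSet.univ_pi ht), volume_pi, Measure.restrict_pi_pi,
      ← ofReal_integral_eq_lintegral_ofReal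
        (Integrable.fintype_prod (f := fun _ => p) fun i => hpi.integrableOn)
        (Eventually.of_forall fun x => Finset.prod_nonneg fun i _ => hp0 _),
      integral_fintype_prod_eq_prod (fun _ => p),
      ENNReal.ofReal_prod_of_nonneg fun i _ => integral_nonneg fun x => hp0 x]
    refine Finset.prod_congr rfl fun i _ => ?_
    rw [stdGauss, gaussianReal_apply_eq_integral _ one_ne_zero]
  refine ⟨(√(2 * Real.pi))⁻¹ ^ d, by positivity, fun f => ?_⟩
  have hm2 : Measurable fun x : Fin d → ℝ => (∏ i, p (x i)).toNNReal := hmeas.real_toNNReal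
  rw [hdens]
  simp only [ENNReal.ofReal]
  rw [integral_withDensity_eq_integral_smul hm2, ← integral_const_mul]
  congr 1; ext x
  rw [NNReal.smul_def, Real.coe_toNNReal _ (Finset.prod_nonneg fun i _ => hp0 _), smul_eq_mul]
  simp only [hp, gaussianPDFReal, NNReal.coe_one, mul_one, sub_zero]
  rw [Finset.prod_mul_distrib, ← Real.exp_sum, Finset.prod_const, Finset.card_univ,
    Fintype.card_fin, Finset.mul_sum, Finset.sum_congr rfl fun i _ =>
      show -x i ^ 2 / 2 = -(1 / 2) * x i ^ 2 by ring]
  ring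

end Gaussian

/-! ### The Poincaré inequality on the sphere -/

section Sphere

open Filter Topology

variable {n : ℕ}

lemma continuous_sphere_of_contDiffOn {g : Cross n → ℝ} (hg : ContinuousOn g {0}ᶜ) :
    Continuous fun θ : Metric.sphere (0 : Cross n) 1 => g θ :=
  continuousOn_iff_continuous_domRestrict.1 (hg.mono fun θ hθ h => by
    rw [mem_singleton_iff.1 h] at hθ; simp at hθ)

lemma sphere_ne_zero (θ : Metric.sphere (0 : Cross n) 1) : (θ : Cross n) ≠ 0 := fun h => by
  have := θ.2
  rw [h] at this
  simp at this

lemma integrable_sphere {φ : Metric.sphere (0 : Cross n) 1 → ℝ} (hφ : Continuous φ) :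
    Integrable φ (volume : Measure (Cross n)).toSphere :=
  hφ.integrable_of_hasCompactSupport (HasCompactSupport.of_compactSpace φ)

/-- Integration in polar coordinates of a product of functions of angle and radius. -/
lemma integral_polar (φ : Metric.sphere (0 : Cross n) 1 → ℝ) (ρ : ℝ → ℝ) (ψ : Cross n → ℝ)
    (h : ∀ (θ : Metric.sphere (0 : Cross n) 1) (r : ℝ), 0 < r → ψ (r • (θ : Cross n)) = φ θ * ρ r) :
    ∫ x, ψ x = (∫ θ, φ θ ∂(volume : Measure (Cross n)).toSphere) *
      ∫ r : Ioi (0 : ℝ), ρ r ∂Measure.volumeIoiPow n := by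
  have hd : Module.finrank ℝ (Cross n) - 1 = n := by simp
  calc ∫ x, ψ x = ∫ x : ({0}ᶜ : Set (Cross n)), ψ x.1 ∂(volume.comap Subtype.val) := by
        rw [integral_subtype_comap (measurableSet_singleton _).compl fun x => ψ x,
          restrict_compl_singleton]
    _ = ∫ p, φ p.1 * ρ p.2 ∂((volume : Measure (Cross n)).toSphere.prod
          (Measure.volumeIoiPow (Module.finrank ℝ (Cross n) - 1))) := by
        rw [← (volume : Measure (Cross n)).measurePreserving_homeomorphUnitSphereProd.integral_comp
          (Homeomorph.measurableEmbedding _) fun p => φ p.1 * ρ p.2]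
        refine integral_congr_ae (Eventually.of_forall fun x => ?_)
        have hx : (x : Cross n) ≠ 0 := x.2
        have hx' : 0 < ‖(x : Cross n)‖ := norm_pos_iff.2 hx
        have := h (homeomorphUnitSphereProd (Cross n) x).1 ‖(x : Cross n)‖ hx'
        simp only [homeomorphUnitSphereProd_apply_fst_coe, smul_smul,
          mul_inv_cancel₀ hx'.ne', one_smul] at this
        simp only
        rw [this]
        simp
    _ = _ := by rw [hd, integral_prod_mul φ fun r : Ioi (0 : ℝ) => ρ r]

lemma integral_volumeIoiPow (ρ : ℝ → ℝ) :
    ∫ r : Ioi (0 : ℝ), ρ r ∂Measure.volumeIoiPow n = ∫ r in Ioi (0 : ℝ), r ^ n * ρ r := by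
  simp only [Measure.volumeIoiPow, ENNReal.ofReal]
  rw [integral_withDensity_eq_integral_smul,
    integral_subtype_comap measurableSet_Ioi fun a => Real.toNNReal (a ^ n) • ρ a,
    setIntegral_congr_fun measurableSet_Ioi fun x hx => ?_]
  · rw [NNReal.smul_def, Real.coe_toNNReal _ (pow_nonneg (le_of_lt hx) _), smul_eq_mul]
  · exact (measurable_subtype_coe.pow_const _).real_toNNReal

lemma integral_pow_mul_gaussian_pos (n : ℕ) :
    0 < ∫ r in Ioi (0 : ℝ), r ^ n * Real.exp (-(1 / 2) * r ^ 2) := by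
  have := integral_rpow_mul_exp_neg_mul_rpow (p := 2) (q := n) (b := 1 / 2) (by norm_num)
    (by have : (0 : ℝ) ≤ n := n.cast_nonneg; linarith) (by norm_num)
  simp only [Real.rpow_natCast, Real.rpow_two] at this
  rw [this]
  have : 0 < Real.Gamma (((n : ℝ) + 1) / 2) := Real.Gamma_pos_of_pos (by positivity)
  positivity

/-- The second radial moment of the Gaussian measure is `n + 1`. -/
lemma integral_pow_add_two_mul_gaussian (n : ℕ) :
    ∫ r in Ioi (0 : ℝ), r ^ n * (r ^ 2 * Real.exp (-(1 / 2) * r ^ 2)) =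
      (n + 1) * ∫ r in Ioi (0 : ℝ), r ^ n * Real.exp (-(1 / 2) * r ^ 2) := by
  have hn : (0 : ℝ) ≤ n := n.cast_nonneg
  have h1 := integral_rpow_mul_exp_neg_mul_rpow (p := 2) (q := n) (b := 1 / 2) (by norm_num)
    (by linarith) (by norm_num)
  have h2 := integral_rpow_mul_exp_neg_mul_rpow (p := 2) (q := ((n + 2 : ℕ) : ℝ)) (b := 1 / 2)
    (by norm_num) (by have : (0 : ℝ) ≤ (n + 2 : ℕ) := Nat.cast_nonneg _; linarith) (by norm_num)
  simp only [Real.rpow_natCast, Real.rpow_two] at h1 h2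
  simp_rw [← mul_assoc, ← pow_add]
  rw [h1, h2]
  push_cast
  rw [show ((n : ℝ) + 2 + 1) / 2 = (n + 1) / 2 + 1 by ring, Real.Gamma_add_one (by positivity),
    show -((n : ℝ) + 2 + 1) / 2 = -(n + 1) / 2 - 1 by ring, Real.rpow_sub_one (by norm_num)]
  ring

/-- The norm of a linear form on Euclidean space in terms of its coefficients. -/
lemma norm_sq_linearForm (L : Cross n →L[ℝ] ℝ) :
    ‖L‖ ^ 2 = ∑ i, L (EuclideanSpace.single i 1) ^ 2 := by
  set v := (InnerProductSpace.toDual ℝ (Cross n)).symm L with hv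
  have h1 : ∀ x, L x = inner ℝ v x := fun x => by
    rw [hv, InnerProductSpace.toDual_symm_apply]
  have h2 : ‖L‖ = ‖v‖ := by rw [hv, LinearIsometryEquiv.norm_map]
  rw [h2, EuclideanSpace.real_norm_sq_eq]
  refine Finset.sum_congr rfl fun i _ => ?_
  rw [h1]
  simp [EuclideanSpace.inner_single_right]

/-- The positively homogeneous extension of degree one of a function on the sphere. -/
def coneExt (g : Cross n → ℝ) (x : Cross n) : ℝ := ‖x‖ * g (‖x‖⁻¹ • x)

lemma coneExt_smul (g : Cross n → ℝ) {r : ℝ} (hr : 0 < r) (x : Cross n) :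
    coneExt g (r • x) = r * coneExt g x := by
  simp only [coneExt, norm_smul, Real.norm_of_nonneg hr.le, smul_smul]
  rw [mul_inv, mul_comm r⁻¹, mul_assoc ‖x‖⁻¹, inv_mul_cancel₀ hr.ne', mul_one, mul_assoc]

lemma contDiffAt_coneExt {g : Cross n → ℝ} (hg : ContDiffOn ℝ 1 g {0}ᶜ) {x : Cross n}
    (hx : x ≠ 0) : ContDiffAt ℝ 1 (coneExt g) x := by
  have h1 : ContDiffAt ℝ 1 (fun x : Cross n => ‖x‖) x := contDiffAt_norm ℝ hx
  have h2 : ContDiffAt ℝ 1 (fun x : Cross n => ‖x‖⁻¹ • x) x :=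
    (h1.inv (norm_ne_zero_iff.2 hx)).smul contDiffAt_id
  have h3 : ‖x‖⁻¹ • x ∈ ({0}ᶜ : Set (Cross n)) := by
    simp [hx]
  exact h1.mul (ContDiffAt.comp (f := fun x : Cross n => ‖x‖⁻¹ • x) x
    (hg.contDiffAt (isOpen_compl_singleton.mem_nhds h3)) h2)

lemma fderiv_coneExt_smul {g : Cross n → ℝ} (hg : ContDiffOn ℝ 1 g {0}ᶜ) {x : Cross n}
    (hx : x ≠ 0) {r : ℝ} (hr : 0 < r) :
    fderiv ℝ (coneExt g) (r • x) = fderiv ℝ (coneExt g) x := by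
  have h0 : r • (r⁻¹ • (r • x)) = r • x := by rw [smul_smul, mul_inv_cancel₀ hr.ne', one_smul]
  have h1 : coneExt g = fun y => r * coneExt g (r⁻¹ • y) := by
    funext y
    rw [← coneExt_smul g hr, smul_smul, mul_inv_cancel₀ hr.ne', one_smul]
  have h2 : HasFDerivAt (fun y : Cross n => r⁻¹ • y) (r⁻¹ • ContinuousLinearMap.id ℝ (Cross n))
      (r • x) := (hasFDerivAt_id (r • x)).const_smul r⁻¹
  have h3 : HasFDerivAt (coneExt g) (fderiv ℝ (coneExt g) x) (r⁻¹ • (r • x)) := by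
    rw [smul_smul, inv_mul_cancel₀ hr.ne', one_smul]
    exact ((contDiffAt_coneExt hg hx).differentiableAt (by norm_num)).hasFDerivAt
  have h4 := (h3.comp (r • x) h2).const_mul r
  have h5 : HasFDerivAt (coneExt g) (fderiv ℝ (coneExt g) x) (r • x) := by
    rw [h1]
    refine h4.congr_fderiv ?_
    ext v
    simp [hr.ne', h1.symm]
  exact h5.fderiv

/-- The derivatives of the norm and of the radial projection at a point of the sphere. -/
lemma hasFDerivAt_normalize (θ : Metric.sphere (0 : Cross n) 1) :
    HasFDerivAt (fun x : Cross n => ‖x‖) (innerSL ℝ (θ : Cross n)) θ ∧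
    HasFDerivAt (fun x : Cross n => ‖x‖⁻¹ • x) (ContinuousLinearMap.id ℝ (Cross n) -
      (innerSL ℝ (θ : Cross n)).smulRight (θ : Cross n)) θ := by
  have hθ : ‖(θ : Cross n)‖ = 1 := by simp
  have hnorm : HasFDerivAt (fun x : Cross n => ‖x‖) (innerSL ℝ (θ : Cross n)) θ := by
    have h1 := (hasStrictFDerivAt_norm_sq (θ : Cross n)).hasFDerivAt.sqrt (by simp [hθ])
    simp only [Real.sqrt_sq (norm_nonneg _)] at h1
    refine h1.congr_fderiv ?_
    ext v
    simp [hθ]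
  have hinv : HasFDerivAt (fun x : Cross n => ‖x‖⁻¹) (-innerSL ℝ (θ : Cross n)) θ := by
    have h2 : HasDerivAt (fun t : ℝ => t⁻¹) (-1) ‖(θ : Cross n)‖ := by
      rw [hθ]; simpa using hasDerivAt_inv (one_ne_zero (α := ℝ))
    refine (h2.comp_hasFDerivAt (θ : Cross n) hnorm).congr_fderiv ?_
    ext v; simp
  refine ⟨hnorm, (hinv.smul (hasFDerivAt_id (θ : Cross n))).congr_fderiv ?_⟩
  ext v
  simp [hθ, sub_eq_add_neg]

/-- The squared length of the gradient of the cone extension. -/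
lemma norm_fderiv_coneExt_sq {g : Cross n → ℝ} (hg : ContDiffOn ℝ 1 g {0}ᶜ)
    (θ : Metric.sphere (0 : Cross n) 1) :
    ‖fderiv ℝ (coneExt g) θ‖ ^ 2 = g θ ^ 2 + sphGradSq g θ := by
  have hθ0 := sphere_ne_zero θ
  have hθ : ‖(θ : Cross n)‖ = 1 := by simp
  obtain ⟨hnorm, hproj⟩ := hasFDerivAt_normalize θ
  have hgd : HasFDerivAt g (fderiv ℝ g θ) (‖(θ : Cross n)‖⁻¹ • (θ : Cross n)) := by
    rw [hθ, inv_one, one_smul]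
    exact ((hg.contDiffAt (isOpen_compl_singleton.mem_nhds hθ0)).differentiableAt
      (by norm_num)).hasFDerivAt
  have hF := hnorm.mul
    (HasFDerivAt.comp (f := fun x : Cross n => ‖x‖⁻¹ • x) (θ : Cross n) hgd hproj)
  set a := (InnerProductSpace.toDual ℝ (Cross n)).symm (fderiv ℝ g θ) with ha
  have ha1 : ∀ x, fderiv ℝ g θ x = inner ℝ a x := fun x => by
    rw [ha, InnerProductSpace.toDual_symm_apply]
  have ha2 : ‖fderiv ℝ g θ‖ = ‖a‖ := by rw [ha, LinearIsometryEquiv.norm_map]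
  have hFd : fderiv ℝ (coneExt g) θ = innerSL ℝ
      (g θ • (θ : Cross n) + a - inner ℝ a (θ : Cross n) • (θ : Cross n)) := by
    refine HasFDerivAt.fderiv (HasFDerivAt.congr_fderiv (f := coneExt g) hF ?_)
    ext v
    simp [hθ, ha1, inner_smul_right]
    ring
  rw [hFd, innerSL_apply_norm, sphGradSq, ha2, ha1, ← real_inner_self_eq_norm_sq,
    ← real_inner_self_eq_norm_sq a]
  have hθθ : inner ℝ (θ : Cross n) (θ : Cross n) = 1 := by rw [real_inner_self_eq_norm_sq, hθ]; simp
  simp only [inner_add_left, inner_sub_left, inner_smul_left, inner_add_right, inner_sub_right,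
    inner_smul_right, hθθ, real_inner_comm, conj_trivial]
  rw [real_inner_comm a (θ : Cross n)]
  ring

lemma continuous_coneExt {g : Cross n → ℝ} (hg : ContDiffOn ℝ 1 g {0}ᶜ) {M : ℝ}
    (hM : ∀ x, |coneExt g x| ≤ M * ‖x‖) : Continuous (coneExt g) := by
  refine continuous_iff_continuousAt.2 fun x => ?_
  rcases eq_or_ne x 0 with rfl | hx
  · have h0 : coneExt g 0 = 0 := by simp [coneExt]
    rw [ContinuousAt, h0]
    refine squeeze_zero_norm hM ?_
    have : Continuous fun x : Cross n => M * ‖x‖ := by fun_prop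
    simpa using this.tendsto 0
  · exact (contDiffAt_coneExt hg hx).continuousAt

lemma exists_bound_coneExt {g : Cross n → ℝ} (hg : ContDiffOn ℝ 1 g {0}ᶜ) :
    ∃ M, 0 ≤ M ∧ (∀ x, |coneExt g x| ≤ M * ‖x‖) ∧ ∀ x, ‖fderiv ℝ (coneExt g) x‖ ≤ M := by
  have hne : ∀ x ∈ Metric.sphere (0 : Cross n) 1, x ≠ 0 := fun x hx h => by
    rw [h] at hx; simp at hx
  obtain ⟨M₁, h1⟩ := (isCompact_sphere (0 : Cross n) 1).exists_bound_of_continuousOn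
    (hg.continuousOn.mono hne)
  have hc : ContinuousOn (fderiv ℝ (coneExt g)) (Metric.sphere (0 : Cross n) 1) := fun x hx =>
    ((contDiffAt_coneExt hg (hne x hx)).fderiv_right (m := 0)
      (by norm_num)).continuousAt.continuousWithinAt
  obtain ⟨M₂, h2⟩ := (isCompact_sphere (0 : Cross n) 1).exists_bound_of_continuousOn hc
  have hunit : ∀ x : Cross n, x ≠ 0 → ‖x‖⁻¹ • x ∈ Metric.sphere (0 : Cross n) 1 := fun x hx => by
    simp [norm_smul, hx]
  set M := max 0 (max M₁ M₂) with hM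
  have h3 : ∀ x, |coneExt g x| ≤ M * ‖x‖ := by
    intro x
    rcases eq_or_ne x 0 with rfl | hx
    · simp [coneExt]
    · rw [coneExt, abs_mul, abs_norm, mul_comm]
      refine mul_le_mul_of_nonneg_right ((h1 _ (hunit x hx)).trans ?_) (norm_nonneg _)
      exact (le_max_left _ _).trans (le_max_right _ _)
  refine ⟨M, le_max_left _ _, h3, fun x => ?_⟩
  rcases eq_or_ne x 0 with rfl | hx
  · refine norm_fderiv_le_of_lip' ℝ (le_max_left _ _) (Eventually.of_forall fun x => ?_)
    have h0 : coneExt g 0 = 0 := by simp [coneExt]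
    rw [h0, sub_zero, sub_zero]
    exact h3 x
  · have hx' : 0 < ‖x‖ := norm_pos_iff.2 hx
    have : x = ‖x‖ • (‖x‖⁻¹ • x) := by rw [smul_smul, mul_inv_cancel₀ hx'.ne', one_smul]
    rw [this, fderiv_coneExt_smul hg (hne _ (hunit x hx)) hx']
    exact (h2 _ (hunit x hx)).trans ((le_max_right _ _).trans (le_max_right _ _))

lemma integral_piGauss_euclidean (n : ℕ) : ∃ c > 0, ∀ f : Cross n → ℝ,
    ∫ x, f (WithLp.toLp 2 x) ∂piGauss (n + 1) =
      c * ∫ x : Cross n, f x * Real.exp (-(1 / 2) * ‖x‖ ^ 2) := by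
  obtain ⟨c, hc, h⟩ := integral_piGauss (n + 1)
  refine ⟨c, hc, fun f => ?_⟩
  rw [h,
    ← (EuclideanSpace.volume_preserving_symm_measurableEquiv_toLp (Fin (n + 1))).symm.integral_comp'
    fun x : Cross n => f x * Real.exp (-(1 / 2) * ‖x‖ ^ 2)]
  congr 2; ext x
  simp [EuclideanSpace.real_norm_sq_eq]

/-- The Poincaré inequality on the sphere for functions of mean zero: the Gaussian Poincaré
inequality for the homogeneous extension of degree one, in polar coordinates. -/
lemma sphere_poincare_of_integral_eq_zero (hn : 1 ≤ n) {g : Cross n → ℝ}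
    (hg : ContDiffOn ℝ 1 g {0}ᶜ)
    (h0 : ∫ θ : Metric.sphere (0 : Cross n) 1, g θ ∂(volume : Measure (Cross n)).toSphere = 0) :
    n * ∫ θ : Metric.sphere (0 : Cross n) 1, g θ ^ 2 ∂(volume : Measure (Cross n)).toSphere ≤
      ∫ θ : Metric.sphere (0 : Cross n) 1, ‖fderiv ℝ (coneExt g) θ‖ ^ 2
        ∂(volume : Measure (Cross n)).toSphere -
      ∫ θ : Metric.sphere (0 : Cross n) 1, g θ ^ 2 ∂(volume : Measure (Cross n)).toSphere := by
  obtain ⟨M, hM0, hM, hM'⟩ := exists_bound_coneExt hg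
  obtain ⟨c, hc, hcf⟩ := integral_piGauss_euclidean n
  set e := (PiLp.continuousLinearEquiv 2 ℝ fun _ : Fin (n + 1) => ℝ).symm with he
  have hee : ∀ x, e x = WithLp.toLp 2 x := fun x => rfl
  set K : ℝ := ‖(e : (Fin (n + 1) → ℝ) →L[ℝ] Cross n)‖ with hK
  have hnorm : ∀ x, ‖e x‖ ≤ K * ‖x‖ := fun x =>
    (e : (Fin (n + 1) → ℝ) →L[ℝ] Cross n).le_opNorm x
  have hK0 : 0 ≤ K := norm_nonneg _
  have hfd : ∀ x, fderiv ℝ (fun x => coneExt g (e x)) x = (fderiv ℝ (coneExt g) (e x)).comp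
      (e : (Fin (n + 1) → ℝ) →L[ℝ] Cross n) := fun x =>
    e.comp_right_fderiv (f := coneExt g) (x := x)
  have hfd' : ∀ x, ‖fderiv ℝ (fun x => coneExt g (e x)) x‖ ≤ M * K := fun x => by
    rw [hfd]
    exact (ContinuousLinearMap.opNorm_comp_le _ _).trans (mul_le_mul_of_nonneg_right (hM' _) hK0)
  have key := gaussian_poincare_punctured hn (F := fun x => coneExt g (e x)) (C := M * K)
    ((continuous_coneExt hg hM).comp e.continuous) (fun x => by
      refine (hM _).trans ?_
      rw [mul_assoc]
      refine mul_le_mul_of_nonneg_left ((hnorm x).trans ?_) hM0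
      nlinarith [norm_nonneg x]) hfd' (fun x hx => by
      refine ContDiffAt.comp x (contDiffAt_coneExt hg ?_) e.contDiff.contDiffAt
      simpa using hx)
  rw [← integral_finsetSum _ fun i _ => integrable_sq_partial hfd' _] at key
  have hsum : ∀ x, ∑ i, fderiv ℝ (fun x => coneExt g (e x)) x (Pi.single i 1) ^ 2 =
      ‖fderiv ℝ (coneExt g) (e x)‖ ^ 2 := fun x => by
    rw [norm_sq_linearForm]
    refine Finset.sum_congr rfl fun i _ => ?_
    rw [hfd]
    rfl
  simp_rw [hsum, hee] at key
  rw [hcf (fun x => coneExt g x ^ 2), hcf (coneExt g),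
    hcf (fun x => ‖fderiv ℝ (coneExt g) x‖ ^ 2)] at key
  have hnr : ∀ (θ : Metric.sphere (0 : Cross n) 1) (r : ℝ), 0 < r → ‖r • (θ : Cross n)‖ = r :=
    fun θ r hr => by rw [norm_smul, Real.norm_of_nonneg hr.le]; simp
  have hθ1 : ∀ θ : Metric.sphere (0 : Cross n) 1, coneExt g θ = g θ := fun θ => by simp [coneExt]
  rw [integral_polar (fun θ => g θ ^ 2) (fun r => r ^ 2 * Real.exp (-(1 / 2) * r ^ 2)) _
      (fun θ r hr => by rw [hnr θ r hr, coneExt_smul g hr, hθ1]; ring),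
    integral_polar (fun θ => g θ) (fun r => r * Real.exp (-(1 / 2) * r ^ 2)) _
      (fun θ r hr => by rw [hnr θ r hr, coneExt_smul g hr, hθ1]; ring),
    integral_polar (fun θ => ‖fderiv ℝ (coneExt g) θ‖ ^ 2) (fun r => Real.exp (-(1 / 2) * r ^ 2)) _
      (fun θ r hr => by rw [hnr θ r hr, fderiv_coneExt_smul hg (sphere_ne_zero θ) hr]),
    integral_volumeIoiPow (fun r => r ^ 2 * Real.exp (-(1 / 2) * r ^ 2)),
    integral_volumeIoiPow (fun r => Real.exp (-(1 / 2) * r ^ 2)),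
    integral_pow_add_two_mul_gaussian, h0] at key
  have hI := integral_pow_mul_gaussian_pos n
  set I := ∫ r in Ioi (0 : ℝ), r ^ n * Real.exp (-(1 / 2) * r ^ 2)
  set A := ∫ θ : Metric.sphere (0 : Cross n) 1, g θ ^ 2 ∂(volume : Measure (Cross n)).toSphere
  set G := ∫ θ : Metric.sphere (0 : Cross n) 1, ‖fderiv ℝ (coneExt g) θ‖ ^ 2
    ∂(volume : Measure (Cross n)).toSphere
  have h1 : c * I * ((n + 1) * A) ≤ c * I * G := by linarith
  have h2 := le_of_mul_le_mul_left h1 (mul_pos hc hI)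
  linarith

lemma continuous_sphGradSq {g : Cross n → ℝ} (hg : ContDiffOn ℝ 1 g {0}ᶜ) :
    Continuous fun θ : Metric.sphere (0 : Cross n) 1 => sphGradSq g θ := by
  have h1 : ContinuousOn (fderiv ℝ g) {0}ᶜ := fun x hx =>
    (((hg.contDiffAt (isOpen_compl_singleton.mem_nhds hx)).fderiv_right (m := 0)
      (by norm_num)).continuousAt).continuousWithinAt
  have h2 : ContinuousOn (fun x => sphGradSq g x) {0}ᶜ :=
    (h1.norm.pow 2).sub ((h1.clm_apply continuousOn_id).pow 2)
  exact continuous_sphere_of_contDiffOn h2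

/-- The Poincaré inequality on the sphere `Sⁿ`, with the sharp constant `n`. -/
theorem sphere_poincare (hn : 1 ≤ n) {g : Cross n → ℝ} (hg : ContDiffOn ℝ 1 g {0}ᶜ) :
    n * (∫ θ : Metric.sphere (0 : Cross n) 1, g θ ^ 2 ∂(volume : Measure (Cross n)).toSphere -
      (∫ θ : Metric.sphere (0 : Cross n) 1, g θ ∂(volume : Measure (Cross n)).toSphere) ^ 2
        / sphereArea n) ≤
      ∫ θ : Metric.sphere (0 : Cross n) 1, sphGradSq g θ
        ∂(volume : Measure (Cross n)).toSphere := by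
  have hS := sphereArea_pos n
  set μ := (volume : Measure (Cross n)).toSphere with hμ
  have hc := continuous_sphere_of_contDiffOn hg.continuousOn
  set A := ∫ θ : Metric.sphere (0 : Cross n) 1, g θ ∂μ with hA
  set m := A / sphereArea n with hm
  have hg' : ContDiffOn ℝ 1 (fun x => g x - m) {0}ᶜ := hg.sub contDiffOn_const
  have hmul : m * sphereArea n = A := by rw [hm]; field_simp
  have h0 : ∫ θ : Metric.sphere (0 : Cross n) 1, (g θ - m) ∂μ = 0 := by
    rw [integral_sub (integrable_sphere hc) (integrable_const _), integral_const, smul_eq_mul,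
      ← hA, mul_comm]
    exact sub_eq_zero.2 hmul.symm
  have hfd : ∀ x, fderiv ℝ (fun x => g x - m) x = fderiv ℝ g x := fun x => fderiv_sub_const m
  have hgrad : ∀ θ : Cross n, sphGradSq (fun x => g x - m) θ = sphGradSq g θ := fun θ => by
    rw [sphGradSq, sphGradSq, hfd]
  have hc' := continuous_sphere_of_contDiffOn hg'.continuousOn
  have key := sphere_poincare_of_integral_eq_zero hn hg' h0
  simp_rw [norm_fderiv_coneExt_sq hg', hgrad] at key
  have i0 : Integrable (fun θ : Metric.sphere (0 : Cross n) 1 => (g θ - m) ^ 2) μ :=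
    integrable_sphere (hc'.pow 2)
  rw [integral_add i0 (integrable_sphere (continuous_sphGradSq hg)),
    add_sub_cancel_left] at key
  have hexp : ∫ θ : Metric.sphere (0 : Cross n) 1, (g θ - m) ^ 2 ∂μ =
      ∫ θ : Metric.sphere (0 : Cross n) 1, g θ ^ 2 ∂μ - A ^ 2 / sphereArea n := by
    have e1 : ∀ θ : Metric.sphere (0 : Cross n) 1, (g θ - m) ^ 2 =
        g θ ^ 2 - 2 * m * g θ + m ^ 2 := fun θ => by ring
    have i1 : Integrable (fun θ : Metric.sphere (0 : Cross n) 1 => g θ ^ 2) μ :=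
      integrable_sphere (hc.pow 2)
    have i2 := (integrable_sphere hc).const_mul (2 * m)
    have i3 : Integrable (fun θ : Metric.sphere (0 : Cross n) 1 => g θ ^ 2 - 2 * m * g θ) μ :=
      i1.sub i2
    simp_rw [e1]
    rw [integral_add i3 (integrable_const _), integral_sub i1 i2, integral_const_mul,
      integral_const, smul_eq_mul, ← hA, show μ.real univ = sphereArea n from rfl, ← hmul]
    field_simp
    ring
  rw [hexp] at key
  exact key

end Sphere

/-! ### The second variation of area -/

section Lagrangian

open Filter Topology

/-- The second derivative of the area integrand along a curve for which the angular part `S` of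
the squared slope vanishes to second order. -/
lemma exists_hasDerivAt_lagrangian {n : ℕ} (hn : 1 ≤ n) {F F₁ P P₁ S S₁ : ℝ → ℝ} {F₂ P₂ S₂ : ℝ}
    (hF : ∀ᶠ t in 𝓝 0, HasDerivAt F (F₁ t) t) (hP : ∀ᶠ t in 𝓝 0, HasDerivAt P (P₁ t) t)
    (hS : ∀ᶠ t in 𝓝 0, HasDerivAt S (S₁ t) t) (hF₁ : HasDerivAt F₁ F₂ 0)
    (hP₁ : HasDerivAt P₁ P₂ 0) (hS₁ : HasDerivAt S₁ S₂ 0) (h0 : 0 < F 0) (hS0 : S 0 = 0)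
    (hS₁0 : S₁ 0 = 0) :
    ∃ y₁ : ℝ → ℝ, (∀ᶠ t in 𝓝 0,
      HasDerivAt (fun t => F t ^ n * √(1 + P t ^ 2 + S t / F t ^ 2)) (y₁ t) t) ∧
      HasDerivAt y₁ (n * (n - 1) * (F 0 ^ n / F 0 ^ 2) * √(1 + P 0 ^ 2) * (F₁ 0 * F₁ 0) +
        n * (F 0 ^ n / F 0) * (P 0 / √(1 + P 0 ^ 2)) * (P₁ 0 * F₁ 0 + F₁ 0 * P₁ 0) +
        F 0 ^ n / √(1 + P 0 ^ 2) ^ 3 * (P₁ 0 * P₁ 0) +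
        (n * (F 0 ^ n / F 0) * √(1 + P 0 ^ 2) * F₂ + F 0 ^ n * (P 0 / √(1 + P 0 ^ 2)) * P₂) +
        F 0 ^ n / F 0 ^ 2 / √(1 + P 0 ^ 2) * (S₂ / 2)) 0 := by
  set R : ℝ → ℝ := fun t => 1 + P t ^ 2 + S t / F t ^ 2 with hR
  set R₁ : ℝ → ℝ := fun t => 2 * P t * P₁ t +
    (S₁ t * F t ^ 2 - S t * (2 * F t * F₁ t)) / (F t ^ 2) ^ 2 with hR₁
  have hFd := hF.self_of_nhds
  have hPd := hP.self_of_nhds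
  have hSd := hS.self_of_nhds
  have hF0 := h0.ne'
  have hFpos : ∀ᶠ t in 𝓝 0, 0 < F t := hFd.continuousAt.eventually (lt_mem_nhds h0)
  have hRd : ∀ᶠ t in 𝓝 0, HasDerivAt R (R₁ t) t := by
    filter_upwards [hF, hP, hS, hFpos] with t h1 h2 h3 h4
    refine (((h2.fun_pow 2).const_add 1).fun_add
      (h3.fun_div (h1.fun_pow 2) (pow_pos h4 2).ne')).congr_deriv ?_
    simp only [hR₁]
    push_cast
    ring
  have hR0 : R 0 = 1 + P 0 ^ 2 := by simp [hR, hS0]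
  have hRpos : ∀ᶠ t in 𝓝 0, 0 < R t := by
    refine hRd.self_of_nhds.continuousAt.eventually (lt_mem_nhds ?_)
    rw [hR0]; exact one_add_sq_pos _
  have hR₁0 : R₁ 0 = 2 * P 0 * P₁ 0 := by simp [hR₁, hS0, hS₁0]
  have hR₂ : HasDerivAt R₁ (2 * (P₁ 0 * P₁ 0) + 2 * P 0 * P₂ + S₂ / F 0 ^ 2) 0 := by
    have h1 := (hPd.const_mul 2).fun_mul hP₁
    have h2 := (hS₁.fun_mul (hFd.fun_pow 2)).fun_sub (hSd.fun_mul ((hFd.const_mul 2).fun_mul hF₁))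
    have h3 := h2.fun_div ((hFd.fun_pow 2).fun_pow 2) (pow_pos (pow_pos h0 2) 2).ne'
    refine (h1.fun_add h3).congr_deriv ?_
    rw [hS0, hS₁0]
    field_simp
    ring
  set Q : ℝ → ℝ := fun t => √(R t) with hQ
  have hQd : ∀ᶠ t in 𝓝 0, HasDerivAt Q (R₁ t / (2 * Q t)) t := by
    filter_upwards [hRd, hRpos] with t h1 h2
    exact h1.sqrt h2.ne'
  have hpw : ∀ᶠ t in 𝓝 0, HasDerivAt (fun t => F t ^ n) (n * (F t ^ n / F t) * F₁ t) t := by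
    filter_upwards [hF, hFpos] with t h1 h2
    exact (hasDerivWithinAt_pow_of_pos hn (h1.hasDerivWithinAt (s := univ)) h2.ne').hasDerivAt
      univ_mem
  have hpw2 : HasDerivAt (fun t => F t ^ n / F t) ((n - 1) * (F 0 ^ n / F 0 ^ 2) * F₁ 0) 0 :=
    (hasDerivWithinAt_pow_div hn (hFd.hasDerivWithinAt (s := univ)) hF0).hasDerivAt univ_mem
  refine ⟨fun t => n * (F t ^ n / F t) * F₁ t * Q t + F t ^ n * (R₁ t / (2 * Q t)), ?_, ?_⟩
  · filter_upwards [hpw, hQd] with t h1 h2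
    exact h1.mul h2
  · have hQ0 : Q 0 = √(1 + P 0 ^ 2) := by rw [hQ]; simp only [hR0]
    have hQpos := sqrt_one_add_sq_pos (P 0)
    have hQ0' : Q 0 ≠ 0 := by rw [hQ0]; exact hQpos.ne'
    have hQd0 := hQd.self_of_nhds
    have h1 := ((hpw2.const_mul (n : ℝ)).fun_mul hF₁).fun_mul hQd0
    have h2 := hpw.self_of_nhds.fun_mul (hR₂.fun_div (hQd0.const_mul 2)
      (mul_ne_zero two_ne_zero hQ0'))
    refine (h1.fun_add h2).congr_deriv ?_
    rw [hR₁0, hQ0]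
    have hsq := sq_sqrt_one_add_sq (P 0)
    have h3 : F 0 ^ n * (P₁ 0 * P₁ 0) / √(1 + P 0 ^ 2) =
        F 0 ^ n * (P₁ 0 * P₁ 0) * (1 + P 0 ^ 2) / √(1 + P 0 ^ 2) ^ 3 := by
      field_simp
      rw [hsq]
    have h4 : n * (n - 1) * (F 0 ^ n / F 0 ^ 2) * √(1 + P 0 ^ 2) * (F₁ 0 * F₁ 0) +
        n * (F 0 ^ n / F 0) * (P 0 / √(1 + P 0 ^ 2)) * (P₁ 0 * F₁ 0 + F₁ 0 * P₁ 0) +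
        F 0 ^ n / √(1 + P 0 ^ 2) ^ 3 * (P₁ 0 * P₁ 0) +
        (n * (F 0 ^ n / F 0) * √(1 + P 0 ^ 2) * F₂ + F 0 ^ n * (P 0 / √(1 + P 0 ^ 2)) * P₂) +
        F 0 ^ n / F 0 ^ 2 / √(1 + P 0 ^ 2) * (S₂ / 2) =
        n * (n - 1) * (F 0 ^ n / F 0 ^ 2) * √(1 + P 0 ^ 2) * (F₁ 0 * F₁ 0) +
        n * (F 0 ^ n / F 0) * (P 0 / √(1 + P 0 ^ 2)) * (P₁ 0 * F₁ 0 + F₁ 0 * P₁ 0) +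
        (F 0 ^ n * (P₁ 0 * P₁ 0) / √(1 + P 0 ^ 2) -
          F 0 ^ n * (P₁ 0 * P₁ 0) * P 0 ^ 2 / √(1 + P 0 ^ 2) ^ 3) +
        (n * (F 0 ^ n / F 0) * √(1 + P 0 ^ 2) * F₂ + F 0 ^ n * (P 0 / √(1 + P 0 ^ 2)) * P₂) +
        F 0 ^ n / F 0 ^ 2 / √(1 + P 0 ^ 2) * (S₂ / 2) := by
      rw [h3]; ring
    rw [h4]
    have hq := hQpos.ne'
    field_simp
    ring

end Lagrangian

section Variation

open Filter Topology

variable {n : ℕ} {a b δ : ℝ}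

/-- The domain `(-δ, δ) × (ℝ^(n+1) ∖ 0) × [a, b]` of a variation. -/
def varDomain (n : ℕ) (a b δ : ℝ) : Set ((ℝ × Cross n) × ℝ) :=
  (Ioo (-δ) δ ×ˢ ({0}ᶜ : Set (Cross n))) ×ˢ Icc a b

lemma isOpen_varBase : IsOpen (Ioo (-δ) δ ×ˢ ({0}ᶜ : Set (Cross n))) :=
  isOpen_Ioo.prod isOpen_compl_singleton

lemma uniqueDiffOn_varDomain (hab : a < b) : UniqueDiffOn ℝ (varDomain n a b δ) :=
  uniqueDiffOn_slab isOpen_varBase hab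

lemma varDomain_subset_closure (hab : a < b) :
    varDomain n a b δ ⊆ closure (interior (varDomain n a b δ)) :=
  slab_subset_closure isOpen_varBase hab

/-- The direction of the parameter of the variation. -/
def dirE (n : ℕ) : (ℝ × Cross n) × ℝ := ((1, 0), 0)

/-- The direction `v` of the cross-section. -/
def dirX {n : ℕ} (v : Cross n) : (ℝ × Cross n) × ℝ := ((0, v), 0)

/-- The direction of the axis. -/
def dirZ (n : ℕ) : (ℝ × Cross n) × ℝ := (0, 1)

variable {Q : (ℝ × Cross n) × ℝ → ℝ}

lemma hasDerivAt_dirE {D : Set ((ℝ × Cross n) × ℝ)} (hQ : ContDiffOn ℝ ∞ Q D) {t : ℝ} {x : Cross n}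
    {z : ℝ} (hD : ∀ᶠ τ in 𝓝 t, ((τ, x), z) ∈ D) :
    HasDerivAt (fun τ => Q ((τ, x), z)) (pd D Q (dirE n) ((t, x), z)) t := by
  have h1 : HasDerivWithinAt (fun τ : ℝ => ((τ, x), z)) (dirE n) {τ | ((τ, x), z) ∈ D} t :=
    ((hasDerivWithinAt_id t _).prodMk (hasDerivWithinAt_const t _ x)).prodMk
      (hasDerivWithinAt_const t _ z)
  exact (hasDerivWithinAt_pd hQ h1 (fun τ hτ => hτ) hD.self_of_nhds).hasDerivAt hD

lemma hasFDerivAt_dirX (hQ : ContDiffOn ℝ ∞ Q (varDomain n a b δ)) {t : ℝ} (ht : t ∈ Ioo (-δ) δ)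
    {x : Cross n} (hx : x ≠ 0) {z : ℝ} (hz : z ∈ Icc a b) :
    ∃ L : Cross n →L[ℝ] ℝ, HasFDerivAt (fun y => Q ((t, y), z)) L x ∧
      ∀ v, L v = pd (varDomain n a b δ) Q (dirX v) ((t, x), z) := by
  have h1 : HasFDerivWithinAt (fun y : Cross n => ((t, y), z))
      (((0 : Cross n →L[ℝ] ℝ).prod (ContinuousLinearMap.id ℝ (Cross n))).prod 0) {0}ᶜ x :=
    ((hasFDerivWithinAt_const t x _).prodMk (hasFDerivWithinAt_id x _)).prodMk
      (hasFDerivWithinAt_const z x _)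
  have h0 : ((t, x), z) ∈ varDomain n a b δ := ⟨⟨ht, hx⟩, hz⟩
  have h2 := ((hQ.differentiableOn (by simp)) ((t, x), z) h0).hasFDerivWithinAt.comp x
    h1 (show MapsTo (fun y : Cross n => ((t, y), z)) {0}ᶜ (varDomain n a b δ) from
      fun y hy => ⟨⟨ht, hy⟩, hz⟩)
  exact ⟨_, h2.hasFDerivAt (isOpen_compl_singleton.mem_nhds hx), fun v => rfl⟩

/-- The squared length of the gradient along the sphere, in coordinates. -/
def gradSq (D : Set ((ℝ × Cross n) × ℝ)) (Q : (ℝ × Cross n) × ℝ → ℝ) (p : (ℝ × Cross n) × ℝ) : ℝ :=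
  ∑ i, pd D Q (dirX (EuclideanSpace.single i 1)) p ^ 2 -
    (∑ i, p.1.2 i * pd D Q (dirX (EuclideanSpace.single i 1)) p) ^ 2

lemma linearForm_eq_sum (L : Cross n →L[ℝ] ℝ) (x : Cross n) :
    L x = ∑ i, x i * L (EuclideanSpace.single i 1) := by
  conv_lhs => rw [← (EuclideanSpace.basisFun (Fin (n + 1)) ℝ).sum_repr x, map_sum]
  simp

lemma sphGradSq_eq_gradSq (hQ : ContDiffOn ℝ ∞ Q (varDomain n a b δ)) {t : ℝ}
    (ht : t ∈ Ioo (-δ) δ) {x : Cross n} (hx : x ≠ 0) {z : ℝ} (hz : z ∈ Icc a b) :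
    sphGradSq (fun y => Q ((t, y), z)) x = gradSq (varDomain n a b δ) Q ((t, x), z) := by
  obtain ⟨L, hL, hLv⟩ := hasFDerivAt_dirX hQ ht hx hz
  rw [sphGradSq, hL.fderiv, norm_sq_linearForm, linearForm_eq_sum L x]
  simp only [hLv, gradSq]

lemma contDiffOn_gradSq (hab : a < b) (hQ : ContDiffOn ℝ ∞ Q (varDomain n a b δ)) :
    ContDiffOn ℝ ∞ (gradSq (varDomain n a b δ) Q) (varDomain n a b δ) := by
  have h1 := fun e => contDiffOn_pd (uniqueDiffOn_varDomain hab) hQ e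
  have h2 : ∀ i, ContDiffOn ℝ ∞ (fun p : (ℝ × Cross n) × ℝ => p.1.2 i) (varDomain n a b δ) :=
    fun i => by fun_prop
  exact (ContDiffOn.sum fun i _ => (h1 _).pow 2).sub
    ((ContDiffOn.sum fun i _ => (h2 i).mul (h1 _)).pow 2)

end Variation

section Variation

open Filter Topology

variable {n : ℕ} {a b δ : ℝ} {h : ℝ → ℝ} {F : (ℝ × Cross n) × ℝ → ℝ}

lemma sphGradSq_nonneg (g : Cross n → ℝ) (θ : Metric.sphere (0 : Cross n) 1) :
    0 ≤ sphGradSq g θ := by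
  have h1 := (fderiv ℝ g θ).le_opNorm (θ : Cross n)
  rw [show ‖(θ : Cross n)‖ = 1 by simp, mul_one, Real.norm_eq_abs] at h1
  have h2 := pow_le_pow_left₀ (abs_nonneg _) h1 2
  rw [sq_abs] at h2
  exact sub_nonneg.2 h2

lemma zero_mem_Ioo (hδ : 0 < δ) : (0 : ℝ) ∈ Ioo (-δ) δ := ⟨by linarith, hδ⟩

lemma mem_varDomain {t : ℝ} (ht : t ∈ Ioo (-δ) δ) (θ : Metric.sphere (0 : Cross n) 1) {z : ℝ}
    (hz : z ∈ Icc a b) : ((t, (θ : Cross n)), z) ∈ varDomain n a b δ :=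
  ⟨⟨ht, sphere_ne_zero θ⟩, hz⟩

lemma eventually_mem_varDomain {t : ℝ} (ht : t ∈ Ioo (-δ) δ) (θ : Metric.sphere (0 : Cross n) 1)
    {z : ℝ} (hz : z ∈ Icc a b) : ∀ᶠ τ in 𝓝 t, ((τ, (θ : Cross n)), z) ∈ varDomain n a b δ := by
  filter_upwards [isOpen_Ioo.mem_nhds ht] with τ hτ
  exact mem_varDomain hτ θ hz

/-- A function that is constant on the sphere has a radial gradient there. -/
lemma pd_dirX_of_const_on_sphere (hδ : 0 < δ) (hF : ContDiffOn ℝ ∞ F (varDomain n a b δ))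
    (hstart : ∀ θ ∈ Metric.sphere (0 : Cross n) 1, ∀ z ∈ Icc a b, F ((0, θ), z) = h z)
    (θ : Metric.sphere (0 : Cross n) 1) {z : ℝ} (hz : z ∈ Icc a b) (v : Cross n) :
    pd (varDomain n a b δ) F (dirX v) ((0, θ), z) = inner ℝ (θ : Cross n) v *
      pd (varDomain n a b δ) F (dirX (θ : Cross n)) ((0, θ), z) := by
  obtain ⟨L, hL, hLv⟩ := hasFDerivAt_dirX hF (zero_mem_Ioo hδ) (sphere_ne_zero θ) hz
  have hL' : HasFDerivAt (fun y => F ((0, y), z)) L (‖(θ : Cross n)‖⁻¹ • (θ : Cross n)) := by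
    rwa [show ‖(θ : Cross n)‖ = 1 by simp, inv_one, one_smul]
  have h1 := HasFDerivAt.comp (f := fun x : Cross n => ‖x‖⁻¹ • x) (θ : Cross n) hL'
    (hasFDerivAt_normalize θ).2
  have h2 : HasFDerivAt (fun _ : Cross n => h z) (0 : Cross n →L[ℝ] ℝ) (θ : Cross n) :=
    hasFDerivAt_const _ _
  have h3 : ((fun y => F ((0, y), z)) ∘ fun x : Cross n => ‖x‖⁻¹ • x) =ᶠ[𝓝 (θ : Cross n)]
      fun _ => h z := by
    filter_upwards [isOpen_compl_singleton.mem_nhds (sphere_ne_zero θ)] with x hx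
    have hx0 : x ≠ 0 := hx
    refine hstart _ ?_ z hz
    simp [norm_smul, hx0]
  have h4 := congrArg (fun K : Cross n →L[ℝ] ℝ => K v) ((h2.congr_of_eventuallyEq h3).unique h1)
  simp only [zero_apply, ContinuousLinearMap.comp_apply,
    sub_apply, ContinuousLinearMap.id_apply,
    ContinuousLinearMap.smulRight_apply, innerSL_apply_apply, map_sub, map_smul,
    smul_eq_mul] at h4
  rw [← hLv, ← hLv]
  linarith

lemma inner_eq_sum_coord (θ : Cross n) (c : Fin (n + 1) → ℝ) (τ : ℝ) :
    ∑ i, inner ℝ θ (EuclideanSpace.single i 1) * τ * c i = τ * ∑ i, θ i * c i := by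
  rw [Finset.mul_sum]
  refine Finset.sum_congr rfl fun i _ => ?_
  simp [EuclideanSpace.inner_single_right]
  ring

/-- Along a variation of a hypersurface of revolution the angular part of the squared slope
vanishes to second order, with the gradient of the variation field as second derivative. -/
lemma exists_hasDerivAt_gradSq (hab : a < b) (hδ : 0 < δ)
    (hF : ContDiffOn ℝ ∞ F (varDomain n a b δ))
    (hstart : ∀ θ ∈ Metric.sphere (0 : Cross n) 1, ∀ z ∈ Icc a b, F ((0, θ), z) = h z)
    (θ : Metric.sphere (0 : Cross n) 1) {z : ℝ} (hz : z ∈ Icc a b) :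
    gradSq (varDomain n a b δ) F ((0, θ), z) = 0 ∧ ∃ S₁ : ℝ → ℝ,
      (∀ᶠ t in 𝓝 0, HasDerivAt (fun t => gradSq (varDomain n a b δ) F ((t, θ), z)) (S₁ t) t) ∧
      S₁ 0 = 0 ∧ HasDerivAt S₁ (2 * gradSq (varDomain n a b δ)
        (pd (varDomain n a b δ) F (dirE n)) ((0, θ), z)) 0 := by
  set D := varDomain n a b δ with hD
  have hU : UniqueDiffOn ℝ D := uniqueDiffOn_varDomain hab
  have hcl : D ⊆ closure (interior D) := varDomain_subset_closure hab
  set u := pd D F (dirE n) with hu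
  have su : ContDiffOn ℝ ∞ u D := contDiffOn_pd hU hF _
  set e : Fin (n + 1) → (ℝ × Cross n) × ℝ := fun i => dirX (EuclideanSpace.single i 1) with he
  set T : Fin (n + 1) → ℝ → ℝ := fun i t => pd D F (e i) ((t, θ), z) with hT
  set T₁ : Fin (n + 1) → ℝ → ℝ := fun i t => pd D u (e i) ((t, θ), z) with hT₁
  set T₂ : Fin (n + 1) → ℝ := fun i => pd D (pd D u (e i)) (dirE n) ((0, θ), z) with hT₂
  have h0 := zero_mem_Ioo hδ
  have dT : ∀ t ∈ Ioo (-δ) δ, ∀ i, HasDerivAt (T i) (T₁ i t) t := fun t ht i => by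
    have h1 := hasDerivAt_dirE (contDiffOn_pd hU hF (e i)) (eventually_mem_varDomain ht θ hz)
    rwa [pd_comm hU hcl hF _ _ (mem_varDomain ht θ hz)] at h1
  have dT₁ : ∀ i, HasDerivAt (T₁ i) (T₂ i) 0 := fun i =>
    hasDerivAt_dirE (contDiffOn_pd hU su (e i)) (eventually_mem_varDomain h0 θ hz)
  set τ : ℝ := pd D F (dirX (θ : Cross n)) ((0, θ), z) with hτ
  have hT0 : ∀ i, T i 0 = inner ℝ (θ : Cross n) (EuclideanSpace.single i 1) * τ := fun i =>
    pd_dirX_of_const_on_sphere hδ hF hstart θ hz _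
  have hsum : ∀ c : Fin (n + 1) → ℝ, ∑ i, T i 0 * c i = τ * ∑ i, (θ : Cross n) i * c i :=
      fun c => by
    simp_rw [hT0]; exact inner_eq_sum_coord _ _ _
  have hθ2 : ∑ i, (θ : Cross n) i * (θ : Cross n) i = 1 := by
    have h1 := EuclideanSpace.real_norm_sq_eq (θ : Cross n)
    rw [show ‖(θ : Cross n)‖ = 1 by simp] at h1
    simp_rw [← sq]
    rw [← h1, one_pow]
  have hθT : ∑ i, (θ : Cross n) i * T i 0 = τ := by
    have h1 := hsum fun i => (θ : Cross n) i
    rw [hθ2, mul_one] at h1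
    rw [← h1]
    exact Finset.sum_congr rfl fun i _ => mul_comm _ _
  refine ⟨?_, fun t => ∑ i, 2 * (T i t * T₁ i t) -
    2 * ((∑ i, (θ : Cross n) i * T i t) * ∑ i, (θ : Cross n) i * T₁ i t), ?_, ?_, ?_⟩
  · change ∑ i, T i 0 ^ 2 - (∑ i, (θ : Cross n) i * T i 0) ^ 2 = 0
    have h1 := hsum fun i => T i 0
    simp_rw [← sq] at h1
    rw [h1, hθT]
    ring
  · filter_upwards [isOpen_Ioo.mem_nhds h0] with t ht
    have h1 : HasDerivAt (fun t => ∑ i, T i t ^ 2) (∑ i, 2 * (T i t * T₁ i t)) t :=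
      HasDerivAt.fun_sum fun i _ => ((dT t ht i).fun_pow 2).congr_deriv (by push_cast; ring)
    have h2 : HasDerivAt (fun t => ∑ i, (θ : Cross n) i * T i t)
        (∑ i, (θ : Cross n) i * T₁ i t) t :=
      HasDerivAt.fun_sum fun i _ => (dT t ht i).const_mul _
    exact (h1.fun_sub (h2.fun_pow 2)).congr_deriv (by push_cast; ring)
  · simp only []
    rw [← Finset.mul_sum, hsum, hθT]
    ring
  · have h1 : HasDerivAt (fun t => ∑ i, 2 * (T i t * T₁ i t))
        (∑ i, 2 * (T₁ i 0 * T₁ i 0 + T i 0 * T₂ i)) 0 :=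
      HasDerivAt.fun_sum fun i _ => ((dT 0 h0 i).fun_mul (dT₁ i)).const_mul 2
    have h2 : HasDerivAt (fun t => ∑ i, (θ : Cross n) i * T i t)
        (∑ i, (θ : Cross n) i * T₁ i 0) 0 :=
      HasDerivAt.fun_sum fun i _ => (dT 0 h0 i).const_mul _
    have h3 : HasDerivAt (fun t => ∑ i, (θ : Cross n) i * T₁ i t)
        (∑ i, (θ : Cross n) i * T₂ i) 0 :=
      HasDerivAt.fun_sum fun i _ => (dT₁ i).const_mul _
    refine (h1.fun_sub ((h2.fun_mul h3).const_mul 2)).congr_deriv ?_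
    rw [← Finset.mul_sum, Finset.sum_add_distrib, hsum, hθT]
    change _ = 2 * (∑ i, T₁ i 0 ^ 2 - (∑ i, (θ : Cross n) i * T₁ i 0) ^ 2)
    simp_rw [← sq]
    ring

/-- Surface measure times length on `Sⁿ × [a, b]`. -/
abbrev slabMeasure (n : ℕ) : Measure (Metric.sphere (0 : Cross n) 1 × ℝ) :=
  (volume : Measure (Cross n)).toSphere.prod volume

lemma isCompact_sphere_slab :
    IsCompact ((univ : Set (Metric.sphere (0 : Cross n) 1)) ×ˢ Icc a b) :=
  isCompact_univ.prod isCompact_Icc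

lemma measurableSet_sphere_slab :
    MeasurableSet ((univ : Set (Metric.sphere (0 : Cross n) 1)) ×ˢ Icc a b) :=
  MeasurableSet.univ.prod measurableSet_Icc

lemma slabMeasure_ne_top :
    slabMeasure n ((univ : Set (Metric.sphere (0 : Cross n) 1)) ×ˢ Icc a b) ≠ ⊤ := by
  rw [slabMeasure, Measure.prod_prod]
  exact ENNReal.mul_ne_top (measure_ne_top _ _) measure_Icc_lt_top.ne

lemma slabMeasure_restrict : (slabMeasure n).restrict
    ((univ : Set (Metric.sphere (0 : Cross n) 1)) ×ˢ Icc a b) =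
    (volume : Measure (Cross n)).toSphere.prod (volume.restrict (Icc a b)) := by
  rw [slabMeasure, ← Measure.prod_restrict, Measure.restrict_univ]

lemma integrableOn_slab {Ψ : Metric.sphere (0 : Cross n) 1 × ℝ → ℝ}
    (hΨ : ContinuousOn Ψ (univ ×ˢ Icc a b)) : IntegrableOn Ψ (univ ×ˢ Icc a b) (slabMeasure n) := by
  obtain ⟨C, hC⟩ := isCompact_sphere_slab.exists_bound_of_continuousOn hΨ
  refine (integrableOn_const (C := C) slabMeasure_ne_top).mono'
    (hΨ.aestronglyMeasurable_of_isCompact isCompact_sphere_slab measurableSet_sphere_slab) ?_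
  filter_upwards [ae_restrict_mem measurableSet_sphere_slab] with y hy using hC y hy

lemma setIntegral_slab {Ψ : Metric.sphere (0 : Cross n) 1 × ℝ → ℝ}
    (hΨ : ContinuousOn Ψ (univ ×ˢ Icc a b)) : ∫ y in univ ×ˢ Icc a b, Ψ y ∂slabMeasure n =
      ∫ θ, (∫ z in Icc a b, Ψ (θ, z)) ∂(volume : Measure (Cross n)).toSphere := by
  have h1 := integrableOn_slab hΨ
  rw [IntegrableOn, slabMeasure_restrict] at h1
  rw [slabMeasure_restrict, integral_prod _ h1]

lemma setIntegral_slab_symm {Ψ : Metric.sphere (0 : Cross n) 1 × ℝ → ℝ}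
    (hΨ : ContinuousOn Ψ (univ ×ˢ Icc a b)) : ∫ y in univ ×ˢ Icc a b, Ψ y ∂slabMeasure n =
      ∫ z in Icc a b, (∫ θ, Ψ (θ, z) ∂(volume : Measure (Cross n)).toSphere) := by
  have h1 := integrableOn_slab hΨ
  rw [IntegrableOn, slabMeasure_restrict] at h1
  rw [slabMeasure_restrict, integral_prod_symm _ h1]

lemma continuousOn_slab_param {D' : Set ((ℝ × Cross n) × ℝ)} {G : (ℝ × Cross n) × ℝ → ℝ}
    (hG : ContinuousOn G D') {J : Set ℝ}
    (hJ : ∀ t ∈ J, ∀ (θ : Metric.sphere (0 : Cross n) 1), ∀ z ∈ Icc a b,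
      ((t, (θ : Cross n)), z) ∈ D') :
    ContinuousOn (fun p : ℝ × (Metric.sphere (0 : Cross n) 1 × ℝ) =>
      G ((p.1, (p.2.1 : Cross n)), p.2.2)) (J ×ˢ (univ ×ˢ Icc a b)) := by
  refine hG.comp (f := fun p : ℝ × (Metric.sphere (0 : Cross n) 1 × ℝ) =>
    ((p.1, (p.2.1 : Cross n)), p.2.2)) ?_ fun p hp => hJ p.1 hp.1 p.2.1 p.2.2 hp.2.2
  exact Continuous.continuousOn (by fun_prop)

lemma continuousOn_slab {D' : Set ((ℝ × Cross n) × ℝ)} {G : (ℝ × Cross n) × ℝ → ℝ}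
    (hG : ContinuousOn G D') {t : ℝ}
    (hJ : ∀ (θ : Metric.sphere (0 : Cross n) 1), ∀ z ∈ Icc a b, ((t, (θ : Cross n)), z) ∈ D') :
    ContinuousOn (fun y : Metric.sphere (0 : Cross n) 1 × ℝ => G ((t, (y.1 : Cross n)), y.2))
      (univ ×ˢ Icc a b) := by
  refine hG.comp (f := fun y : Metric.sphere (0 : Cross n) 1 × ℝ => ((t, (y.1 : Cross n)), y.2)) ?_
    fun y hy => hJ y.1 y.2 hy.2
  exact Continuous.continuousOn (by fun_prop)

end Variation

section Variation

open Filter Topology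

variable {n : ℕ} {a b δ : ℝ} {h : ℝ → ℝ} {F : (ℝ × Cross n) × ℝ → ℝ}

/-- The second derivative at `0` of the area integrand of a variation, in terms of the variation
field `u`, the second parameter derivative `u₂`, and their slopes `uz`, `u₂z`; the last term is
the contribution of the squared gradient `g` of `u` along the sphere. -/
def secondVariation (n : ℕ) (a b : ℝ) (h : ℝ → ℝ) (z u uz u₂ u₂z g : ℝ) : ℝ :=
  n * (n - 1) * (h z ^ n / h z ^ 2) * √(1 + dz a b h z ^ 2) * (u * u) +
    n * (h z ^ n / h z) * (dz a b h z / √(1 + dz a b h z ^ 2)) * (uz * u + u * uz) +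
    h z ^ n / √(1 + dz a b h z ^ 2) ^ 3 * (uz * uz) +
    (n * (h z ^ n / h z) * √(1 + dz a b h z ^ 2) * u₂ +
      h z ^ n * (dz a b h z / √(1 + dz a b h z ^ 2)) * u₂z) +
    h z ^ n / h z ^ 2 / √(1 + dz a b h z ^ 2) * g

lemma area_eq_setIntegral (hab : a < b) (hF : ContDiffOn ℝ ∞ F (varDomain n a b δ)) {t : ℝ}
    (ht : t ∈ Ioo (-δ) δ)
    (hG : ContinuousOn (fun y : Metric.sphere (0 : Cross n) 1 × ℝ =>
      F ((t, (y.1 : Cross n)), y.2) ^ n * √(1 +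
        pd (varDomain n a b δ) F (dirZ n) ((t, (y.1 : Cross n)), y.2) ^ 2 +
        gradSq (varDomain n a b δ) F ((t, (y.1 : Cross n)), y.2) /
          F ((t, (y.1 : Cross n)), y.2) ^ 2)) (univ ×ˢ Icc a b)) :
    area n a b (fun x z => F ((t, x), z)) = ∫ y in univ ×ˢ Icc a b,
      F ((t, (y.1 : Cross n)), y.2) ^ n * √(1 +
        pd (varDomain n a b δ) F (dirZ n) ((t, (y.1 : Cross n)), y.2) ^ 2 +
        gradSq (varDomain n a b δ) F ((t, (y.1 : Cross n)), y.2) /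
          F ((t, (y.1 : Cross n)), y.2) ^ 2) ∂slabMeasure n := by
  rw [setIntegral_slab hG, area]
  congr 1; ext θ
  rw [intervalIntegral_eq_setIntegral_Icc hab.le]
  refine setIntegral_congr_fun measurableSet_Icc fun z hz => ?_
  have hx := sphere_ne_zero θ
  simp only []
  rw [sphGradSq_eq_gradSq hF ht hx hz, dz_eq hab hz
    (hasDerivWithinAt_slab hF (show (t, (θ : Cross n)) ∈ _ from ⟨ht, hx⟩) hz)]
  rfl

/-- The second derivative of area along a variation of a hypersurface of revolution. -/
theorem iteratedDeriv_area (hn : 1 ≤ n) (hab : a < b) (hδ : 0 < δ)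
    (hF : ContDiffOn ℝ ∞ F (varDomain n a b δ))
    (hpos : ∀ t ∈ Ioo (-δ) δ, ∀ θ ∈ Metric.sphere (0 : Cross n) 1, ∀ z ∈ Icc a b, 0 < F ((t, θ), z))
    (hstart : ∀ θ ∈ Metric.sphere (0 : Cross n) 1, ∀ z ∈ Icc a b, F ((0, θ), z) = h z) :
    iteratedDeriv 2 (fun t => area n a b (fun x z => F ((t, x), z))) 0 =
      ∫ y in univ ×ˢ Icc a b, secondVariation n a b h y.2
        (pd (varDomain n a b δ) F (dirE n) ((0, (y.1 : Cross n)), y.2))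
        (pd (varDomain n a b δ) (pd (varDomain n a b δ) F (dirE n)) (dirZ n)
          ((0, (y.1 : Cross n)), y.2))
        (pd (varDomain n a b δ) (pd (varDomain n a b δ) F (dirE n)) (dirE n)
          ((0, (y.1 : Cross n)), y.2))
        (pd (varDomain n a b δ)
          (pd (varDomain n a b δ) (pd (varDomain n a b δ) F (dirE n)) (dirE n)) (dirZ n)
          ((0, (y.1 : Cross n)), y.2))
        (gradSq (varDomain n a b δ) (pd (varDomain n a b δ) F (dirE n)) ((0, (y.1 : Cross n)), y.2))
        ∂slabMeasure n := by
  set D := varDomain n a b δ with hD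
  have hU : UniqueDiffOn ℝ D := uniqueDiffOn_varDomain hab
  have hcl : D ⊆ closure (interior D) := varDomain_subset_closure hab
  have h0 := zero_mem_Ioo hδ
  set u := pd D F (dirE n) with hu
  set P := pd D F (dirZ n) with hP
  set S := gradSq D F with hS
  have su : ContDiffOn ℝ ∞ u D := contDiffOn_pd hU hF _
  have sP : ContDiffOn ℝ ∞ P D := contDiffOn_pd hU hF _
  have sS : ContDiffOn ℝ ∞ S D := contDiffOn_gradSq hab hF
  -- the relatively open part of the domain on which the area integrand is smooth
  set k : (ℝ × Cross n) × ℝ → ℝ := fun p => min (F p) (F p ^ 2 * (1 + P p ^ 2) + S p) with hk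
  have ck : ContinuousOn k D := hF.continuousOn.inf
    (((hF.continuousOn.pow 2).mul (continuousOn_const.add (sP.continuousOn.pow 2))).add
      sS.continuousOn)
  obtain ⟨W, hW, hWk⟩ := continuousOn_iff'.1 ck (Ioi 0) isOpen_Ioi
  set D' := D ∩ W with hD'
  have hU' : UniqueDiffOn ℝ D' := hU.inter hW
  have hD'D : D' ⊆ D := inter_subset_left
  have hmemD' : ∀ p, p ∈ D' ↔ p ∈ D ∧ 0 < k p := fun p => by
    have : p ∈ k ⁻¹' Ioi 0 ∩ D ↔ p ∈ W ∩ D := by rw [hWk]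
    simp only [mem_inter_iff, mem_preimage, mem_Ioi] at this
    rw [hD', mem_inter_iff]
    tauto
  have hFD' : ∀ p ∈ D', 0 < F p := fun p hp => (lt_min_iff.1 ((hmemD' p).1 hp).2).1
  have hRD' : ∀ p ∈ D', 0 < 1 + P p ^ 2 + S p / F p ^ 2 := fun p hp => by
    have h1 := (lt_min_iff.1 ((hmemD' p).1 hp).2).2
    have h2 := pow_pos (hFD' p hp) 2
    have h3 : 1 + P p ^ 2 + S p / F p ^ 2 = (F p ^ 2 * (1 + P p ^ 2) + S p) / F p ^ 2 := by
      rw [add_div, mul_div_cancel_left₀ _ h2.ne']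
    rw [h3]
    exact div_pos h1 h2
  have hmem : ∀ t ∈ Ioo (-δ) δ, ∀ (θ : Metric.sphere (0 : Cross n) 1), ∀ z ∈ Icc a b,
      ((t, (θ : Cross n)), z) ∈ D' := fun t ht θ z hz => by
    have h1 := hpos t ht θ θ.2 z hz
    have h2 : 0 ≤ S ((t, θ), z) := by
      rw [hS, ← sphGradSq_eq_gradSq hF ht (sphere_ne_zero θ) hz]
      exact sphGradSq_nonneg _ _
    refine (hmemD' _).2 ⟨mem_varDomain ht θ hz, lt_min h1 ?_⟩
    positivity
  set G : (ℝ × Cross n) × ℝ → ℝ := fun p => F p ^ n * √(1 + P p ^ 2 + S p / F p ^ 2) with hG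
  have sG : ContDiffOn ℝ ∞ G D' := by
    refine ((hF.mono hD'D).pow n).mul (ContDiffOn.sqrt ?_ fun p hp => (hRD' p hp).ne')
    exact (contDiffOn_const.add ((sP.mono hD'D).pow 2)).add
      ((sS.mono hD'D).div ((hF.mono hD'D).pow 2) fun p hp => (pow_pos (hFD' p hp) 2).ne')
  set G₁ := pd D' G (dirE n) with hG₁
  set G₂ := pd D' G₁ (dirE n) with hG₂
  have sG₁ : ContDiffOn ℝ ∞ G₁ D' := contDiffOn_pd hU' sG _
  have sG₂ : ContDiffOn ℝ ∞ G₂ D' := contDiffOn_pd hU' sG₁ _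
  have hev : ∀ t ∈ Ioo (-δ) δ, ∀ (θ : Metric.sphere (0 : Cross n) 1), ∀ z ∈ Icc a b,
      ∀ᶠ τ in 𝓝 t, ((τ, (θ : Cross n)), z) ∈ D' := fun t ht θ z hz => by
    filter_upwards [isOpen_Ioo.mem_nhds ht] with τ hτ using hmem τ hτ θ z hz
  have harea : (fun t => area n a b (fun x z => F ((t, x), z))) =ᶠ[𝓝 0]
      fun t => ∫ y in univ ×ˢ Icc a b, G ((t, (y.1 : Cross n)), y.2) ∂slabMeasure n := by
    filter_upwards [isOpen_Ioo.mem_nhds h0] with t ht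
    exact area_eq_setIntegral hab hF ht (continuousOn_slab sG.continuousOn (hmem t ht))
  rw [harea.iteratedDeriv_eq, iteratedDeriv_two_setIntegral_param isOpen_Ioo isCompact_sphere_slab
    measurableSet_sphere_slab slabMeasure_ne_top
    (Φ := fun t y => G ((t, (y.1 : Cross n)), y.2))
    (Φ' := fun t y => G₁ ((t, (y.1 : Cross n)), y.2))
    (Φ'' := fun t y => G₂ ((t, (y.1 : Cross n)), y.2))
    (continuousOn_slab_param sG.continuousOn hmem) (continuousOn_slab_param sG₁.continuousOn hmem)
    (continuousOn_slab_param sG₂.continuousOn hmem)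
    (fun t ht y hy => hasDerivAt_dirE sG (hev t ht y.1 y.2 hy.2))
    (fun t ht y hy => hasDerivAt_dirE sG₁ (hev t ht y.1 y.2 hy.2)) h0]
  refine setIntegral_congr_fun measurableSet_sphere_slab fun y hy => ?_
  obtain ⟨θ, z⟩ := y
  have hz : z ∈ Icc a b := hy.2
  simp only []
  have hline : ∀ {Q : (ℝ × Cross n) × ℝ → ℝ}, ContDiffOn ℝ ∞ Q D → ∀ᶠ t in 𝓝 0,
      HasDerivAt (fun t => Q ((t, (θ : Cross n)), z)) (pd D Q (dirE n) ((t, θ), z)) t := by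
    intro Q hQ
    filter_upwards [isOpen_Ioo.mem_nhds h0] with t ht
    exact hasDerivAt_dirE hQ (eventually_mem_varDomain ht θ hz)
  obtain ⟨hS0, S₁, hS₁, hS₁0, hS₂⟩ := exists_hasDerivAt_gradSq hab hδ hF hstart θ hz
  have hPd : ∀ᶠ t in 𝓝 0, HasDerivAt (fun t => P ((t, (θ : Cross n)), z))
      (pd D u (dirZ n) ((t, θ), z)) t := by
    filter_upwards [hline sP, isOpen_Ioo.mem_nhds h0] with t h1 ht
    rwa [hP, pd_comm hU hcl hF _ _ (mem_varDomain ht θ hz)] at h1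
  have hP₁ : HasDerivAt (fun t => pd D u (dirZ n) ((t, (θ : Cross n)), z))
      (pd D (pd D u (dirE n)) (dirZ n) ((0, θ), z)) 0 := by
    have h1 := (hline (contDiffOn_pd hU su (dirZ n))).self_of_nhds
    rwa [pd_comm hU hcl su _ _ (mem_varDomain h0 θ hz)] at h1
  have hF0 : F ((0, (θ : Cross n)), z) = h z := hstart θ θ.2 z hz
  have hP0 : P ((0, (θ : Cross n)), z) = dz a b h z := by
    have h1 := dz_eq hab hz (hasDerivWithinAt_slab hF
      (show ((0 : ℝ), (θ : Cross n)) ∈ _ from ⟨h0, sphere_ne_zero θ⟩) hz)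
    have h2 : dz a b (fun t => F ((0, (θ : Cross n)), t)) z = dz a b h z :=
      derivWithin_congr (fun t ht => hstart θ θ.2 t ht) (hstart θ θ.2 z hz)
    rw [← h2, h1]
    rfl
  obtain ⟨y₁, hy₁, hy₂⟩ := exists_hasDerivAt_lagrangian hn (hline hF) hPd hS₁
    (hline su).self_of_nhds hP₁ hS₂ (hpos 0 h0 θ θ.2 z hz) hS0 hS₁0
  have hG₁d : ∀ᶠ t in 𝓝 0, HasDerivAt (fun t => G ((t, (θ : Cross n)), z))
      (G₁ ((t, θ), z)) t := by
    filter_upwards [isOpen_Ioo.mem_nhds h0] with t ht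
    exact hasDerivAt_dirE sG (hev t ht θ z hz)
  have heq : (fun t => G₁ ((t, (θ : Cross n)), z)) =ᶠ[𝓝 0] y₁ := by
    filter_upwards [hG₁d, hy₁] with t h1 h2 using h1.unique h2
  have hfin := (hy₂.congr_of_eventuallyEq heq).unique (hasDerivAt_dirE sG₁ (hev 0 h0 θ z hz))
  rw [hF0, hP0] at hfin
  refine hfin.symm.trans ?_
  rw [secondVariation, mul_div_cancel_left₀ _ two_ne_zero]

/-- Both the first and the second derivative of volume vanish at the start of a volume-preserving
variation: the first is the integral of `hⁿ u`, the second that of `n hⁿ⁻¹ u² + hⁿ u₂`, for the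
first and second parameter derivatives `u` and `u₂`. -/
theorem integral_variation_of_volume_eq (hn : 1 ≤ n) (hab : a < b) (hδ : 0 < δ)
    (hF : ContDiffOn ℝ ∞ F (varDomain n a b δ))
    (hpos : ∀ z ∈ Icc a b, 0 < h z)
    (hstart : ∀ θ ∈ Metric.sphere (0 : Cross n) 1, ∀ z ∈ Icc a b, F ((0, θ), z) = h z)
    (hvol : ∀ t ∈ Ioo (-δ) δ, enclosedVolume n a b (fun x z => F ((t, x), z)) =
      enclosedVolume n a b (fun x z => F ((0, x), z))) :
    ∫ y in univ ×ˢ Icc a b, h y.2 ^ n *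
        pd (varDomain n a b δ) F (dirE n) ((0, (y.1 : Cross n)), y.2) ∂slabMeasure n = 0 ∧
    ∫ y in univ ×ˢ Icc a b, (n * (h y.2 ^ n / h y.2) *
        (pd (varDomain n a b δ) F (dirE n) ((0, (y.1 : Cross n)), y.2) *
          pd (varDomain n a b δ) F (dirE n) ((0, (y.1 : Cross n)), y.2)) +
      h y.2 ^ n * pd (varDomain n a b δ) (pd (varDomain n a b δ) F (dirE n)) (dirE n)
        ((0, (y.1 : Cross n)), y.2)) ∂slabMeasure n = 0 := by
  set D := varDomain n a b δ with hD
  have hU : UniqueDiffOn ℝ D := uniqueDiffOn_varDomain hab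
  have h0 := zero_mem_Ioo hδ
  set u := pd D F (dirE n) with hu
  set u₂ := pd D u (dirE n) with hu₂
  have su : ContDiffOn ℝ ∞ u D := contDiffOn_pd hU hF _
  have su₂ : ContDiffOn ℝ ∞ u₂ D := contDiffOn_pd hU su _
  have hmem : ∀ t ∈ Ioo (-δ) δ, ∀ (θ : Metric.sphere (0 : Cross n) 1), ∀ z ∈ Icc a b,
      ((t, (θ : Cross n)), z) ∈ D := fun t ht θ z hz => mem_varDomain ht θ hz
  have hn0 : (n : ℝ) + 1 ≠ 0 := by positivity
  have hF0 : ∀ (θ : Metric.sphere (0 : Cross n) 1), ∀ z ∈ Icc a b,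
    F ((0, (θ : Cross n)), z) = h z := fun θ z hz => hstart θ θ.2 z hz
  set V : ℝ → ℝ := fun t => ∫ y in univ ×ˢ Icc a b,
    ((n : ℝ) + 1)⁻¹ * F ((t, (y.1 : Cross n)), y.2) ^ (n + 1) ∂slabMeasure n with hV
  have sV : ContDiffOn ℝ ∞ (fun p => ((n : ℝ) + 1)⁻¹ * F p ^ (n + 1)) D :=
    contDiffOn_const.mul (hF.pow _)
  have hVeq : ∀ t ∈ Ioo (-δ) δ, enclosedVolume n a b (fun x z => F ((t, x), z)) = V t := by
    intro t ht
    rw [hV]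
    simp only []
    rw [setIntegral_slab (continuousOn_slab sV.continuousOn (hmem t ht)), enclosedVolume,
      ← integral_const_mul]
    congr 1; ext θ
    rw [intervalIntegral_eq_setIntegral_Icc hab.le, ← integral_const_mul]
  have hconst : V =ᶠ[𝓝 0] fun _ => V 0 := by
    filter_upwards [isOpen_Ioo.mem_nhds h0] with t ht
    rw [← hVeq t ht, ← hVeq 0 h0, hvol t ht]
  have sV₁ : ContDiffOn ℝ ∞ (fun p => F p ^ n * u p) D := (hF.pow n).mul su
  have sV₂ : ContDiffOn ℝ ∞ (fun p => n * F p ^ (n - 1) * u p * u p + F p ^ n * u₂ p) D :=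
    (((contDiffOn_const.mul (hF.pow _)).mul su).mul su).add ((hF.pow n).mul su₂)
  have hd : ∀ t ∈ Ioo (-δ) δ, ∀ y ∈ (univ : Set (Metric.sphere (0 : Cross n) 1)) ×ˢ Icc a b,
      HasDerivAt (fun t => ((n : ℝ) + 1)⁻¹ * F ((t, (y.1 : Cross n)), y.2) ^ (n + 1))
        (F ((t, (y.1 : Cross n)), y.2) ^ n * u ((t, (y.1 : Cross n)), y.2)) t := by
    intro t ht y hy
    have h1 := hasDerivAt_dirE hF (eventually_mem_varDomain ht y.1 hy.2)
    refine ((h1.fun_pow (n + 1)).const_mul _).congr_deriv ?_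
    push_cast
    field_simp
    rfl
  have hd' : ∀ t ∈ Ioo (-δ) δ, ∀ y ∈ (univ : Set (Metric.sphere (0 : Cross n) 1)) ×ˢ Icc a b,
      HasDerivAt (fun t => F ((t, (y.1 : Cross n)), y.2) ^ n * u ((t, (y.1 : Cross n)), y.2))
        (n * F ((t, (y.1 : Cross n)), y.2) ^ (n - 1) * u ((t, (y.1 : Cross n)), y.2) *
          u ((t, (y.1 : Cross n)), y.2) +
          F ((t, (y.1 : Cross n)), y.2) ^ n * u₂ ((t, (y.1 : Cross n)), y.2)) t := by
    intro t ht y hy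
    have h1 := hasDerivAt_dirE hF (eventually_mem_varDomain ht y.1 hy.2)
    have h2 := hasDerivAt_dirE su (eventually_mem_varDomain ht y.1 hy.2)
    exact (h1.fun_pow n).fun_mul h2
  have e1 := hasDerivAt_setIntegral_param (m := slabMeasure n) isOpen_Ioo isCompact_sphere_slab
    measurableSet_sphere_slab slabMeasure_ne_top (continuousOn_slab_param sV.continuousOn hmem)
    (continuousOn_slab_param sV₁.continuousOn hmem) hd h0
  have e2 := iteratedDeriv_two_setIntegral_param (m := slabMeasure n) isOpen_Ioo
    isCompact_sphere_slab measurableSet_sphere_slab slabMeasure_ne_top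
    (continuousOn_slab_param sV.continuousOn hmem) (continuousOn_slab_param sV₁.continuousOn hmem)
    (continuousOn_slab_param sV₂.continuousOn hmem) hd hd' h0
  have e3 : HasDerivAt V 0 0 := (hasDerivAt_const (0 : ℝ) (V 0)).congr_of_eventuallyEq hconst
  have e4 : iteratedDeriv 2 V 0 = 0 := by
    rw [hconst.iteratedDeriv_eq, iteratedDeriv_const]
    simp
  constructor
  · refine Eq.trans ?_ (e1.unique e3)
    refine setIntegral_congr_fun measurableSet_sphere_slab fun y hy => ?_
    rw [hF0 y.1 y.2 hy.2]
  · refine Eq.trans ?_ (e2.symm.trans e4)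
    refine setIntegral_congr_fun measurableSet_sphere_slab fun y hy => ?_
    rw [hF0 y.1 y.2 hy.2, pow_pred_eq hn (hpos y.2 hy.2).ne']
    ring

end Variation

section Variation

open Filter Topology

variable {n : ℕ} {a b δ : ℝ} {h : ℝ → ℝ} {H : ℝ} {F : (ℝ × Cross n) × ℝ → ℝ}

/-- The restriction of a smooth function on the domain of a variation to a meridian. -/
def meridian (hab : a < b) (hδ : 0 < δ) (hF : ContDiffOn ℝ ∞ F (varDomain n a b δ))
    (θ : Metric.sphere (0 : Cross n) 1) : C1Space a b :=
  ⟨(fun z => F ((0, (θ : Cross n)), z),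
    fun z => pd (varDomain n a b δ) F (dirZ n) ((0, (θ : Cross n)), z)),
    mem_C1Space_of_hasDerivWithinAt
      ((contDiffOn_pd (uniqueDiffOn_varDomain hab) hF _).continuousOn.comp
        (Continuous.continuousOn (by fun_prop))
        fun _ hz => mem_varDomain (zero_mem_Ioo hδ) θ hz)
      fun _ hz => hasDerivWithinAt_slab hF
        (show ((0 : ℝ), (θ : Cross n)) ∈ _ from ⟨zero_mem_Ioo hδ, sphere_ne_zero θ⟩) hz⟩

lemma continuousOn_slab_snd {f : ℝ → ℝ} (hf : ContinuousOn f (Icc a b)) :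
    ContinuousOn (fun y : Metric.sphere (0 : Cross n) 1 × ℝ => f y.2) (univ ×ˢ Icc a b) :=
  hf.comp continuousOn_snd fun _ hy => hy.2

/-- The integrand of the second variation of area of a volume-preserving variation, in terms of
the variation field `u`, its slope `uz` and its squared gradient `g` along the sphere. -/
def jacobiDensity (n : ℕ) (a b : ℝ) (h : ℝ → ℝ) (z u uz g : ℝ) : ℝ :=
  sigma n a b h z * uz * uz - n * (h z ^ n / h z ^ 2 / √(1 + dz a b h z ^ 2)) * u * u +
    h z ^ n / h z ^ 2 / √(1 + dz a b h z ^ 2) * g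

lemma IsHalfPeriod.cont_sigma (hp : IsHalfPeriod n a b h H) (hab : a < b) :
    ContinuousOn (sigma n a b h) (Icc a b) :=
  (hp.data hab).σ_smooth.continuousOn

lemma IsHalfPeriod.cont_potential (hp : IsHalfPeriod n a b h H) (hab : a < b) :
    ContinuousOn (fun z => h z ^ n / h z ^ 2 / √(1 + dz a b h z ^ 2)) (Icc a b) :=
  (hp.cont_pow_div 2).div (hp.cont_sqrt hab) fun _ _ => (sqrt_one_add_sq_pos _).ne'

lemma continuousOn_jacobiDensity (hp : IsHalfPeriod n a b h H) (hab : a < b) (hδ : 0 < δ)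
    {u uz g : (ℝ × Cross n) × ℝ → ℝ} (hu : ContinuousOn u (varDomain n a b δ))
    (huz : ContinuousOn uz (varDomain n a b δ)) (hg : ContinuousOn g (varDomain n a b δ)) :
    ContinuousOn (fun y : Metric.sphere (0 : Cross n) 1 × ℝ => jacobiDensity n a b h y.2
      (u ((0, (y.1 : Cross n)), y.2)) (uz ((0, (y.1 : Cross n)), y.2))
      (g ((0, (y.1 : Cross n)), y.2))) (univ ×ˢ Icc a b) := by
  have hm : ∀ (θ : Metric.sphere (0 : Cross n) 1), ∀ z ∈ Icc a b,
      (((0 : ℝ), (θ : Cross n)), z) ∈ varDomain n a b δ :=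
    fun θ z hz => mem_varDomain (zero_mem_Ioo hδ) θ hz
  have c1 := continuousOn_slab hu hm
  have c2 := continuousOn_slab huz hm
  have c3 := continuousOn_slab hg hm
  have c4 := continuousOn_slab_snd (n := n) (hp.cont_sigma hab)
  have c5 := continuousOn_slab_snd (n := n) (hp.cont_potential hab)
  exact (((c4.mul c2).mul c2).sub (((continuousOn_const.mul c5).mul c1).mul c1)).add (c5.mul c3)

lemma IsHalfPeriod.energy_eq (hp : IsHalfPeriod n a b h H) (hab : a < b) (v : C1Space a b) :
    (hp.data hab).energy v v = ∫ z in Icc a b, jacobiDensity n a b h z (v.1.1 z) (v.1.2 z) 0 := by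
  rw [SLData.energy_apply, intervalIntegral_eq_setIntegral_Icc hab.le]
  refine setIntegral_congr_fun measurableSet_Icc fun z hz => ?_
  simp only [jacobiDensity, mul_zero, add_zero]
  rw [jacobiData_q n hab hp.smooth hp.pos hz, mul_div_assoc]
  rfl

/-- The second variation of area for volume-preserving variations. The contributions of the
second parameter derivative cancel against the second derivative of volume, because the mean
curvature is constant. -/
theorem area_second_variation (hp : IsHalfPeriod n a b h H) (hn : 1 ≤ n) (hab : a < b)
    (hδ : 0 < δ) (hF : ContDiffOn ℝ ∞ F (varDomain n a b δ))
    (hpos : ∀ t ∈ Ioo (-δ) δ, ∀ θ ∈ Metric.sphere (0 : Cross n) 1, ∀ z ∈ Icc a b, 0 < F ((t, θ), z))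
    (hstart : ∀ θ ∈ Metric.sphere (0 : Cross n) 1, ∀ z ∈ Icc a b, F ((0, θ), z) = h z)
    (hvol : ∀ t ∈ Ioo (-δ) δ, enclosedVolume n a b (fun x z => F ((t, x), z)) =
      enclosedVolume n a b (fun x z => F ((0, x), z))) :
    iteratedDeriv 2 (fun t => area n a b (fun x z => F ((t, x), z))) 0 =
      ∫ y in univ ×ˢ Icc a b, jacobiDensity n a b h y.2
        (pd (varDomain n a b δ) F (dirE n) ((0, (y.1 : Cross n)), y.2))
        (pd (varDomain n a b δ) (pd (varDomain n a b δ) F (dirE n)) (dirZ n)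
          ((0, (y.1 : Cross n)), y.2))
        (gradSq (varDomain n a b δ) (pd (varDomain n a b δ) F (dirE n)) ((0, (y.1 : Cross n)), y.2))
        ∂slabMeasure n := by
  rw [iteratedDeriv_area hn hab hδ hF hpos hstart]
  have hvar2 := (integral_variation_of_volume_eq hn hab hδ hF hp.pos hstart hvol).2
  set D := varDomain n a b δ with hD
  have hU : UniqueDiffOn ℝ D := uniqueDiffOn_varDomain hab
  set u := pd D F (dirE n) with hu
  set uz := pd D u (dirZ n) with huz
  set u₂ := pd D u (dirE n) with hu₂
  set u₂z := pd D u₂ (dirZ n) with hu₂z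
  have su : ContDiffOn ℝ ∞ u D := contDiffOn_pd hU hF _
  have suz : ContDiffOn ℝ ∞ uz D := contDiffOn_pd hU su _
  have su₂ : ContDiffOn ℝ ∞ u₂ D := contDiffOn_pd hU su _
  have su₂z : ContDiffOn ℝ ∞ u₂z D := contDiffOn_pd hU su₂ _
  have sg : ContDiffOn ℝ ∞ (gradSq D u) D := contDiffOn_gradSq hab su
  have hm : ∀ (θ : Metric.sphere (0 : Cross n) 1), ∀ z ∈ Icc a b,
      (((0 : ℝ), (θ : Cross n)), z) ∈ D := fun θ z hz => mem_varDomain (zero_mem_Ioo hδ) θ hz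
  have cu := continuousOn_slab su.continuousOn hm
  have cuz := continuousOn_slab suz.continuousOn hm
  have cu₂ := continuousOn_slab su₂.continuousOn hm
  have cu₂z := continuousOn_slab su₂z.continuousOn hm
  have cg := continuousOn_slab sg.continuousOn hm
  have k0 := continuousOn_slab_snd (n := n) hp.cont_pow
  have k1 : ContinuousOn (fun y : Metric.sphere (0 : Cross n) 1 × ℝ => h y.2 ^ n / h y.2)
      (univ ×ˢ Icc a b) := by
    have := continuousOn_slab_snd (n := n) (hp.cont_pow_div 1)
    simpa using this
  have k2 := continuousOn_slab_snd (n := n) (hp.cont_pow_div 2)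
  have ks := continuousOn_slab_snd (n := n) (hp.cont_sqrt hab)
  have ksd := continuousOn_slab_snd (n := n) (hp.cont_slope_div hab)
  have kσ := continuousOn_slab_snd (n := n) (hp.cont_sigma hab)
  have kq := continuousOn_slab_snd (n := n) (hp.cont_potential hab)
  set A : Metric.sphere (0 : Cross n) 1 × ℝ → ℝ := fun y => jacobiDensity n a b h y.2
    (u ((0, (y.1 : Cross n)), y.2)) (uz ((0, (y.1 : Cross n)), y.2))
    (gradSq D u ((0, (y.1 : Cross n)), y.2)) with hA
  set B : Metric.sphere (0 : Cross n) 1 × ℝ → ℝ := fun y =>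
    n * (h y.2 ^ n / h y.2) * (u ((0, (y.1 : Cross n)), y.2) * u ((0, (y.1 : Cross n)), y.2)) +
      h y.2 ^ n * u₂ ((0, (y.1 : Cross n)), y.2) with hB
  have cA : ContinuousOn A (univ ×ˢ Icc a b) :=
    continuousOn_jacobiDensity hp hab hδ su.continuousOn suz.continuousOn sg.continuousOn
  have cB : ContinuousOn B (univ ×ˢ Icc a b) :=
    ((continuousOn_const.mul k1).mul (cu.mul cu)).add (k0.mul cu₂)
  have cSV : ContinuousOn (fun y : Metric.sphere (0 : Cross n) 1 × ℝ =>
      secondVariation n a b h y.2 (u ((0, (y.1 : Cross n)), y.2)) (uz ((0, (y.1 : Cross n)), y.2))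
        (u₂ ((0, (y.1 : Cross n)), y.2)) (u₂z ((0, (y.1 : Cross n)), y.2))
        (gradSq D u ((0, (y.1 : Cross n)), y.2))) (univ ×ˢ Icc a b) :=
    ((((((continuousOn_const.mul k2).mul ks).mul (cu.mul cu)).add
      (((continuousOn_const.mul k1).mul ksd).mul ((cuz.mul cu).add (cu.mul cuz)))).add
      (kσ.mul (cuz.mul cuz))).add
      ((((continuousOn_const.mul k1).mul ks).mul cu₂).add ((k0.mul ksd).mul cu₂z))).add
      (kq.mul cg)
  have hmain : ∫ y in univ ×ˢ Icc a b, secondVariation n a b h y.2 (u ((0, (y.1 : Cross n)), y.2))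
      (uz ((0, (y.1 : Cross n)), y.2)) (u₂ ((0, (y.1 : Cross n)), y.2))
      (u₂z ((0, (y.1 : Cross n)), y.2)) (gradSq D u ((0, (y.1 : Cross n)), y.2)) ∂slabMeasure n =
      ∫ y in univ ×ˢ Icc a b, (A y - (n + 1) * H * B y) ∂slabMeasure n := by
    have cAB : ContinuousOn (fun y => A y - (n + 1) * H * B y) (univ ×ˢ Icc a b) :=
      cA.sub (continuousOn_const.mul cB)
    rw [setIntegral_slab cSV, setIntegral_slab cAB]
    congr 1; ext θ
    -- on each meridian, integrate by parts
    set v := meridian hab hδ su θ with hv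
    set w := meridian hab hδ su₂ θ with hw
    have e1 := hp.second_variation_eq hn hab v v
    have e2 := hp.euler_lagrange hn hab w
    rw [hp.energy_eq hab, intervalIntegral_eq_setIntegral_Icc hab.le,
      intervalIntegral_eq_setIntegral_Icc hab.le] at e1
    rw [hp.volumeForm_apply, intervalIntegral_eq_setIntegral_Icc hab.le,
      intervalIntegral_eq_setIntegral_Icc hab.le] at e2
    have ii : ∀ {f : ℝ → ℝ}, ContinuousOn f (Icc a b) → IntegrableOn f (Icc a b) :=
      fun hf => hf.integrableOn_compact isCompact_Icc
    have d1 : ContinuousOn (fun z => h z ^ n / h z) (Icc a b) := by simpa using hp.cont_pow_div 1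
    have v1 := C1Space.cont v
    have v2 := C1Space.cont' v
    have w1 := C1Space.cont w
    have w2 := C1Space.cont' w
    have g1 : ContinuousOn (fun z => gradSq D u ((0, (θ : Cross n)), z)) (Icc a b) :=
      sg.continuousOn.comp (Continuous.continuousOn (by fun_prop)) fun z hz => hm θ z hz
    have i1 := ii ((((((continuousOn_const (c := (n : ℝ) * (n - 1))).mul (hp.cont_pow_div 2)).mul
      (hp.cont_sqrt hab)).mul (v1.mul v1)).add (((((continuousOn_const (c := (n : ℝ))).mul d1).mul
      (hp.cont_slope_div hab)).mul ((v2.mul v1).add (v1.mul v2))))).add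
      ((hp.cont_sigma hab).mul (v2.mul v2)))
    have i2 := ii ((((continuousOn_const (c := (n : ℝ)).mul d1).mul (hp.cont_sqrt hab)).mul w1).add
      ((hp.cont_pow.mul (hp.cont_slope_div hab)).mul w2))
    have i3 := ii ((hp.cont_potential hab).mul g1)
    have i4 := ii ((((hp.cont_sigma hab).mul v2).mul v2).sub
      ((((continuousOn_const (c := (n : ℝ))).mul (hp.cont_potential hab)).mul v1).mul v1))
    have i5 := ii (((continuousOn_const (c := (n : ℝ))).mul d1).mul (v1.mul v1))
    have i6 := ii (hp.cont_pow.mul w1)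
    have l1 : ∫ z in Icc a b, secondVariation n a b h z (u ((0, (θ : Cross n)), z))
        (uz ((0, (θ : Cross n)), z)) (u₂ ((0, (θ : Cross n)), z)) (u₂z ((0, (θ : Cross n)), z))
        (gradSq D u ((0, (θ : Cross n)), z)) = _ :=
      (integral_add (i1.add i2) i3).trans (congrArg₂ (· + ·) (integral_add i1 i2) rfl)
    have l2 : ∫ z in Icc a b, A (θ, z) =
        (∫ z in Icc a b, (sigma n a b h z * v.1.2 z * v.1.2 z -
          n * (h z ^ n / h z ^ 2 / √(1 + dz a b h z ^ 2)) * v.1.1 z * v.1.1 z)) +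
        ∫ z in Icc a b, h z ^ n / h z ^ 2 / √(1 + dz a b h z ^ 2) *
          gradSq D u ((0, (θ : Cross n)), z) := integral_add i4 i3
    have l3 : ∫ z in Icc a b, B (θ, z) =
        (∫ z in Icc a b, n * (h z ^ n / h z) * (v.1.1 z * v.1.1 z)) +
        ∫ z in Icc a b, h z ^ n * w.1.1 z := integral_add i5 i6
    have iA : IntegrableOn (fun z => A (θ, z)) (Icc a b) := i4.add i3
    have iB : IntegrableOn (fun z => B (θ, z)) (Icc a b) := i5.add i6
    have l4 : ∫ z in Icc a b, jacobiDensity n a b h z (v.1.1 z) (v.1.2 z) 0 = _ :=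
      setIntegral_congr_fun (g := fun z => sigma n a b h z * v.1.2 z * v.1.2 z -
        n * (h z ^ n / h z ^ 2 / √(1 + dz a b h z ^ 2)) * v.1.1 z * v.1.1 z) measurableSet_Icc
        fun z _ => by simp [jacobiDensity]
    rw [l4] at e1
    have e3 : ∫ z in Icc a b, secondVariation n a b h z (u ((0, (θ : Cross n)), z))
        (uz ((0, (θ : Cross n)), z)) (u₂ ((0, (θ : Cross n)), z)) (u₂z ((0, (θ : Cross n)), z))
        (gradSq D u ((0, (θ : Cross n)), z)) =
        (∫ z in Icc a b, A (θ, z)) - (n + 1) * H * ∫ z in Icc a b, B (θ, z) := by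
      refine l1.trans ((congrArg₂ (· + ·) (congrArg₂ (· + ·) e1 e2) rfl).trans ?_)
      rw [l2, l3]
      simp only [Pi.mul_apply]
      ring
    rw [e3, integral_sub iA (iB.const_mul _), integral_const_mul]
  rw [hmain, integral_sub (integrableOn_slab cA) ((integrableOn_slab cB).const_mul _),
    integral_const_mul, hvar2, mul_zero, sub_zero]

end Variation

/-! ### Stability -/

section Stability

open Filter Topology

variable {n : ℕ} {a b δ : ℝ} {h : ℝ → ℝ} {H : ℝ} {F : (ℝ × Cross n) × ℝ → ℝ}

lemma sq_integral_sphere_le {φ : Metric.sphere (0 : Cross n) 1 → ℝ} (hφ : Continuous φ) :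
    (∫ θ, φ θ ∂(volume : Measure (Cross n)).toSphere) ^ 2 / sphereArea n ≤
      ∫ θ, φ θ ^ 2 ∂(volume : Measure (Cross n)).toSphere := by
  have hS := sphereArea_pos n
  set μ := (volume : Measure (Cross n)).toSphere with hμ
  set A := ∫ θ, φ θ ∂μ with hA
  set c := A / sphereArea n with hc
  have hmul : c * sphereArea n = A := by rw [hc]; field_simp
  have h0 : 0 ≤ ∫ θ, (φ θ - c) ^ 2 ∂μ := integral_nonneg fun θ => sq_nonneg _
  have i1 : Integrable (fun θ => φ θ ^ 2) μ := integrable_sphere (hφ.pow 2)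
  have i2 : Integrable (fun θ => 2 * c * φ θ) μ := (integrable_sphere hφ).const_mul _
  have i3 : Integrable (fun θ => φ θ ^ 2 - 2 * c * φ θ) μ := i1.sub i2
  have e1 : ∀ θ, (φ θ - c) ^ 2 = φ θ ^ 2 - 2 * c * φ θ + c ^ 2 := fun θ => by ring
  simp_rw [e1] at h0
  rw [integral_add i3 (integrable_const _), integral_sub i1 i2, integral_const_mul,
    integral_const, smul_eq_mul, ← hA, show μ.real univ = sphereArea n from rfl] at h0
  have e2 : A ^ 2 / sphereArea n = c ^ 2 * sphereArea n := by rw [← hmul]; field_simp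
  have e3 : 2 * c * A = 2 * (c ^ 2 * sphereArea n) := by rw [← hmul]; ring
  rw [e2]
  linarith

/-- The average over the parallels of a smooth function on the domain of a variation. -/
def average (hab : a < b) (hδ : 0 < δ) (hF : ContDiffOn ℝ ∞ F (varDomain n a b δ)) :
    C1Space a b :=
  ⟨(fun z => (sphereArea n)⁻¹ * ∫ θ : Metric.sphere (0 : Cross n) 1, F ((0, (θ : Cross n)), z)
      ∂(volume : Measure (Cross n)).toSphere,
    fun z => (sphereArea n)⁻¹ * ∫ θ : Metric.sphere (0 : Cross n) 1,
      pd (varDomain n a b δ) F (dirZ n) ((0, (θ : Cross n)), z)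
      ∂(volume : Measure (Cross n)).toSphere), by
    have hm : ∀ (θ : Metric.sphere (0 : Cross n) 1), ∀ z ∈ Icc a b,
        (((0 : ℝ), (θ : Cross n)), z) ∈ varDomain n a b δ :=
      fun θ z hz => mem_varDomain (zero_mem_Ioo hδ) θ hz
    have hsw : ∀ {G : (ℝ × Cross n) × ℝ → ℝ}, ContinuousOn G (varDomain n a b δ) →
        ContinuousOn (fun p : ℝ × Metric.sphere (0 : Cross n) 1 => G ((0, (p.2 : Cross n)), p.1))
          (Icc a b ×ˢ univ) := fun hG =>
      hG.comp (Continuous.continuousOn (by fun_prop)) fun p hp => hm p.2 p.1 hp.1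
    have hpd := (contDiffOn_pd (uniqueDiffOn_varDomain hab) hF (dirZ n)).continuousOn
    have c1 := continuousOn_setIntegral_param (m := (volume : Measure (Cross n)).toSphere)
      (J := Icc a b) isCompact_Icc isCompact_univ MeasurableSet.univ (measure_ne_top _ _)
      (Φ := fun z θ => F ((0, (θ : Cross n)), z)) (hsw hF.continuousOn)
    have c2 := continuousOn_setIntegral_param (m := (volume : Measure (Cross n)).toSphere)
      (J := Icc a b) isCompact_Icc isCompact_univ MeasurableSet.univ (measure_ne_top _ _)
      (Φ := fun z θ => pd (varDomain n a b δ) F (dirZ n) ((0, (θ : Cross n)), z)) (hsw hpd)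
    simp only [Measure.restrict_univ] at c1 c2
    refine ⟨continuousOn_const.mul c1, continuousOn_const.mul c2, fun z hz => ?_⟩
    have h1 := hasDerivAt_setIntegral_param (m := (volume : Measure (Cross n)).toSphere)
      (J := Ioo a b) isOpen_Ioo isCompact_univ MeasurableSet.univ (measure_ne_top _ _)
      (Φ := fun z θ => F ((0, (θ : Cross n)), z))
      (Φ' := fun z θ => pd (varDomain n a b δ) F (dirZ n) ((0, (θ : Cross n)), z))
      ((hsw hF.continuousOn).mono (prod_mono Ioo_subset_Icc_self le_rfl))
      ((hsw hpd).mono (prod_mono Ioo_subset_Icc_self le_rfl))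
      (fun z hz θ _ => (hasDerivWithinAt_slab hF
        (show ((0 : ℝ), (θ : Cross n)) ∈ _ from ⟨zero_mem_Ioo hδ, sphere_ne_zero θ⟩)
        (Ioo_subset_Icc_self hz)).hasDerivAt (Icc_mem_nhds hz.1 hz.2)) hz
    simp only [Measure.restrict_univ] at h1
    exact h1.const_mul _⟩

/-- Averaging over the parallels does not increase the second variation of area: the loss in the
zeroth order term is controlled by the gradient along the sphere. -/
lemma energy_average_le (hp : IsHalfPeriod n a b h H) (hn : 1 ≤ n) (hab : a < b) (hδ : 0 < δ)
    (hF : ContDiffOn ℝ ∞ F (varDomain n a b δ)) :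
    sphereArea n * (hp.data hab).energy (average hab hδ hF) (average hab hδ hF) ≤
      ∫ y in univ ×ˢ Icc a b, jacobiDensity n a b h y.2 (F ((0, (y.1 : Cross n)), y.2))
        (pd (varDomain n a b δ) F (dirZ n) ((0, (y.1 : Cross n)), y.2))
        (gradSq (varDomain n a b δ) F ((0, (y.1 : Cross n)), y.2)) ∂slabMeasure n := by
  have hS := sphereArea_pos n
  set D := varDomain n a b δ with hD
  set Fz := pd D F (dirZ n) with hFz
  have sFz : ContDiffOn ℝ ∞ Fz D := contDiffOn_pd (uniqueDiffOn_varDomain hab) hF _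
  have sg : ContDiffOn ℝ ∞ (gradSq D F) D := contDiffOn_gradSq hab hF
  have cA := continuousOn_jacobiDensity hp hab hδ hF.continuousOn sFz.continuousOn sg.continuousOn
  have hint := integrableOn_slab cA
  rw [IntegrableOn, slabMeasure_restrict] at hint
  rw [setIntegral_slab_symm cA, hp.energy_eq hab, ← integral_const_mul]
  set v := average hab hδ hF with hv
  have cv := C1Space.cont v
  have cv' := C1Space.cont' v
  have ci : ContinuousOn (fun z => sphereArea n * jacobiDensity n a b h z (v.1.1 z) (v.1.2 z) 0)
      (Icc a b) :=
    continuousOn_const.mul (((((hp.cont_sigma hab).mul cv').mul cv').sub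
      (((continuousOn_const.mul (hp.cont_potential hab)).mul cv).mul cv)).add
      ((hp.cont_potential hab).mul continuousOn_const))
  refine setIntegral_mono_on (ci.integrableOn_compact isCompact_Icc) hint.integral_prod_right
    measurableSet_Icc fun z hz => ?_
  have hm : ∀ (θ : Metric.sphere (0 : Cross n) 1), (((0 : ℝ), (θ : Cross n)), z) ∈ D :=
    fun θ => mem_varDomain (zero_mem_Ioo hδ) θ hz
  have hslice : ∀ {G : (ℝ × Cross n) × ℝ → ℝ}, ContinuousOn G D →
      Continuous fun θ : Metric.sphere (0 : Cross n) 1 => G ((0, (θ : Cross n)), z) := fun hG =>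
    continuousOn_univ.1 (hG.comp (Continuous.continuousOn (by fun_prop)) fun θ _ => hm θ)
  have c1 := hslice hF.continuousOn
  have c2 := hslice sFz.continuousOn
  have c3 := hslice sg.continuousOn
  have hg1 : ContDiffOn ℝ 1 (fun x => F ((0, x), z)) {0}ᶜ := by
    have : ContDiffOn ℝ ∞ (fun x => F ((0, x), z)) {0}ᶜ :=
      hF.comp (ContDiff.contDiffOn (by fun_prop)) fun x hx => ⟨⟨zero_mem_Ioo hδ, hx⟩, hz⟩
    exact this.of_le (by norm_cast)
  have hpoin := sphere_poincare hn hg1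
  simp_rw [sphGradSq_eq_gradSq hF (zero_mem_Ioo hδ) (sphere_ne_zero _) hz] at hpoin
  have hjens := sq_integral_sphere_le c2
  set μ := (volume : Measure (Cross n)).toSphere with hμ
  set k := h z ^ n / h z ^ 2 / √(1 + dz a b h z ^ 2) with hk
  have hk0 : 0 ≤ k := by
    have := hp.pos z hz
    positivity
  have hσ := ((hp.data hab).σ_pos z hz).le
  change 0 ≤ sigma n a b h z at hσ
  have i1 : Integrable (fun θ : Metric.sphere (0 : Cross n) 1 =>
      sigma n a b h z * Fz ((0, (θ : Cross n)), z) ^ 2) μ :=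
    (integrable_sphere (c2.pow 2)).const_mul _
  have i2 : Integrable (fun θ : Metric.sphere (0 : Cross n) 1 =>
      n * k * F ((0, (θ : Cross n)), z) ^ 2) μ :=
    (integrable_sphere (c1.pow 2)).const_mul _
  have i3 : Integrable (fun θ : Metric.sphere (0 : Cross n) 1 =>
      k * gradSq D F ((0, (θ : Cross n)), z)) μ := (integrable_sphere c3).const_mul _
  have i4 : Integrable (fun θ : Metric.sphere (0 : Cross n) 1 =>
      sigma n a b h z * Fz ((0, (θ : Cross n)), z) ^ 2 -
      n * k * F ((0, (θ : Cross n)), z) ^ 2) μ := i1.sub i2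
  have e1 : ∫ θ : Metric.sphere (0 : Cross n) 1, jacobiDensity n a b h z
      (F ((0, (θ : Cross n)), z)) (Fz ((0, (θ : Cross n)), z))
      (gradSq D F ((0, (θ : Cross n)), z)) ∂μ =
      sigma n a b h z * (∫ θ : Metric.sphere (0 : Cross n) 1, Fz ((0, (θ : Cross n)), z) ^ 2 ∂μ) -
      n * k * (∫ θ : Metric.sphere (0 : Cross n) 1, F ((0, (θ : Cross n)), z) ^ 2 ∂μ) +
      k * (∫ θ : Metric.sphere (0 : Cross n) 1, gradSq D F ((0, (θ : Cross n)), z) ∂μ) := by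
    rw [← integral_const_mul, ← integral_const_mul, ← integral_const_mul, ← integral_sub i1 i2,
      ← integral_add i4 i3]
    congr 1; ext θ
    rw [jacobiDensity]
    ring
  rw [e1]
  set X := ∫ θ : Metric.sphere (0 : Cross n) 1, F ((0, (θ : Cross n)), z) ∂μ with hX
  set Y := ∫ θ : Metric.sphere (0 : Cross n) 1, Fz ((0, (θ : Cross n)), z) ∂μ with hY
  have e2 : sphereArea n * jacobiDensity n a b h z (v.1.1 z) (v.1.2 z) 0 =
      sigma n a b h z * (Y ^ 2 / sphereArea n) - n * k * (X ^ 2 / sphereArea n) := by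
    have e3 : v.1.1 z = (sphereArea n)⁻¹ * X := rfl
    have e4 : v.1.2 z = (sphereArea n)⁻¹ * Y := rfl
    rw [jacobiDensity, e3, e4, ← hk]
    field_simp
    ring
  rw [e2]
  have h1 := mul_le_mul_of_nonneg_left hjens hσ
  have h2 := mul_le_mul_of_nonneg_left hpoin hk0
  linarith

/-- If the energy form is non-negative on axially symmetric variation fields that preserve volume
to first order, then the hypersurface is stable. -/
theorem isStable_of_energy_nonneg (hp : IsHalfPeriod n a b h H) (hn : 1 ≤ n) (hab : a < b)
    (hE : ∀ v : C1Space a b, hp.volumeForm hab v = 0 → 0 ≤ (hp.data hab).energy v v) :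
    IsStable n a b h := by
  intro δ hδ f hf
  have hS := sphereArea_pos n
  set F : (ℝ × Cross n) × ℝ → ℝ := fun p => f p.1.1 p.1.2 p.2 with hFdef
  have hF : ContDiffOn ℝ ∞ F (varDomain n a b δ) :=
    hf.smooth.comp (f := fun p : (ℝ × Cross n) × ℝ => (p.1.1, p.1.2, p.2))
      (ContDiff.contDiffOn (by fun_prop)) fun p hp => ⟨hp.1.1, hp.1.2, hp.2⟩
  have key := area_second_variation (F := F) hp hn hab hδ hF hf.pos hf.start hf.volume_eq
  have hvol := (integral_variation_of_volume_eq hn hab hδ hF hp.pos hf.start hf.volume_eq).1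
  set u := pd (varDomain n a b δ) F (dirE n) with hu
  have su : ContDiffOn ℝ ∞ u (varDomain n a b δ) := contDiffOn_pd (uniqueDiffOn_varDomain hab) hF _
  have h1 := energy_average_le hp hn hab hδ su
  rw [← key] at h1
  refine le_trans (mul_nonneg hS.le (hE _ ?_)) h1
  have hm : ∀ (θ : Metric.sphere (0 : Cross n) 1), ∀ z ∈ Icc a b,
      (((0 : ℝ), (θ : Cross n)), z) ∈ varDomain n a b δ :=
    fun θ z hz => mem_varDomain (zero_mem_Ioo hδ) θ hz
  have cw : ContinuousOn (fun y : Metric.sphere (0 : Cross n) 1 × ℝ =>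
      h y.2 ^ n * u ((0, (y.1 : Cross n)), y.2)) (univ ×ˢ Icc a b) :=
    (continuousOn_slab_snd hp.cont_pow).mul (continuousOn_slab su.continuousOn hm)
  rw [setIntegral_slab_symm cw] at hvol
  rw [hp.volumeForm_apply, intervalIntegral_eq_setIntegral_Icc hab.le]
  have h2 : ∀ z, h z ^ n * (average hab hδ su).1.1 z = (sphereArea n)⁻¹ *
      ∫ θ : Metric.sphere (0 : Cross n) 1, h z ^ n * u ((0, (θ : Cross n)), z)
        ∂(volume : Measure (Cross n)).toSphere := fun z => by
    rw [integral_const_mul]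
    change h z ^ n * ((sphereArea n)⁻¹ * _) = _
    ring
  simp_rw [h2]
  rw [integral_const_mul, hvol, mul_zero]

end Stability

/-! ### Instability -/

section Instability

open Filter Topology

variable {n : ℕ} {a b : ℝ} {h : ℝ → ℝ} {H : ℝ}

/-- An axially symmetric variation that preserves volume exactly, with variation field `v`. -/
def symmetricVariation (n : ℕ) (h v : ℝ → ℝ) (ε : ℝ) (_ : Cross n) (z : ℝ) : ℝ :=
  (h z ^ (n + 1) + (n + 1) * ε * (h z ^ n * v z)) ^ (((n + 1 : ℕ) : ℝ)⁻¹)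

lemma exists_symmetricVariation_pos (hp : IsHalfPeriod n a b h H) (hab : a < b) {v : ℝ → ℝ}
    (hv : ContinuousOn v (Icc a b)) : ∃ δ > 0, ∀ ε ∈ Ioo (-δ) δ, ∀ z ∈ Icc a b,
      0 < h z ^ (n + 1) + (n + 1) * ε * (h z ^ n * v z) := by
  obtain ⟨M, hM⟩ := isCompact_Icc.exists_bound_of_continuousOn hv
  obtain ⟨z₀, hz₀, hmin⟩ := isCompact_Icc.exists_isMinOn (nonempty_Icc.2 hab.le) hp.cont
  have hm := hp.pos z₀ hz₀
  have hM0 : 0 ≤ M := (norm_nonneg _).trans (hM z₀ hz₀)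
  have hn0 : (0 : ℝ) < n + 1 := by positivity
  refine ⟨h z₀ / ((n + 1) * (M + 1)), by positivity, fun ε hε z hz => ?_⟩
  have h1 : |ε| < h z₀ / ((n + 1) * (M + 1)) := abs_lt.2 hε
  rw [lt_div_iff₀ (by positivity)] at h1
  have h2 : h z₀ ≤ h z := hmin hz
  have h3 : |(n + 1) * ε * v z| ≤ |ε| * ((n + 1) * (M + 1)) := by
    rw [abs_mul, abs_mul, abs_of_pos hn0]
    have := mul_le_mul_of_nonneg_left ((hM z hz).trans (by linarith : M ≤ M + 1))
      (mul_nonneg hn0.le (abs_nonneg ε))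
    rw [Real.norm_eq_abs] at this
    linarith
  have h4 := (abs_le.1 h3).1
  have h5 : h z ^ (n + 1) + (n + 1) * ε * (h z ^ n * v z) =
      h z ^ n * (h z + (n + 1) * ε * v z) := by ring
  rw [h5]
  exact mul_pos (pow_pos (hp.pos z hz) n) (by linarith)

lemma isVolumePreservingVariation_symmetricVariation (hp : IsHalfPeriod n a b h H) (hab : a < b)
    {v : ℝ → ℝ} (hv : ContDiffOn ℝ ∞ v (Icc a b)) (hvol : ∫ z in a..b, h z ^ n * v z = 0) {δ : ℝ}
    (hδ : ∀ ε ∈ Ioo (-δ) δ, ∀ z ∈ Icc a b,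
      0 < h z ^ (n + 1) + (n + 1) * ε * (h z ^ n * v z)) :
    IsVolumePreservingVariation n a b h δ (symmetricVariation n h v) := by
  have hpow : ∀ ε ∈ Ioo (-δ) δ, ∀ (x : Cross n), ∀ z ∈ Icc a b,
      symmetricVariation n h v ε x z ^ (n + 1) = h z ^ (n + 1) + (n + 1) * ε * (h z ^ n * v z) :=
    fun ε hε x z hz => Real.rpow_inv_natCast_pow (hδ ε hε z hz).le (Nat.succ_ne_zero n)
  have hV : ∀ ε ∈ Ioo (-δ) δ, enclosedVolume n a b (symmetricVariation n h v ε) =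
      ((n : ℝ) + 1)⁻¹ * (sphereArea n * ∫ z in a..b, h z ^ (n + 1)) := by
    intro ε hε
    have h1 : ∀ x : Cross n, ∫ z in a..b, symmetricVariation n h v ε x z ^ (n + 1) =
        ∫ z in a..b, h z ^ (n + 1) := by
      intro x
      have h2 : ∫ z in a..b, symmetricVariation n h v ε x z ^ (n + 1) =
          ∫ z in a..b, (h z ^ (n + 1) + (n + 1) * ε * (h z ^ n * v z)) := by
        refine intervalIntegral.integral_congr fun z hz => ?_
        rw [uIcc_of_le hab.le] at hz
        exact hpow ε hε x z hz
      have i1 : IntervalIntegrable (fun z => h z ^ (n + 1)) volume a b :=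
        intervalIntegrable_of_continuousOn_Icc hab.le (hp.cont.pow _)
      have i2 : IntervalIntegrable (fun z => h z ^ n * v z) volume a b :=
        intervalIntegrable_of_continuousOn_Icc hab.le (hp.cont_pow.mul hv.continuousOn)
      rw [h2, intervalIntegral.integral_add i1 (i2.const_mul _),
        intervalIntegral.integral_const_mul, hvol, mul_zero, add_zero]
    rw [enclosedVolume]
    simp_rw [h1]
    rw [integral_const, smul_eq_mul]
    rfl
  refine ⟨?_, fun ε hε θ _ z hz => Real.rpow_pos_of_pos (hδ ε hε z hz) _, fun θ _ z hz => ?_,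
    fun ε hε => ?_⟩
  · have hz : MapsTo (fun p : ℝ × Cross n × ℝ => p.2.2)
        (Ioo (-δ) δ ×ˢ ({0}ᶜ : Set (Cross n)) ×ˢ Icc a b) (Icc a b) := fun p hp => hp.2.2
    have h1 : ContDiffOn ℝ ∞ (fun p : ℝ × Cross n × ℝ => h p.2.2)
        (Ioo (-δ) δ ×ˢ ({0}ᶜ : Set (Cross n)) ×ˢ Icc a b) :=
      hp.smooth.comp (ContDiff.contDiffOn (by fun_prop)) hz
    have h2 : ContDiffOn ℝ ∞ (fun p : ℝ × Cross n × ℝ => v p.2.2)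
        (Ioo (-δ) δ ×ˢ ({0}ᶜ : Set (Cross n)) ×ˢ Icc a b) :=
      hv.comp (ContDiff.contDiffOn (by fun_prop)) hz
    have h3 : ContDiffOn ℝ ∞ (fun p : ℝ × Cross n × ℝ => ((n : ℝ) + 1) * p.1)
        (Ioo (-δ) δ ×ˢ ({0}ᶜ : Set (Cross n)) ×ˢ Icc a b) :=
      ContDiff.contDiffOn (by fun_prop)
    exact ((h1.pow (n + 1)).add (h3.mul ((h1.pow n).mul h2))).rpow_const_of_ne fun p hp =>
      (hδ p.1 hp.1 p.2.2 hp.2.2).ne'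
  · rw [symmetricVariation, mul_zero, zero_mul, add_zero]
    exact Real.pow_rpow_inv_natCast (hp.pos z hz).le (Nat.succ_ne_zero n)
  · rw [hV ε hε, hV 0 ⟨by linarith [hε.1, hε.2], by linarith [hε.1, hε.2]⟩]

/-- If the energy form is negative on some smooth axially symmetric variation field that preserves
volume to first order, then the hypersurface is unstable. -/
theorem not_isStable_of_energy_neg (hp : IsHalfPeriod n a b h H) (hn : 1 ≤ n) (hab : a < b)
    {v : C1Space a b} (hv : ContDiffOn ℝ ∞ v.1.1 (Icc a b)) (hvol : hp.volumeForm hab v = 0)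
    (hE : (hp.data hab).energy v v < 0) : ¬ IsStable n a b h := by
  intro hst
  have hS := sphereArea_pos n
  obtain ⟨δ, hδ, hpos⟩ := exists_symmetricVariation_pos hp hab hv.continuousOn
  have hf := isVolumePreservingVariation_symmetricVariation hp hab hv hvol hpos
  have h0 := hst δ hδ _ hf
  set f := symmetricVariation n h v.1.1 with hfdef
  set F : (ℝ × Cross n) × ℝ → ℝ := fun p => f p.1.1 p.1.2 p.2 with hFdef
  have hF : ContDiffOn ℝ ∞ F (varDomain n a b δ) :=
    hf.smooth.comp (f := fun p : (ℝ × Cross n) × ℝ => (p.1.1, p.1.2, p.2))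
      (ContDiff.contDiffOn (by fun_prop)) fun p hp => ⟨hp.1.1, hp.1.2, hp.2⟩
  have key := area_second_variation (F := F) hp hn hab hδ hF hf.pos hf.start hf.volume_eq
  set D := varDomain n a b δ with hD
  set u := pd D F (dirE n) with hu
  have su : ContDiffOn ℝ ∞ u D := contDiffOn_pd (uniqueDiffOn_varDomain hab) hF _
  have hz0 := zero_mem_Ioo hδ
  have hu0 : ∀ x : Cross n, x ≠ 0 → ∀ z ∈ Icc a b, u ((0, x), z) = v.1.1 z := by
    intro x hx z hz
    have hev : ∀ᶠ τ in 𝓝 (0 : ℝ), ((τ, x), z) ∈ D := by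
      filter_upwards [isOpen_Ioo.mem_nhds hz0] with τ hτ using ⟨⟨hτ, hx⟩, hz⟩
    have h1 := (hasDerivAt_dirE hF hev).fun_pow (n + 1)
    have h2 : HasDerivAt (fun ε : ℝ => h z ^ (n + 1) + (n + 1) * ε * (h z ^ n * v.1.1 z))
        ((n + 1) * (h z ^ n * v.1.1 z)) 0 := by
      have := (((hasDerivAt_id (0 : ℝ)).const_mul ((n : ℝ) + 1)).mul_const
        (h z ^ n * v.1.1 z)).const_add (h z ^ (n + 1))
      simpa using this
    have h3 : (fun ε => F ((ε, x), z) ^ (n + 1)) =ᶠ[𝓝 0]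
        fun ε : ℝ => h z ^ (n + 1) + (n + 1) * ε * (h z ^ n * v.1.1 z) := by
      filter_upwards [isOpen_Ioo.mem_nhds hz0] with ε hε
      exact Real.rpow_inv_natCast_pow (hpos ε hε z hz).le (Nat.succ_ne_zero n)
    have h4 := (h2.congr_of_eventuallyEq h3).unique h1
    have h5 : F ((0, x), z) = h z := by
      change (h z ^ (n + 1) + (n + 1) * 0 * (h z ^ n * v.1.1 z)) ^ (((n + 1 : ℕ) : ℝ)⁻¹) = h z
      rw [mul_zero, zero_mul, add_zero]
      exact Real.pow_rpow_inv_natCast (hp.pos z hz).le (Nat.succ_ne_zero n)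
    rw [h5] at h4
    have hhz := pow_pos (hp.pos z hz) n
    have hn0 : (0 : ℝ) < n + 1 := by positivity
    push_cast at h4
    rw [mul_assoc] at h4
    exact (mul_left_cancel₀ hhz.ne' (mul_left_cancel₀ hn0.ne' h4)).symm
  have hgrad : ∀ (θ : Metric.sphere (0 : Cross n) 1), ∀ z ∈ Icc a b,
      gradSq D u ((0, (θ : Cross n)), z) = 0 := by
    intro θ z hz
    rw [← sphGradSq_eq_gradSq su hz0 (sphere_ne_zero θ) hz]
    have h1 : (fun y => u ((0, y), z)) =ᶠ[𝓝 (θ : Cross n)] fun _ => v.1.1 z := by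
      filter_upwards [isOpen_compl_singleton.mem_nhds (sphere_ne_zero θ)] with x hx
      exact hu0 x hx z hz
    rw [sphGradSq, h1.fderiv_eq]
    simp
  have suz : ContDiffOn ℝ ∞ (pd D u (dirZ n)) D := contDiffOn_pd (uniqueDiffOn_varDomain hab) su _
  have sg : ContDiffOn ℝ ∞ (gradSq D u) D := contDiffOn_gradSq hab su
  have cA := continuousOn_jacobiDensity hp hab hδ su.continuousOn suz.continuousOn sg.continuousOn
  rw [setIntegral_slab cA] at key
  have hmer : ∀ θ : Metric.sphere (0 : Cross n) 1, ∫ z in Icc a b, jacobiDensity n a b h z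
      (u ((0, (θ : Cross n)), z)) (pd D u (dirZ n) ((0, (θ : Cross n)), z))
      (gradSq D u ((0, (θ : Cross n)), z)) = (hp.data hab).energy v v := by
    intro θ
    rw [hp.energy_eq hab, integral_Icc_eq_integral_Ioo, integral_Icc_eq_integral_Ioo]
    refine setIntegral_congr_fun measurableSet_Ioo fun z hz => ?_
    have hz' := Ioo_subset_Icc_self hz
    rw [hu0 θ (sphere_ne_zero θ) z hz', hgrad θ z hz']
    congr 1
    -- the slope of `u` is the derivative of `v`
    have h1 := (hasDerivWithinAt_slab su (show ((0 : ℝ), (θ : Cross n)) ∈ _ from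
      ⟨hz0, sphere_ne_zero θ⟩) hz').hasDerivAt (Icc_mem_nhds hz.1 hz.2)
    refine (h1.congr_of_eventuallyEq ?_).unique (C1Space.hasDerivAt v hz)
    filter_upwards [Icc_mem_nhds hz.1 hz.2] with t ht
    exact (hu0 θ (sphere_ne_zero θ) t ht).symm
  simp only [hmer] at key
  rw [integral_const, smul_eq_mul] at key
  have h1 : iteratedDeriv 2 (fun ε => area n a b (f ε)) 0 =
      sphereArea n * (hp.data hab).energy v v := key
  rw [h1] at h0
  exact absurd h0 (not_le.2 (mul_neg_of_pos_of_neg hS hE))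

end Instability

/-! ### The stability criterion -/

section Criterion

variable {n : ℕ} {a b : ℝ} {h : ℝ → ℝ} {H : ℝ}

lemma IsHalfPeriod.volumeForm_one_pos (hp : IsHalfPeriod n a b h H) (hab : a < b) :
    0 < hp.volumeForm hab (C1Space.one a b) := by
  rw [hp.volumeForm_apply]
  have hpos : ∀ z ∈ Icc a b, 0 < h z ^ n * (C1Space.one a b).1.1 z := fun z hz => by
    have := pow_pos (hp.pos z hz) n
    change 0 < h z ^ n * 1
    linarith
  exact intervalIntegral.integral_pos hab (hp.cont_pow.mul (C1Space.cont _))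
    (fun z hz => (hpos z (Ioc_subset_Icc_self hz)).le)
    ⟨a, left_mem_Icc.2 hab.le, hpos a (left_mem_Icc.2 hab.le)⟩

/-- Dilations of the cross-section decrease area to second order. -/
lemma IsHalfPeriod.energy_one_neg (hp : IsHalfPeriod n a b h H) (hn : 1 ≤ n) (hab : a < b) :
    (hp.data hab).energy (C1Space.one a b) (C1Space.one a b) < 0 := by
  have hpos : ∀ z ∈ Icc a b, 0 < h z ^ n / h z ^ 2 / √(1 + dz a b h z ^ 2) := fun z hz =>
    div_pos (div_pos (pow_pos (hp.pos z hz) n) (pow_pos (hp.pos z hz) 2)) (sqrt_one_add_sq_pos _)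
  have h1 : 0 < ∫ z in a..b, h z ^ n / h z ^ 2 / √(1 + dz a b h z ^ 2) :=
    intervalIntegral.integral_pos hab (hp.cont_potential hab)
      (fun z hz => (hpos z (Ioc_subset_Icc_self hz)).le)
      ⟨a, left_mem_Icc.2 hab.le, hpos a (left_mem_Icc.2 hab.le)⟩
  have h2 : (hp.data hab).energy (C1Space.one a b) (C1Space.one a b) =
      -(n * ∫ z in a..b, h z ^ n / h z ^ 2 / √(1 + dz a b h z ^ 2)) := by
    rw [hp.energy_eq hab, intervalIntegral_eq_setIntegral_Icc hab.le, ← integral_const_mul,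
      ← integral_neg]
    refine setIntegral_congr_fun measurableSet_Icc fun z _ => ?_
    change jacobiDensity n a b h z 1 0 0 = _
    simp [jacobiDensity]
  have hn0 : (0 : ℝ) < n := by exact_mod_cast hn
  rw [h2, neg_lt_zero]
  exact mul_pos hn0 h1

/-- The lowest eigenvalue is negative, with an eigenfunction whose orthogonal complement is
controlled by the second eigenvalue. -/
lemma IsHalfPeriod.exists_ground_state (hp : IsHalfPeriod n a b h H) (hn : 1 ≤ n) (hab : a < b) :
    ∃ (lam : ℝ) (φ : C1Space a b), (hp.data hab).eigenvalue 1 ≤ lam ∧ lam < 0 ∧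
      0 < (hp.data hab).mass φ φ ∧
      (∀ v, (hp.data hab).energy φ v = lam * (hp.data hab).mass φ v) ∧
      ContDiffOn ℝ ∞ φ.1.1 (Icc a b) ∧
      ∀ v, (hp.data hab).mass φ v = 0 →
        (hp.data hab).eigenvalue 2 * (hp.data hab).mass v v ≤ (hp.data hab).energy v v := by
  obtain ⟨lam, φ, h1, h2, h3, h4, h5, h6⟩ := (hp.data hab).exists_first_eigenfunction
  refine ⟨lam, φ, h1, ?_, h2, h3, h4, h6⟩
  have h7 := (h5 (C1Space.one a b)).trans_lt (hp.energy_one_neg hn hab)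
  have h8 := (hp.data hab).mass_nonneg (C1Space.one a b)
  by_contra! h9
  exact absurd h7 (not_lt.2 (mul_nonneg h9 h8))

lemma IsHalfPeriod.eigenvalue_one_neg (hp : IsHalfPeriod n a b h H) (hn : 1 ≤ n) (hab : a < b) :
    (hp.data hab).eigenvalue 1 < 0 := by
  obtain ⟨lam, φ, h1, h2, -⟩ := hp.exists_ground_state hn hab
  exact h1.trans_lt h2

/-- Two negative eigenvalues leave a negative direction among the volume-preserving fields. -/
lemma IsHalfPeriod.not_isStable_of_eigenvalue_two_neg (hp : IsHalfPeriod n a b h H) (hn : 1 ≤ n)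
    (hab : a < b) (h2 : (hp.data hab).eigenvalue 2 < 0) : ¬ IsStable n a b h := by
  obtain ⟨μ, ν, hne, hμ, hν, eμ, eν⟩ := (hp.data hab).exists_two_of_eigenvalue_two_neg h2
  obtain ⟨φ, hφ, hφe, hφs⟩ := eμ.exists_energy_eq
  obtain ⟨ψ, hψ, hψe, hψs⟩ := eν.exists_energy_eq
  obtain ⟨s, t, hl, hB⟩ := neg_on_ker_of_two (hp.data hab).energy_comm (hp.data hab).mass_comm
    (hp.volumeForm hab) hφe hψe hne hμ hν hφ hψ
  exact not_isStable_of_energy_neg hp hn hab ((hφs.const_smul s).add (hψs.const_smul t)) hl hB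

/-- A field `w` that represents a multiple `c` of the first variation of volume decides stability
if the second eigenvalue is non-negative and `c ≠ 0`. -/
lemma IsHalfPeriod.isStable_of_field (hp : IsHalfPeriod n a b h H) (hn : 1 ≤ n)
    (hab : a < b) (h2 : 0 ≤ (hp.data hab).eigenvalue 2) {w : C1Space a b} {c : ℝ} (hc : c ≠ 0)
    (hw : ∀ v, (hp.data hab).energy w v = c * hp.volumeForm hab v)
    (hcw : c * hp.volumeForm hab w ≤ 0) : IsStable n a b h := by
  obtain ⟨lam, φ, -, -, hφ, hφe, -, hφ2⟩ := hp.exists_ground_state hn hab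
  refine isStable_of_energy_nonneg hp hn hab fun v hv => ?_
  exact nonneg_on_ker (hp.data hab).energy_comm hφe hφ.ne'
    (fun x hx => (mul_nonneg h2 ((hp.data hab).mass_nonneg x)).trans (hφ2 x hx)) hw hc
    (by rw [hw]; exact hcw) ⟨_, (hp.volumeForm_one_pos hab).ne'⟩ hv

/-- The ground state, corrected by a multiple of `w` so as to preserve volume, is a negative
direction if `c` has the right sign. -/
lemma IsHalfPeriod.not_isStable_of_field (hp : IsHalfPeriod n a b h H) (hn : 1 ≤ n)
    (hab : a < b) {w : C1Space a b} (hws : ContDiffOn ℝ ∞ w.1.1 (Icc a b)) {c : ℝ}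
    (hw : ∀ v, (hp.data hab).energy w v = c * hp.volumeForm hab v)
    (hlw : hp.volumeForm hab w ≠ 0) (hcw : 0 ≤ c * hp.volumeForm hab w) :
    ¬ IsStable n a b h := by
  obtain ⟨lam, φ, -, hlam, hφ, hφe, hφs, -⟩ := hp.exists_ground_state hn hab
  have hneg : (hp.data hab).energy φ φ < 0 := by
    rw [hφe]; exact mul_neg_of_neg_of_pos hlam hφ
  obtain ⟨h1, h3⟩ := neg_on_ker_of_proj (hp.data hab).energy_comm hneg hw hlw hcw
  have hsm := hφs.sub (hws.const_smul (hp.volumeForm hab φ / hp.volumeForm hab w))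
  exact not_isStable_of_energy_neg hp hn hab hsm h1 h3

/-- A non-trivial field in the kernel of the energy form excludes a positive second eigenvalue. -/
lemma IsHalfPeriod.eigenvalue_two_nonpos (hp : IsHalfPeriod n a b h H) (hn : 1 ≤ n)
    (hab : a < b) {w : C1Space a b} (hw : ∀ v, (hp.data hab).energy w v = 0)
    (hne : ∃ z ∈ Icc a b, w.1.1 z ≠ 0) : (hp.data hab).eigenvalue 2 ≤ 0 := by
  obtain ⟨lam, φ, -, hlam, -, hφe, -, hφ2⟩ := hp.exists_ground_state hn hab
  have h1 := hφe w
  rw [(hp.data hab).energy_comm, hw] at h1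
  have h3 := hφ2 w ((mul_eq_zero.1 h1.symm).resolve_left hlam.ne)
  rw [hw] at h3
  exact nonpos_of_mul_nonpos_left h3 ((hp.data hab).mass_pos w hne)

end Criterion

end Unduloid

end

theorem mainTheorem1 (n : ℕ) (hn : 1 ≤ n) (z₁ z₂ : ℝ) (hz : z₁ < z₂)
    (I : Set ℝ) (hI : IsOpen I) (h : ℝ → ℝ → ℝ) (H V : ℝ → ℝ) (ev : ℕ → ℝ → ℝ)
    (hsmooth : ContDiffOn ℝ ∞ (fun p : ℝ × ℝ => h p.1 p.2) (I ×ˢ Set.Icc z₁ z₂))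
    (hund : ∀ s ∈ I, Unduloid.IsHalfPeriod n z₁ z₂ (h s) (H s))
    (hpar : ∀ s ∈ I, Unduloid.nonuniformness z₁ z₂ (h s) = s)
    (hV : ∀ s ∈ I, V s = Unduloid.profileVolume n z₁ z₂ (h s))
    (hev : ∀ i, ∀ s ∈ I, ev i s = Unduloid.neumannEigenvalue n z₁ z₂ (h s) i)
    (s : ℝ) (hs : s ∈ I) :
    (0 ≤ ev 1 s → Unduloid.IsStable n z₁ z₂ (h s)) ∧
    (ev 1 s < 0 → 0 < ev 2 s →
      (0 ≤ deriv H s * deriv V s → Unduloid.IsStable n z₁ z₂ (h s)) ∧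
      (deriv H s * deriv V s < 0 → ¬ Unduloid.IsStable n z₁ z₂ (h s))) ∧
    (ev 2 s = 0 →
      (deriv H s = 0 → deriv V s ≠ 0 → ¬ Unduloid.IsStable n z₁ z₂ (h s)) ∧
      (deriv H s ≠ 0 →
        (0 ≤ deriv H s * deriv V s → Unduloid.IsStable n z₁ z₂ (h s)) ∧
        (deriv H s * deriv V s < 0 → ¬ Unduloid.IsStable n z₁ z₂ (h s)))) ∧
    (ev 2 s < 0 → ¬ Unduloid.IsStable n z₁ z₂ (h s)) := by
  have hp := hund s hs
  set S := hp.data hz with hS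
  have hev1 : ev 1 s = S.eigenvalue 1 :=
    (hev 1 s hs).trans (Unduloid.neumannEigenvalue_eq hz hp.smooth hp.pos 1)
  have hev2 : ev 2 s = S.eigenvalue 2 :=
    (hev 2 s hs).trans (Unduloid.neumannEigenvalue_eq hz hp.smooth hp.pos 2)
  obtain ⟨w, hws, hwd, hwe, hwV⟩ := Unduloid.exists_family_field hn hz hI hsmooth hund hs
  have hwne := Unduloid.family_field_ne_zero hz hI hund hpar hs hwd
  have hA := Unduloid.sphereArea_pos n
  have hn0 : (0 : ℝ) < n + 1 := by positivity
  have hV' : deriv V s = Unduloid.sphereArea n * hp.volumeForm hz w :=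
    (hwV.congr_of_eventuallyEq (Filter.eventuallyEq_of_mem (hI.mem_nhds hs) hV)).deriv
  set l := hp.volumeForm hz w with hl
  -- the sign of `H' V'` is the opposite of the sign of the energy of `w`
  have hprod : deriv H s * deriv V s =
      -(-((n + 1) * deriv H s) * l) * (Unduloid.sphereArea n / (n + 1)) := by
    rw [hV']
    field_simp
  have hfac : 0 < Unduloid.sphereArea n / ((n : ℝ) + 1) := div_pos hA hn0
  have hstab : 0 ≤ S.eigenvalue 2 → deriv H s ≠ 0 → 0 ≤ deriv H s * deriv V s →
      Unduloid.IsStable n z₁ z₂ (h s) := fun h2 hH hHV => by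
    refine hp.isStable_of_field hn hz h2 (neg_ne_zero.2 (mul_ne_zero hn0.ne' hH)) hwe ?_
    rw [hprod] at hHV
    exact neg_nonneg.1 (nonneg_of_mul_nonneg_left hHV hfac)
  have hunst : deriv H s * deriv V s < 0 → ¬ Unduloid.IsStable n z₁ z₂ (h s) := fun hHV => by
    have h1 : hp.volumeForm hz w ≠ 0 := fun h0 => by
      rw [hV', hl, h0, mul_zero, mul_zero] at hHV
      exact lt_irrefl _ hHV
    refine hp.not_isStable_of_field hn hz hws hwe h1 ?_
    rw [hprod] at hHV
    exact (neg_neg_iff_pos.1 (neg_of_mul_neg_left hHV hfac.le)).le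
  refine ⟨fun h1 => ?_, fun _ h2 => ⟨fun hHV => ?_, hunst⟩, fun h2 => ⟨fun hH hVne => ?_,
    fun hH => ⟨hstab (hev2 ▸ h2.ge) hH, hunst⟩⟩, fun h2 => ?_⟩
  · -- the first eigenvalue is always negative
    exact absurd (hev1 ▸ hp.eigenvalue_one_neg hn hz) (not_lt.2 h1)
  · -- `H' = 0` would put `w` into the kernel of the energy form
    rw [hev2] at h2
    refine hstab h2.le (fun hH => ?_) hHV
    refine absurd (hp.eigenvalue_two_nonpos hn hz (fun v => ?_) hwne) (not_le.2 h2)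
    rw [hwe v, hH, mul_zero, neg_zero, zero_mul]
  · refine hp.not_isStable_of_field hn hz hws hwe (fun h0 => hVne ?_) ?_
    · rw [hV', hl, h0, mul_zero]
    · rw [hH, mul_zero, neg_zero, zero_mul]
  · exact hp.not_isStable_of_eigenvalue_two_neg hn hz (hev2 ▸ h2)
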